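/- Let $n\ge 4$. Let $I_n=\{\pm1,\dots,\pm n\}$, let $E_{i,j}$ ($i,j\in I_n$) be the matrix units of $\mathfrak{gl}(2n)$, and let $\tau$ be the Lie algebra automorphism of $\mathfrak{gl}(2n)[u^{\pm1},v]$ over $\mathbb C$ with $\tau(E_{i,j}u^rv^s)=-(-1)^sE_{-j,-i}u^rv^s$. Let $\mathfrak{sl}(2n)[u^{\pm1},v]^\tau$ be the Lie algebra of $\tau$-fixed elements of $\mathfrak{sl}(2n)[u^{\pm1},v]$, and put $f^{r,s}_{i,j}=(E_{i,j}-(-1)^sE_{-j,-i})u^rv^s$. Let $(a^{0}_{i,j})_{0\le i,j\le n}$ be the Cartan matrix of type $D_n^{(1)}$, with edges $0-2$, $k-(k+1)$ for $1\le k\le n-2$, and $(n-2)-n$. Put $a^{r}_{i,j}=a^0_{i,j}$ for $r$ even. For $r$ odd and $1\le i\le n-1$ put $a^r_{i,j}=a^0_{i,j}$, except that $a^r_{1,0}=a^r_{n-1,n}=2$. Call $(0,1),(1,0),(n-1,n),(n,n-1)$ the exceptional pairs. Let $D(2n)$ be the complex Lie algebra with generators $H_{i,r}$ ($1\le i\le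 n-1$, $r\ge0$), $H_{0,r},H_{n,r}$ ($r\ge 0$ even), $X^\pm_{i,r}$ ($0\le i\le n$, $r\ge0$), $X^\pm_{-1,r},X^\pm_{n+1,r}$ ($r\ge 1$ odd) and the following relations, for all indices for which the symbols are generators: 1. $[H_{i,r},H_{j,s}]=0$; $[H_{i,r},X^\pm_{j,s}]=\pm a^r_{i,j}X^\pm_{j,r+s}$ for $0\le j\le n$. 2. $[X^+_{i,r},X^-_{j,s}]=0$ for $0\le i\ne j\le n$ with $(i,j)$ not exceptional; $[X^+_{i,r},X^-_{i,s}]=H_{i,r+s}$ for $1\le i\le n-1$; $[X^+_{n,r},X^-_{n,s}]$ is $H_{n,r+s}$ if $r+s$ is even and $H_{n-1,r+s}$ if $r+s$ is odd; $[X^+_{0,r},X^-_{0,s}]$ is $H_{0,r+s}$ if $r+s$ is even and $H_{1,r+s}$ if $r+s$ is odd. 3. If $r+s$ is odd, then $[X^+_{n-1,r},X^-_{n,s}]=-X^-_{n+1,r+s}$, $[X^+_{n,r},X^-_{n-1,s}]=-X^+_{n+1,r+s}$, $[X^+_{0,r},X^-_{1,s}]=-X^+_{-1,r+s}$, $[X^+_{1,r},X^-_{0,s}]=-X^-_{-1,r+s}$;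 if $r+s$ is even, these four brackets are $0$. 4. For all choices of the signs, $[X^{\pm}_{i,r},X^{\pm}_{n+1,s}]=0$ for $1\le i\le n-2$ and $[X^\pm_{i,r},X^\pm_{-1,s}]=0$ for $2\le i\le n+1$. 5. $[X^\pm_{n-1,r},X^\pm_{n+1,s}]=\pm2X^\pm_{n,r+s}$, $[X^\mp_{n-1,r},X^\pm_{n+1,s}]=0$, $[X^\pm_{n,r},X^\pm_{n+1,s}]=0$, $[X^\mp_{n,r},X^\pm_{n+1,s}]=\mp2X^\mp_{n-1,r+s}$. 6. $[X^\pm_{0,r},X^\pm_{-1,s}]=0$, $[X^\mp_{0,r},X^\pm_{-1,s}]=\mp2X^\mp_{1,r+s}$, $[X^\pm_{1,r},X^\pm_{-1,s}]=\pm2X^\pm_{0,r+s}$, $[X^\mp_{1,r},X^\pm_{-1,s}]=0$. 7. $[X^\pm_{i,r},X^\pm_{i,s}]=0$; $[X^\pm_{i,r+1},X^\pm_{j,s}]=[X^\pm_{i,r},X^\pm_{j,s+1}]$ for $0\le i\le j\le n$ with $(i,j)$ not exceptional; $[X^\pm_{i,r+1},X^\pm_{j,s}]=-[X^\pm_{i,r},X^\pm_{j,s+1}]$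 for $(i,j)=(0,1),(n-1,n)$. 8. $[X^\pm_{i,r},X^\pm_{j,s}]=0$ for $0\le i\neq j\le n$ with $a^0_{i,j}=0$, if $(i,j)$ is not exceptional or $r+s$ is even; $[X^\pm_{i,r},[X^\pm_{i,s},X^\pm_{j,t}]]=0$ if $a^0_{i,j}=-1$; $[X^\pm_{i,0},[X^\pm_{i,0},X^\pm_{j,r}]]=0$ if $(i,j)$ is exceptional and $r$ is odd. 9. $[X^+_{1,1},[X^-_{1,0},h_p]]=[X^+_{1,0},[X^-_{1,1},h_p]]$ for $p\in\mathbb Z$, where $h_p$ is the element $(f_{1,1}-f_{2,2})t^p$, $f_{i,j}=E_{i,j}-E_{-j,-i}$, of the affine Lie algebra $\widehat{\mathfrak{so}}(2n)$ (for $p=0$ the coroot of $\alpha_1$), written through the Chevalley generators $X^\pm_{i,0},H_{i,0}$ ($0\le i\le n$), which are normalized by $X^+_{i,0}=f_{i,i+1}$, $X^-_{i,0}=f_{i+1,i}$ for $1\le i\le n-1$, $X^+_{n,0}=f_{n-1,-n}$, $X^-_{n,0}=f_{-n,n-1}$, $X^+_{0,0}=f_{-2,1}t$, $X^-_{0,0}=f_{1,-2}t^{-1}$.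 Let $Q=\bigoplus_{i=0}^n\mathbb Z\alpha_i$ be the root lattice and $\Delta\subset Q$ the set of (real and imaginary) roots of $\widehat{\mathfrak{so}}(2n)$, let $\delta=\alpha_0+\alpha_1+2\sum_{j=2}^{n-2}\alpha_j+\alpha_{n-1}+\alpha_n$, and let $$\Delta^{\mathrm{ex}}=\Delta\cup\Big\{\pm\Big(2\sum_{j=i}^{n-2}\alpha_j+\alpha_{n-1}+\alpha_n\Big)+s\delta,\ \pm(\alpha_{n-1}-\alpha_n)+s\delta,\ \pm(\alpha_0-\alpha_1)+s\delta\ \Big|\ 1\le i\le n-1,\ s\in\mathbb Z\Big\}.$$ Assign the degrees $\deg H_{i,r}=(0,r)$, $\deg X^\pm_{i,r}=(\pm\alpha_i,r)$ for $0\le i\le n$, $\deg X^\pm_{n+1,r}=(\pm(\alpha_n-\alpha_{n-1}),r)$, $\deg X^\pm_{-1,r}=(\pm(\alpha_0-\alpha_1),r)$, and let $D(2n)_\alpha^k$ be the span of the iterated brackets of generators of total degree $(\alpha,k)$. **Theorem.** The spaces $D(2n)_\alpha^k$ form a grading $D(2n)=\bigoplus_{(\alpha,k)\in Q\times\mathbb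 Z_{\ge0}}D(2n)_\alpha^k$. For every $k\ge0$: * if $\alpha\in\Delta^{\mathrm{ex}}\setminus\mathbb Z\delta$, then $\dim D(2n)_\alpha^k=1$ when $\alpha\in\Delta$ or $k$ is odd, and $\dim D(2n)_\alpha^k=0$ when $\alpha\notin\Delta$ and $k$ is even; * if $\alpha\notin\Delta^{\mathrm{ex}}\cup\{0\}$, then $\dim D(2n)_\alpha^k=0$. Moreover, there is a surjective Lie algebra homomorphism $\pi\colon D(2n)\to\mathfrak{sl}(2n)[u^{\pm1},v]^\tau$ whose kernel is contained in the center of $D(2n)$, so that $D(2n)$ is a central extension of $\mathfrak{sl}(2n)[u^{\pm1},v]^\tau$; it is given on the generators by $H_{i,r}\mapsto f^{0,r}_{i,i}-f^{0,r}_{i+1,i+1}$, $X^+_{i,r}\mapsto f^{0,r}_{i,i+1}$, $X^-_{i,r}\mapsto f^{0,r}_{i+1,i}$ ($1\le i\le n-1$); $H_{n,r}\mapsto f^{0,r}_{n-1,n-1}+f^{0,r}_{n,n}$, $X^+_{n,r}\mapsto f^{0,r}_{n-1,-n}$, $X^-_{n,r}\mapsto f^{0,r}_{-n,n-1}$; $H_{0,r}\mapsto-(f^{0,r}_{1,1}+f^{0,r}_{2,2})$,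 $X^+_{0,r}\mapsto(-1)^rf^{1,r}_{-2,1}$, $X^-_{0,r}\mapsto(-1)^rf^{-1,r}_{1,-2}$; $X^+_{n+1,r}\mapsto f^{0,r}_{n,-n}$, $X^-_{n+1,r}\mapsto f^{0,r}_{-n,n}$, $X^+_{-1,r}\mapsto f^{1,r}_{-1,1}$, $X^-_{-1,r}\mapsto f^{-1,r}_{1,-1}$. -/

import Mathlib

noncomputable section

namespace TwistedD

/-! ### The Lie algebra `sl(2n)[u^{±1}, v]^τ` -/

/-- The coefficient ring `ℂ[u^{±1}, v]`, as polynomials in `v` over Laurent polynomials in `u`. -/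
abbrev Coeff : Type := Polynomial (LaurentPolynomial ℂ)

/-- The monomial `u^r v^s`. -/
def mono (r : ℤ) (s : ℕ) : Coeff := Polynomial.monomial s (LaurentPolynomial.T r)

/-- The algebra endomorphism `u ↦ u`, `v ↦ -v` of `ℂ[u^{±1}, v]`. -/
def vNeg : Coeff →ₐ[ℂ] Coeff :=
  (Polynomial.aeval (-Polynomial.X) : Coeff →ₐ[LaurentPolynomial ℂ] Coeff).restrictScalars ℂ

/-- The index set `I_n = {±1, …, ±n}`. -/
abbrev Idx (n : ℕ) : Type := {i : ℤ // i ∈ (Finset.Icc (-(n : ℤ)) n).erase 0}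

/-- The involution `i ↦ -i` of `I_n`. -/
def Idx.neg {n : ℕ} (i : Idx n) : Idx n :=
  ⟨-i.1, by
    have h := i.2
    simp only [Finset.mem_erase, Finset.mem_Icc] at h ⊢
    omega⟩

theorem Idx.neg_bijective (n : ℕ) : Function.Bijective (Idx.neg (n := n)) :=
  Function.Involutive.bijective fun i => Subtype.ext (neg_neg i.1)

/-- `gl(2n)[u^{±1}, v]`. -/
abbrev Gl (n : ℕ) : Type := Matrix (Idx n) (Idx n) Coeff

/-- `gl(2n)[u^{±1}, v]` is a complex Lie algebra through the commutator `[A, B] = AB - BA`. -/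
instance glLieRing (n : ℕ) : LieRing (Gl n) := LieRing.ofAssociativeRing

instance glLieAlgebra (n : ℕ) : LieAlgebra ℂ (Gl n) := LieAlgebra.ofAssociativeAlgebra

/-- The element `E_{i,j} u^r v^s` of `gl(2n)[u^{±1}, v]`. -/
def E (n : ℕ) (i j r : ℤ) (s : ℕ) : Gl n :=
  Matrix.of fun p q => if p.1 = i ∧ q.1 = j then mono r s else 0

/-- The element `f_{i,j}^{r,s} = (E_{i,j} - (-1)^s E_{-j,-i}) u^r v^s`. -/
def f (n : ℕ) (i j r : ℤ) (s : ℕ) : Gl n :=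
  E n i j r s - (-1 : ℤ) ^ s • E n (-j) (-i) r s

/-- The Lie algebra automorphism `τ` with `τ(E_{i,j} u^r v^s) = -(-1)^s E_{-j,-i} u^r v^s`. -/
def tau (n : ℕ) (M : Gl n) : Gl n :=
  Matrix.of fun p q => -vNeg (M q.neg p.neg)

theorem tau_E (n : ℕ) (i j r : ℤ) (s : ℕ) :
    tau n (E n i j r s) = -((-1 : ℤ) ^ s • E n (-j) (-i) r s) := by
  have hv : vNeg (mono r s) = (-1 : ℤ) ^ s • mono r s := by
    have h : vNeg (mono r s) =
        Polynomial.C (LaurentPolynomial.T r) * (-Polynomial.X : Coeff) ^ s := by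
      simp only [vNeg, mono, AlgHom.restrictScalars_apply, Polynomial.aeval_monomial,
        Polynomial.algebraMap_eq]
    rw [h, neg_pow, mono, ← Polynomial.C_mul_X_pow_eq_monomial, zsmul_eq_mul]
    push_cast
    ring
  ext1 p q
  have hc : ((q.neg.1 = i ∧ p.neg.1 = j) ↔ (p.1 = -j ∧ q.1 = -i)) := by
    simp only [Idx.neg]
    omega
  simp only [tau, E, Matrix.of_apply, Matrix.neg_apply, Matrix.smul_apply]
  by_cases h : p.1 = -j ∧ q.1 = -i
  · rw [if_pos (hc.2 h), if_pos h, hv]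
  · rw [if_neg (fun h' => h (hc.1 h')), if_neg h]
    simp

theorem tau_mul (n : ℕ) (A B : Gl n) : tau n (A * B) = -(tau n B * tau n A) := by
  have key : ∀ x y : Coeff, -x * -y = y * x := fun x y => by ring
  ext1 p q
  have h1 : tau n (A * B) p q = -∑ j, vNeg (A q.neg j) * vNeg (B j p.neg) := by
    simp only [tau, Matrix.of_apply, Matrix.mul_apply, map_sum, map_mul]
  have h2 : (tau n B * tau n A) p q = ∑ j : Idx n, vNeg (A q.neg j.neg) * vNeg (B j.neg p.neg) := by
    simp only [tau, Matrix.of_apply, Matrix.mul_apply]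
    exact Finset.sum_congr rfl fun j _ => key _ _
  rw [Matrix.neg_apply, h1, h2,
    (Idx.neg_bijective n).sum_comp fun j => vNeg (A q.neg j) * vNeg (B j p.neg)]

theorem tau_lie (n : ℕ) (A B : Gl n) : tau n ⁅A, B⁆ = ⁅tau n A, tau n B⁆ := by
  have hs : tau n (A * B - B * A) = tau n (A * B) - tau n (B * A) := by
    ext1 p q
    simp only [tau, Matrix.of_apply, Matrix.sub_apply, map_sub]
    ring
  rw [LieRing.of_associative_ring_bracket, LieRing.of_associative_ring_bracket, hs, tau_mul,
    tau_mul]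
  abel

/-- `sl(2n)[u^{±1}, v]^τ`: the traceless matrices over `ℂ[u^{±1}, v]` that are fixed by `τ`. -/
def slTau (n : ℕ) : LieSubalgebra ℂ (Gl n) where
  carrier := {M | M.trace = 0 ∧ tau n M = M}
  add_mem' := by
    rintro A B ⟨hA, hA'⟩ ⟨hB, hB'⟩
    refine ⟨by rw [Matrix.trace_add, hA, hB, add_zero], ?_⟩
    conv_rhs => rw [← hA', ← hB']
    ext1 p q
    simp only [tau, Matrix.of_apply, Matrix.add_apply, map_add]
    ring
  zero_mem' := by
    refine ⟨Matrix.trace_zero _ _, ?_⟩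
    ext1 p q
    simp [tau]
  smul_mem' := by
    rintro c A ⟨hA, hA'⟩
    refine ⟨by rw [Matrix.trace_smul, hA, smul_zero], ?_⟩
    conv_rhs => rw [← hA']
    ext1 p q
    simp [tau]
  lie_mem' := by
    rintro A B ⟨_, hA'⟩ ⟨_, hB'⟩
    refine ⟨?_, by rw [tau_lie, hA', hB']⟩
    rw [LieRing.of_associative_ring_bracket, Matrix.trace_sub, Matrix.trace_mul_comm, sub_self]

/-! ### The Lie algebra `D(2n)` -/

/-- `i — j` is an edge of the Dynkin diagram of type `D_n^{(1)}` with nodes `0, …, n`, written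
with its smaller end first. -/
def Edge (n : ℕ) (i j : ℤ) : Prop :=
  (i = 0 ∧ j = 2) ∨ (1 ≤ i ∧ i ≤ n - 2 ∧ j = i + 1) ∨ (i = n - 2 ∧ j = n)

open Classical in
/-- The integers `a^r_{i,j}`: for `r` even this is the Cartan matrix of type `D_n^{(1)}`; for `r`
odd (where only the rows `1 ≤ i ≤ n - 1` are used) the entries `(1, 0)` and `(n - 1, n)` are
changed to `2`. -/
def a (n r : ℕ) (i j : ℤ) : ℤ :=
  if i = j then 2
  else if Odd r ∧ ((i = 1 ∧ j = 0) ∨ (i = n - 1 ∧ j = n)) then 2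
  else if Edge n i j ∨ Edge n j i then -1
  else 0

/-- The symbols `H_{i,r}` and `X^±_{i,r}`; the sign is an element of `ℤˣ = {1, -1}`. -/
inductive Symb : Type
  | H (i : ℤ) (r : ℕ)
  | X (e : ℤˣ) (i : ℤ) (r : ℕ)

/-- The symbols that are generators of `D(2n)`: `H_{i,r}` with `1 ≤ i ≤ n - 1`, or `i ∈ {0, n}`
and `r` even; `X^±_{i,r}` with `0 ≤ i ≤ n`, or `i ∈ {-1, n + 1}` and `r` odd. -/
def IsGen (n : ℕ) : Symb → Prop
  | .H i r => (1 ≤ i ∧ i ≤ n - 1) ∨ ((i = 0 ∨ i = n) ∧ Even r)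
  | .X _ i r => (0 ≤ i ∧ i ≤ n) ∨ ((i = -1 ∨ i = n + 1) ∧ Odd r)

/-- The generators of `D(2n)`. -/
abbrev Gen (n : ℕ) : Type := {g : Symb // IsGen n g}

/-- The free Lie algebra on the generators. -/
abbrev Free (n : ℕ) : Type := FreeLieAlgebra ℂ (Gen n)

open Classical in
/-- A symbol as an element of the free Lie algebra (`0` if it is not a generator). -/
def sym (n : ℕ) (g : Symb) : Free n :=
  if h : IsGen n g then FreeLieAlgebra.of ℂ ⟨g, h⟩ else 0

/-- `H_{i,r}`. -/
def H (n : ℕ) (i : ℤ) (r : ℕ) : Free n := sym n (.H i r)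

/-- `X^±_{i,r}`. -/
def X (n : ℕ) (e : ℤˣ) (i : ℤ) (r : ℕ) : Free n := sym n (.X e i r)

/-- `[x, y]` for the sign `+`, and `[y, x]` for the sign `-`. -/
def sbr {n : ℕ} (e : ℤˣ) (x y : Free n) : Free n := (e : ℤ) • ⁅x, y⁆

/-- For the sign `+`, the root vector `f_{2,m+3}` of `so(2n)`, `m + 3 ≤ n - 1`, as an iterated
bracket of Chevalley generators; for the sign `-`, its transpose. -/
def rootA (n : ℕ) (e : ℤˣ) : ℕ → Free n
  | 0 => X n e 2 0
  | m + 1 => sbr e (rootA n e m) (X n e (m + 3) 0)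

/-- For the sign `+`, the root vector `f_{2,-(n-m)}` of `so(2n)`, `3 ≤ n - m`; for the sign `-`,
its transpose. -/
def rootB (n : ℕ) (e : ℤˣ) : ℕ → Free n
  | 0 => sbr e (rootA n e (n - 4)) (X n e n 0)
  | m + 1 => -sbr e (rootB n e m) (X n e (n - 1 - m) 0)

/-- For the sign `+`, the element `f_{2,1} t` of the affine Lie algebra of `so(2n)`; for the
sign `-`, its transpose `f_{1,2} t^{-1}`. -/
def rootC (n : ℕ) (e : ℤˣ) : Free n :=
  -sbr e (rootB n e (n - 3)) (sbr e (X n e 2 0) (X n e 0 0))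

/-- For the sign `+`, the element `f_{2,1} t^{m+1}`; for the sign `-`, `f_{1,2} t^{-(m+1)}`. -/
def loopRoot (n : ℕ) (e : ℤˣ) : ℕ → Free n
  | 0 => rootC n e
  | m + 1 => -((1 / 2 : ℂ) • sbr e (sbr e (X n e 1 0) (rootC n e)) (loopRoot n e m))

/-- The element `(f_{1,1} - f_{2,2}) t^p` of the affine Lie algebra of `so(2n)` (the one that is
written `(E_{1,1} - E_{2,2}) t^p` for short), in terms of the Chevalley generators `X^±_{i,0}`,
`H_{i,0}`. -/
def loopH (n : ℕ) : ℤ → Free n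
  | .ofNat 0 => H n 1 0
  | .ofNat (m + 1) => sbr 1 (X n 1 1 0) (loopRoot n 1 m)
  | .negSucc m => sbr (-1) (X n (-1) 1 0) (loopRoot n (-1) m)

/-- The unordered pair `{i, j}` is `{0, 1}` or `{n - 1, n}`. -/
def Exc (n : ℕ) (i j : ℤ) : Prop :=
  (i = 0 ∧ j = 1) ∨ (i = 1 ∧ j = 0) ∨ (i = n - 1 ∧ j = n) ∨ (i = n ∧ j = n - 1)

open Classical in
/-- The defining relations of `D(2n)`: `Rel n x y` stands for the relation `x = y`. -/
inductive Rel (n : ℕ) : Free n → Free n → Prop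
  | hh (i j : ℤ) (r s : ℕ) : Rel n ⁅H n i r, H n j s⁆ 0
  | hx (e : ℤˣ) (i j : ℤ) (r s : ℕ) (hi : IsGen n (.H i r)) (hj : 0 ≤ j ∧ j ≤ n) :
      Rel n ⁅H n i r, X n e j s⁆ (((e : ℤ) * a n r i j) • X n e j (r + s))
  | xx_ne (i j : ℤ) (r s : ℕ) (hi : 0 ≤ i ∧ i ≤ n) (hj : 0 ≤ j ∧ j ≤ n) (hij : i ≠ j)
      (hexc : ¬ Exc n i j) : Rel n ⁅X n 1 i r, X n (-1) j s⁆ 0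
  | xx_eq (i : ℤ) (r s : ℕ) (hi : 1 ≤ i ∧ i ≤ n - 1) :
      Rel n ⁅X n 1 i r, X n (-1) i s⁆ (H n i (r + s))
  | xx_n (r s : ℕ) :
      Rel n ⁅X n 1 n r, X n (-1) n s⁆ (if Even (r + s) then H n n (r + s) else H n (n - 1) (r + s))
  | xx_zero (r s : ℕ) :
      Rel n ⁅X n 1 0 r, X n (-1) 0 s⁆ (if Even (r + s) then H n 0 (r + s) else H n 1 (r + s))
  | exc_n₁ (r s : ℕ) : Rel n ⁅X n 1 (n - 1) r, X n (-1) n s⁆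
      (if Odd (r + s) then -X n (-1) (n + 1) (r + s) else 0)
  | exc_n₂ (r s : ℕ) : Rel n ⁅X n 1 n r, X n (-1) (n - 1) s⁆
      (if Odd (r + s) then -X n 1 (n + 1) (r + s) else 0)
  | exc_zero₁ (r s : ℕ) : Rel n ⁅X n 1 0 r, X n (-1) 1 s⁆
      (if Odd (r + s) then -X n 1 (-1) (r + s) else 0)
  | exc_zero₂ (r s : ℕ) : Rel n ⁅X n 1 1 r, X n (-1) 0 s⁆
      (if Odd (r + s) then -X n (-1) (-1) (r + s) else 0)
  | top_comm (e e' : ℤˣ) (i : ℤ) (r s : ℕ) (hi : 1 ≤ i ∧ i ≤ n - 2) (hs : Odd s) :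
      Rel n ⁅X n e i r, X n e' (n + 1) s⁆ 0
  | bot_comm (e e' : ℤˣ) (i : ℤ) (r s : ℕ) (hi : 2 ≤ i ∧ i ≤ n + 1) (hs : Odd s) :
      Rel n ⁅X n e i r, X n e' (-1) s⁆ 0
  | top₁ (e : ℤˣ) (r s : ℕ) (hs : Odd s) :
      Rel n ⁅X n e (n - 1) r, X n e (n + 1) s⁆ ((2 * (e : ℤ)) • X n e n (r + s))
  | top₂ (e : ℤˣ) (r s : ℕ) (hs : Odd s) : Rel n ⁅X n (-e) (n - 1) r, X n e (n + 1) s⁆ 0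
  | top₃ (e : ℤˣ) (r s : ℕ) (hs : Odd s) : Rel n ⁅X n e n r, X n e (n + 1) s⁆ 0
  | top₄ (e : ℤˣ) (r s : ℕ) (hs : Odd s) :
      Rel n ⁅X n (-e) n r, X n e (n + 1) s⁆ (-((2 * (e : ℤ)) • X n (-e) (n - 1) (r + s)))
  | bot₁ (e : ℤˣ) (r s : ℕ) (hs : Odd s) : Rel n ⁅X n e 0 r, X n e (-1) s⁆ 0
  | bot₂ (e : ℤˣ) (r s : ℕ) (hs : Odd s) :
      Rel n ⁅X n (-e) 0 r, X n e (-1) s⁆ (-((2 * (e : ℤ)) • X n (-e) 1 (r + s)))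
  | bot₃ (e : ℤˣ) (r s : ℕ) (hs : Odd s) :
      Rel n ⁅X n e 1 r, X n e (-1) s⁆ ((2 * (e : ℤ)) • X n e 0 (r + s))
  | bot₄ (e : ℤˣ) (r s : ℕ) (hs : Odd s) : Rel n ⁅X n (-e) 1 r, X n e (-1) s⁆ 0
  | same (e : ℤˣ) (i : ℤ) (r s : ℕ) : Rel n ⁅X n e i r, X n e i s⁆ 0
  | shift (e : ℤˣ) (i j : ℤ) (r s : ℕ) (hi : 0 ≤ i) (hij : i ≤ j) (hj : j ≤ n)
      (hexc : ¬ Exc n i j) :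
      Rel n ⁅X n e i (r + 1), X n e j s⁆ ⁅X n e i r, X n e j (s + 1)⁆
  | shift_zero (e : ℤˣ) (r s : ℕ) :
      Rel n ⁅X n e 0 (r + 1), X n e 1 s⁆ (-⁅X n e 0 r, X n e 1 (s + 1)⁆)
  | shift_n (e : ℤˣ) (r s : ℕ) :
      Rel n ⁅X n e (n - 1) (r + 1), X n e n s⁆ (-⁅X n e (n - 1) r, X n e n (s + 1)⁆)
  | serre_zero (e : ℤˣ) (i j : ℤ) (r s : ℕ) (hi : 0 ≤ i ∧ i ≤ n) (hj : 0 ≤ j ∧ j ≤ n)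
      (hij : i ≠ j) (ha : a n 0 i j = 0) (h : ¬ Exc n i j ∨ Even (r + s)) :
      Rel n ⁅X n e i r, X n e j s⁆ 0
  | serre (e : ℤˣ) (i j : ℤ) (r s t : ℕ) (hi : 0 ≤ i ∧ i ≤ n) (hj : 0 ≤ j ∧ j ≤ n)
      (ha : a n 0 i j = -1) : Rel n ⁅X n e i r, ⁅X n e i s, X n e j t⁆⁆ 0
  | serre_exc (e : ℤˣ) (i j : ℤ) (r : ℕ) (h : Exc n i j) (hr : Odd r) :
      Rel n ⁅X n e i 0, ⁅X n e i 0, X n e j r⁆⁆ 0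
  | loop (p : ℤ) :
      Rel n (⁅X n 1 1 1, ⁅X n (-1) 1 0, loopH n p⁆⁆ - ⁅X n 1 1 0, ⁅X n (-1) 1 1, loopH n p⁆⁆) 0

/-- The ideal of the free Lie algebra generated by the defining relations. -/
def relIdeal (n : ℕ) : LieIdeal ℂ (Free n) :=
  LieSubmodule.lieSpan ℂ (Free n) {z | ∃ x y, Rel n x y ∧ z = x - y}

/-- The complex Lie algebra `D(2n)`. -/
abbrev D (n : ℕ) : Type := Free n ⧸ relIdeal n

/-- The quotient map from the free Lie algebra to `D(2n)`. -/
def toD (n : ℕ) (x : Free n) : D n := LieSubmodule.Quotient.mk x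

/-! ### Roots -/

/-- The root lattice `Q = ⊕_{i=0}^n ℤ α_i`. -/
abbrev Q (n : ℕ) : Type := Fin (n + 1) → ℤ

/-- The simple root `α_j`, `0 ≤ j ≤ n`. -/
def simple (n : ℕ) (j : ℤ) : Q n := fun k => if (k : ℤ) = j then 1 else 0

/-- `δ = α_0 + α_1 + 2 (α_2 + ⋯ + α_{n-2}) + α_{n-1} + α_n`. -/
def delta (n : ℕ) : Q n :=
  simple n 0 + simple n 1 + (2 : ℤ) • ∑ k ∈ Finset.Icc (2 : ℤ) (n - 2), simple n k
    + simple n (n - 1) + simple n n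

/-- `2 (α_i + ⋯ + α_{n-2}) + α_{n-1} + α_n`, which is `2ε_i`, for `1 ≤ i ≤ n - 1`. -/
def long (n : ℕ) (i : ℤ) : Q n :=
  (2 : ℤ) • (∑ k ∈ Finset.Icc i (n - 2), simple n k) + simple n (n - 1) + simple n n

/-- `ε_i - ε_j = α_i + ⋯ + α_{j-1}`, for `1 ≤ i < j ≤ n`. -/
def epsSub (n : ℕ) (i j : ℤ) : Q n := ∑ k ∈ Finset.Icc i (j - 1), simple n k

/-- `ε_i + ε_j = (ε_i - ε_j) + 2ε_j`, for `1 ≤ i < j ≤ n`, where `2ε_n = α_n - α_{n-1}`. -/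
def epsAdd (n : ℕ) (i j : ℤ) : Q n :=
  epsSub n i j + if j = n then simple n n - simple n (n - 1) else long n j

/-- The roots `±ε_i ± ε_j`, `1 ≤ i < j ≤ n`, of the finite-dimensional Lie algebra `so(2n)`. -/
def finRoots (n : ℕ) : Set (Q n) :=
  {α | ∃ i j : ℤ, 1 ≤ i ∧ i < j ∧ j ≤ n ∧ ∃ e : ℤˣ,
    α = (e : ℤ) • epsSub n i j ∨ α = (e : ℤ) • epsAdd n i j}

/-- The set `Δ` of roots of the affine Lie algebra of `so(2n)`: the `β + sδ` with `β` a root of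
`so(2n)` and `s ∈ ℤ`, and the `sδ` with `s ≠ 0`. -/
def roots (n : ℕ) : Set (Q n) :=
  {α | ∃ β ∈ finRoots n, ∃ s : ℤ, α = β + s • delta n} ∪ {α | ∃ s : ℤ, s ≠ 0 ∧ α = s • delta n}

/-- The extended set of roots `Δ^ex`. -/
def extRoots (n : ℕ) : Set (Q n) :=
  roots n ∪ {α | ∃ e : ℤˣ, ∃ s : ℤ,
    (∃ i : ℤ, 1 ≤ i ∧ i ≤ n - 1 ∧ α = (e : ℤ) • long n i + s • delta n) ∨
    α = (e : ℤ) • (simple n (n - 1) - simple n n) + s • delta n ∨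
    α = (e : ℤ) • (simple n 0 - simple n 1) + s • delta n}

/-! ### The grading of `D(2n)` by `Q × ℤ≥0` -/

/-- The degrees of the generators. -/
def deg (n : ℕ) : Symb → Q n × ℕ
  | .H _ r => (0, r)
  | .X e i r =>
    ((e : ℤ) • (if i = n + 1 then simple n n - simple n (n - 1)
      else if i = -1 then simple n 0 - simple n 1 else simple n i), r)

/-- Iterated brackets of generators of `D(2n)`, with their degrees. -/
inductive IsMonomial (n : ℕ) : D n → Q n × ℕ → Prop
  | gen (g : Gen n) : IsMonomial n (toD n (FreeLieAlgebra.of ℂ g)) (deg n g.1)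
  | lie {x y : D n} {d d' : Q n × ℕ} (hx : IsMonomial n x d) (hy : IsMonomial n y d') :
      IsMonomial n ⁅x, y⁆ (d + d')

/-- The graded piece `D(2n)_α^k`: the span of the iterated brackets of degree `(α, k)`. -/
def piece (n : ℕ) (α : Q n) (k : ℕ) : Submodule ℂ (D n) :=
  Submodule.span ℂ {x | IsMonomial n x (α, k)}

/-! ### The map to `sl(2n)[u^{±1}, v]^τ` -/

/-- The matrices over `ℂ[u^{±1}, v]` that correspond to the generators of `D(2n)`. -/
def image (n : ℕ) : Symb → Gl n
  | .H i r =>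
    if i = 0 then -(f n 1 1 0 r + f n 2 2 0 r)
    else if i = n then f n (n - 1) (n - 1) 0 r + f n n n 0 r
    else f n i i 0 r - f n (i + 1) (i + 1) 0 r
  | .X e i r =>
    if e = 1 then
      if i = -1 then f n (-1) 1 1 r
      else if i = 0 then (-1 : ℤ) ^ r • f n (-2) 1 1 r
      else if i = n then f n (n - 1) (-n) 0 r
      else if i = n + 1 then f n n (-n) 0 r
      else f n i (i + 1) 0 r
    else
      if i = -1 then f n 1 (-1) (-1) r
      else if i = 0 then (-1 : ℤ) ^ r • f n 1 (-2) (-1) r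
      else if i = n then f n (-n) (n - 1) 0 r
      else if i = n + 1 then f n (-n) n 0 r
      else f n (i + 1) i 0 r

end TwistedD

end

noncomputable section

namespace TwistedD

/-! ### Brackets of the elements `f_{i,j}^{r,s}` -/

/-! The map `π` exists because the matrices satisfy the defining relations (`phi_rel`). Each `f` is
`(1 + τ)E`, so the bracket of two of them has only four possible contractions (`lie_f`), and every
relation becomes a comparison of indices and signs.

The relations are homogeneous, so `g ↦ T^{deg g} ⊗ g` extends to a Lie homomorphism from `D(2n)` to
`ℂ[Q × ℕ] ⊗ D(2n)` (`coact`). Reading off the coefficient of `T^d` is a projection onto the piece of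
degree `d`, which gives the grading (`isInternal_piece`).

The upper bound on the dimensions imitates Kac–Moody theory. The algebra is the sum of a positive
subalgebra, a negative subalgebra and the span of the `H_{i,r}`, `X^±_{n+1,r}`, `X^±_{-1,r}`
(`triangular`). Hence a degree `α ≠ 0` that occurs has coefficients of one sign, or is `±(α_n -
α_{n-1})` or `±(α_0 - α_1)`; among the non-zero multiples of a simple root only `±α_i` can occur,
with a piece spanned by one generator. The Serre relations make `ad X^±_{i,0}` locally nilpotent
(`engel_xD`), so the representation theory of `sl(2)` shows that dimensions are invariant under the
simple reflections (`rank_piece_le_refl`). A positive `α` outside `ℤδ` pairs positively with some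
simple coroot, and reflecting in it lowers the height. This descent stops where one more reflection
destroys positivity, and by the restriction on degrees this happens only next to the degree of a
generator (`exists_conj_gen`). So pieces outside `ℤδ` have dimension at most one. Modulo `δ` the
reflections are signed permutations of the `ε_l`, so `α` is `±ε_i ± ε_j` with `i ≠ j`, or `±2ε_i`,
the latter only for odd `k` because `X^±_{n+1,k}` and `X^±_{-1,k}` are generators only then.

For the lower bound, every `f_{p,q}^{r,s}` with `p ≠ q` is the image of a homogeneous element of the
expected degree (`lifts`). Therefore the dimensions outside `ℤδ` are as claimed and `π` is injective
on these pieces (`eq_zero_of_piD_eq_zero`).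

Since `π` respects degrees, its kernel is graded (`piD_proj_eq_zero`), hence concentrated in degrees
from `ℤδ`. The bracket of a kernel element with `X^±_{i,r}` then lies in the kernel and in degrees
outside `ℤδ`, so it vanishes: the kernel is central. Surjectivity follows because a `τ`-fixed
traceless `M` equals `(1 + τ)M / 2`, and `1 + τ` sends traceless matrices to combinations of the
`f_{p,q}`, `p ≠ q`, and the `f_{p,p} - f_{q,q}`, all of which are in the range. -/

theorem mono_mul (r r' : ℤ) (s s' : ℕ) : mono r s * mono r' s' = mono (r + r') (s + s') := by
  rw [mono, mono, Polynomial.monomial_mul_monomial, ← LaurentPolynomial.T_add, mono]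

theorem mem_idx {n : ℕ} {i : ℤ} :
    i ∈ (Finset.Icc (-(n : ℤ)) n).erase 0 ↔ i ≠ 0 ∧ -(n : ℤ) ≤ i ∧ i ≤ n := by
  simp

theorem E_mul (n : ℕ) (i j k l r r' : ℤ) (s s' : ℕ) (hj : j ≠ 0 ∧ -(n : ℤ) ≤ j ∧ j ≤ n) :
    E n i j r s * E n k l r' s' = if j = k then E n i l (r + r') (s + s') else 0 := by
  ext1 p q
  rw [Matrix.mul_apply]
  simp only [E, Matrix.of_apply]
  rw [Finset.sum_eq_single (⟨j, mem_idx.2 hj⟩ : Idx n)]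
  · by_cases h1 : p.1 = i <;> by_cases h2 : j = k <;> by_cases h3 : q.1 = l <;>
      simp [h1, h2, h3, mono_mul]
  · intro b _ hb
    have : b.1 ≠ j := fun h => hb (Subtype.ext h)
    simp [this]
  · simp

theorem f_flip (n : ℕ) (i j r : ℤ) (s : ℕ) :
    f n (-j) (-i) r s = -((-1 : ℤ) ^ s • f n i j r s) := by
  rcases Nat.even_or_odd s with h | h <;> simp [f, h.neg_one_pow]

/-- Writing `f = (1 + τ)E`, one has `[(1 + τ)A, (1 + τ)B] = (1 + τ)([A, B] + [τA, B])`. The first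
summand gives the two direct contractions, the second the two that carry the sign `-(-1)^s`. All
later computations with matrices reduce to this formula. -/
theorem lie_f (n : ℕ) (i j k l r r' : ℤ) (s s' : ℕ) (hi : i ≠ 0 ∧ -(n : ℤ) ≤ i ∧ i ≤ n)
    (hj : j ≠ 0 ∧ -(n : ℤ) ≤ j ∧ j ≤ n) (hk : k ≠ 0 ∧ -(n : ℤ) ≤ k ∧ k ≤ n)
    (hl : l ≠ 0 ∧ -(n : ℤ) ≤ l ∧ l ≤ n) :
    ⁅f n i j r s, f n k l r' s'⁆ =
      ((if j = k then f n i l (r + r') (s + s') else 0) -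
        (if l = i then f n k j (r + r') (s + s') else 0)) -
      (-1 : ℤ) ^ s • ((if k = -i then f n (-j) l (r + r') (s + s') else 0) -
        (if l = -j then f n k (-i) (r + r') (s + s') else 0)) := by
  have hni : -i ≠ 0 ∧ -(n : ℤ) ≤ -i ∧ -i ≤ n := by omega
  have hnj : -j ≠ 0 ∧ -(n : ℤ) ≤ -j ∧ -j ≤ n := by omega
  have hnk : -k ≠ 0 ∧ -(n : ℤ) ≤ -k ∧ -k ≤ n := by omega
  have hnl : -l ≠ 0 ∧ -(n : ℤ) ≤ -l ∧ -l ≤ n := by omega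
  have c1 : (-i = k) = (k = -i) := by apply propext; omega
  have c2 : (-i = -l) = (l = i) := by apply propext; omega
  have c3 : (j = -l) = (l = -j) := by apply propext; omega
  have c4 : (-k = i) = (k = -i) := by apply propext; omega
  have c5 : (-k = -j) = (j = k) := by apply propext; omega
  have hr : r' + r = r + r' := add_comm _ _
  have hs : s' + s = s + s' := add_comm _ _
  simp only [f, LieRing.of_associative_ring_bracket, mul_sub, sub_mul, smul_mul_assoc,
    mul_smul_comm, E_mul n _ _ _ _ _ _ _ _ hj, E_mul n _ _ _ _ _ _ _ _ hni,
    E_mul n _ _ _ _ _ _ _ _ hl, E_mul n _ _ _ _ _ _ _ _ hnk, c1, c2, c3, c4, c5, hr, hs, neg_neg]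
  rcases Nat.even_or_odd s with h | h <;> rcases Nat.even_or_odd s' with h' | h' <;>
    simp only [pow_add, h.neg_one_pow, h'.neg_one_pow, one_smul, neg_smul, mul_one, mul_neg,
      neg_neg] <;> split_ifs <;> abel

theorem trace_E (n : ℕ) (i j r : ℤ) (s : ℕ) (hi : i ≠ 0 ∧ -(n : ℤ) ≤ i ∧ i ≤ n) :
    (E n i j r s).trace = if i = j then mono r s else 0 := by
  simp only [Matrix.trace, Matrix.diag, E, Matrix.of_apply]
  rw [Finset.sum_eq_single (⟨i, mem_idx.2 hi⟩ : Idx n)]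
  · simp
  · intro b _ hb
    have : b.1 ≠ i := fun h => hb (Subtype.ext h)
    simp [this]
  · simp

theorem trace_f (n : ℕ) (i j r : ℤ) (s : ℕ) (hi : i ≠ 0 ∧ -(n : ℤ) ≤ i ∧ i ≤ n)
    (hj : j ≠ 0 ∧ -(n : ℤ) ≤ j ∧ j ≤ n) :
    (f n i j r s).trace = if i = j then mono r s - (-1 : ℤ) ^ s • mono r s else 0 := by
  have hnj : -j ≠ 0 ∧ -(n : ℤ) ≤ -j ∧ -j ≤ n := by omega
  have c : (-j = -i) = (i = j) := by apply propext; omega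
  simp only [f, Matrix.trace_sub, Matrix.trace_smul, trace_E n _ _ _ _ hi, trace_E n _ _ _ _ hnj, c]
  split_ifs <;> simp

/-- The map `τ` as an additive endomorphism. -/
def tauHom (n : ℕ) : Gl n →+ Gl n where
  toFun := tau n
  map_zero' := by ext1 p q; simp [tau]
  map_add' A B := by ext1 p q; simp [tau]; ring

theorem tau_f (n : ℕ) (i j r : ℤ) (s : ℕ) : tau n (f n i j r s) = f n i j r s := by
  change tauHom n _ = _
  have h (i j r s) : tauHom n (E n i j r s) = _ := tau_E n i j r s
  rw [f, map_sub, map_zsmul, h, h]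
  rcases Nat.even_or_odd s with h | h <;> simp [h.neg_one_pow] <;> abel

/-- For odd `s` the element `f_{i,i}` is `(E_{i,i} + E_{-i,-i}) u^r v^s`, which has non-zero trace.
In odd degree only differences of diagonal elements are traceless, which is why `H_{0,r}` and
`H_{n,r}` are generators for even `r` only. -/
theorem f_mem_slTau (n : ℕ) (i j r : ℤ) (s : ℕ) (hi : i ≠ 0 ∧ -(n : ℤ) ≤ i ∧ i ≤ n)
    (hj : j ≠ 0 ∧ -(n : ℤ) ≤ j ∧ j ≤ n) (h : i ≠ j ∨ Even s) : f n i j r s ∈ slTau n := by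
  refine ⟨?_, tau_f n i j r s⟩
  rw [trace_f n i j r s hi hj]
  split_ifs with hij
  · simp [(h.resolve_left (not_not.2 hij)).neg_one_pow]
  · rfl

theorem f_sub_f_mem_slTau (n : ℕ) (i j r : ℤ) (s : ℕ) (hi : i ≠ 0 ∧ -(n : ℤ) ≤ i ∧ i ≤ n)
    (hj : j ≠ 0 ∧ -(n : ℤ) ≤ j ∧ j ≤ n) : f n i i r s - f n j j r s ∈ slTau n := by
  refine ⟨?_, ?_⟩
  · rw [Matrix.trace_sub, trace_f n i i r s hi hi, trace_f n j j r s hj hj]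
    simp
  · change tauHom n _ = _
    have h (i j r s) : tauHom n (f n i j r s) = _ := tau_f n i j r s
    rw [map_sub, h, h]

theorem smul_int_mem_slTau {n : ℕ} {M : Gl n} (hM : M ∈ slTau n) (k : ℤ) : k • M ∈ slTau n :=
  zsmul_mem (S := AddSubgroup (Gl n)) (K := (slTau n).toSubmodule.toAddSubgroup) hM k

/-! ### The map from the free Lie algebra to matrices -/

/-- The homomorphism from the free Lie algebra to matrices that extends `image`. -/
def phi (n : ℕ) : Free n →ₗ⁅ℂ⁆ Gl n := FreeLieAlgebra.lift ℂ fun g : Gen n => image n g.1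

theorem phi_sym (n : ℕ) (g : Symb) (h : IsGen n g) : phi n (sym n g) = image n g := by
  rw [sym, dif_pos h, phi, FreeLieAlgebra.lift_of_apply]

theorem sym_eq_zero (n : ℕ) (g : Symb) (h : ¬ IsGen n g) : sym n g = 0 := dif_neg h

theorem H_eq_zero (n : ℕ) (i : ℤ) (r : ℕ)
    (h : ¬ ((1 ≤ i ∧ i ≤ n - 1) ∨ ((i = 0 ∨ i = n) ∧ Even r))) : H n i r = 0 :=
  sym_eq_zero n (.H i r) h

theorem X_eq_zero (n : ℕ) (e : ℤˣ) (i : ℤ) (r : ℕ)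
    (h : ¬ ((0 ≤ i ∧ i ≤ n) ∨ ((i = -1 ∨ i = n + 1) ∧ Odd r))) : X n e i r = 0 :=
  sym_eq_zero n (.X e i r) h

theorem phi_H (n : ℕ) (i : ℤ) (r : ℕ)
    (h : (1 ≤ i ∧ i ≤ n - 1) ∨ ((i = 0 ∨ i = n) ∧ Even r)) :
    phi n (H n i r) = image n (.H i r) :=
  phi_sym n (.H i r) h

theorem phi_X (n : ℕ) (e : ℤˣ) (i : ℤ) (r : ℕ)
    (h : (0 ≤ i ∧ i ≤ n) ∨ ((i = -1 ∨ i = n + 1) ∧ Odd r)) :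
    phi n (X n e i r) = image n (.X e i r) :=
  phi_sym n (.X e i r) h

theorem phi_H_mid {n : ℕ} {i : ℤ} (hi : 1 ≤ i ∧ i ≤ n - 1) (r : ℕ) :
    phi n (H n i r) = f n i i 0 r - f n (i + 1) (i + 1) 0 r := by
  rw [phi_H n _ _ (Or.inl hi)]
  simp (disch := omega) only [image, if_neg]

theorem phi_H_zero (n : ℕ) {r : ℕ} (hr : Even r) :
    phi n (H n 0 r) = -(f n 1 1 0 r + f n 2 2 0 r) := by
  rw [phi_H n _ _ (Or.inr ⟨Or.inl rfl, hr⟩)]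
  simp only [image, if_true]

theorem phi_H_last {n : ℕ} (hn : 4 ≤ n) {r : ℕ} (hr : Even r) :
    phi n (H n n r) = f n (n - 1) (n - 1) 0 r + f n n n 0 r := by
  rw [phi_H n _ _ (Or.inr ⟨Or.inr rfl, hr⟩)]
  simp (disch := omega) only [image, if_neg, if_true]

theorem neg_one_ne_one_units : ¬ ((-1 : ℤˣ) = 1) := by decide

theorem phi_X_mid {n : ℕ} {i : ℤ} (hi : 1 ≤ i ∧ i ≤ n - 1) (r : ℕ) :
    phi n (X n 1 i r) = f n i (i + 1) 0 r := by
  rw [phi_X n _ _ _ (Or.inl (by omega))]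
  simp (disch := omega) only [image, if_neg, if_true]

theorem phi_X_mid' {n : ℕ} {i : ℤ} (hi : 1 ≤ i ∧ i ≤ n - 1) (r : ℕ) :
    phi n (X n (-1) i r) = f n (i + 1) i 0 r := by
  rw [phi_X n _ _ _ (Or.inl (by omega))]
  simp only [image, if_neg neg_one_ne_one_units]
  simp (disch := omega) only [if_neg]

theorem phi_X_zero (n : ℕ) (r : ℕ) :
    phi n (X n 1 0 r) = (-1 : ℤ) ^ r • f n (-2) 1 1 r := by
  rw [phi_X n _ _ _ (Or.inl (by omega))]
  simp (disch := omega) only [image, if_neg, if_true]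

theorem phi_X_zero' (n : ℕ) (r : ℕ) :
    phi n (X n (-1) 0 r) = (-1 : ℤ) ^ r • f n 1 (-2) (-1) r := by
  rw [phi_X n _ _ _ (Or.inl (by omega))]
  simp only [image, if_neg neg_one_ne_one_units]
  simp (disch := omega) only [if_neg, if_true]

theorem phi_X_last {n : ℕ} (hn : 4 ≤ n) (r : ℕ) :
    phi n (X n 1 n r) = f n (n - 1) (-n) 0 r := by
  rw [phi_X n _ _ _ (Or.inl (by omega))]
  simp (disch := omega) only [image, if_neg, if_true]

theorem phi_X_last' {n : ℕ} (hn : 4 ≤ n) (r : ℕ) :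
    phi n (X n (-1) n r) = f n (-n) (n - 1) 0 r := by
  rw [phi_X n _ _ _ (Or.inl (by omega))]
  simp only [image, if_neg neg_one_ne_one_units]
  simp (disch := omega) only [if_neg, if_true]

theorem phi_X_top (n : ℕ) {r : ℕ} (hr : Odd r) :
    phi n (X n 1 (n + 1) r) = f n n (-n) 0 r := by
  rw [phi_X n _ _ _ (Or.inr ⟨Or.inr rfl, hr⟩)]
  simp (disch := omega) only [image, if_neg, if_true]

theorem phi_X_top' (n : ℕ) {r : ℕ} (hr : Odd r) :
    phi n (X n (-1) (n + 1) r) = f n (-n) n 0 r := by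
  rw [phi_X n _ _ _ (Or.inr ⟨Or.inr rfl, hr⟩)]
  simp only [image, if_neg neg_one_ne_one_units]
  simp (disch := omega) only [if_neg, if_true]

theorem phi_X_bot (n : ℕ) {r : ℕ} (hr : Odd r) :
    phi n (X n 1 (-1) r) = f n (-1) 1 1 r := by
  rw [phi_X n _ _ _ (Or.inr ⟨Or.inl rfl, hr⟩)]
  simp only [image, if_true]

theorem phi_X_bot' (n : ℕ) {r : ℕ} (hr : Odd r) :
    phi n (X n (-1) (-1) r) = f n 1 (-1) (-1) r := by
  rw [phi_X n _ _ _ (Or.inr ⟨Or.inl rfl, hr⟩)]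
  simp only [image, if_neg neg_one_ne_one_units, if_true]

/-- `E_{i,-i}` is an eigenvector of `E_{p,q} ↦ E_{-q,-p}`, so its two terms cancel in even degree.
This is the source of all parity conditions on the weights `±2ε_i`. -/
theorem f_neg_eq_zero {n : ℕ} (i r : ℤ) {s : ℕ} (hs : Even s) : f n i (-i) r s = 0 := by
  simp [f, hs.neg_one_pow]

theorem f_neg_eq_zero' {n : ℕ} (i r : ℤ) {s : ℕ} (hs : Even s) : f n (-i) i r s = 0 := by
  simp [f, hs.neg_one_pow]

/-- The diagonal elements `f_{k,k}` act on the `f_{p,q}` by scalars. -/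
theorem lie_f_diag {n : ℕ} (k p q r r' : ℤ) (s s' : ℕ) (hk : k ≠ 0 ∧ -(n : ℤ) ≤ k ∧ k ≤ n)
    (hp : p ≠ 0 ∧ -(n : ℤ) ≤ p ∧ p ≤ n) (hq : q ≠ 0 ∧ -(n : ℤ) ≤ q ∧ q ≤ n) :
    ⁅f n k k r s, f n p q r' s'⁆ = (((if k = p then 1 else 0) - (if q = k then 1 else 0)) -
      (-1) ^ s * ((if p = -k then 1 else 0) - (if q = -k then 1 else 0)) : ℤ) •
        f n p q (r + r') (s + s') := by
  rw [lie_f n k k p q r r' s s' hk hk hp hq]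
  have e1 : (if k = p then f n k q (r + r') (s + s') else 0) =
      (if k = p then (1 : ℤ) else 0) • f n p q (r + r') (s + s') := by
    split_ifs with h
    · rw [h, one_smul]
    · rw [zero_smul]
  have e2 : (if q = k then f n p k (r + r') (s + s') else 0) =
      (if q = k then (1 : ℤ) else 0) • f n p q (r + r') (s + s') := by
    split_ifs with h
    · rw [h, one_smul]
    · rw [zero_smul]
  have e3 : (if p = -k then f n (-k) q (r + r') (s + s') else 0) =
      (if p = -k then (1 : ℤ) else 0) • f n p q (r + r') (s + s') := by
    split_ifs with h
    · rw [h, one_smul]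
    · rw [zero_smul]
  have e4 : (if q = -k then f n p (-k) (r + r') (s + s') else 0) =
      (if q = -k then (1 : ℤ) else 0) • f n p q (r + r') (s + s') := by
    split_ifs with h
    · rw [h, one_smul]
    · rw [zero_smul]
  rw [e1, e2, e3, e4]
  module

theorem lie_f_diag_diag {n : ℕ} (k l r r' : ℤ) (s s' : ℕ) (hk : k ≠ 0 ∧ -(n : ℤ) ≤ k ∧ k ≤ n)
    (hl : l ≠ 0 ∧ -(n : ℤ) ≤ l ∧ l ≤ n) : ⁅f n k k r s, f n l l r' s'⁆ = 0 := by
  rw [lie_f_diag k l l r r' s s' hk hl hl]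
  simp [eq_comm]

/-- Every `φ(H_{i,r})` is a combination of diagonal elements. -/
theorem phi_H_mem {n : ℕ} (hn : 4 ≤ n) (i : ℤ) (r : ℕ) : ∃ k l : ℤ, ∃ a b : ℤ,
    (k ≠ 0 ∧ -(n : ℤ) ≤ k ∧ k ≤ n) ∧ (l ≠ 0 ∧ -(n : ℤ) ≤ l ∧ l ≤ n) ∧
      phi n (H n i r) = a • f n k k 0 r + b • f n l l 0 r := by
  by_cases h : (1 ≤ i ∧ i ≤ n - 1) ∨ ((i = 0 ∨ i = n) ∧ Even r)
  · rcases h with h | ⟨rfl | rfl, h⟩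
    · exact ⟨i, i + 1, 1, -1, by omega, by omega, by rw [phi_H_mid h]; module⟩
    · exact ⟨1, 2, -1, -1, by omega, by omega, by rw [phi_H_zero n h]; module⟩
    · exact ⟨n - 1, n, 1, 1, by omega, by omega, by rw [phi_H_last hn h]; module⟩
  · exact ⟨1, 2, 0, 0, by omega, by omega, by rw [H_eq_zero n i r h]; simp⟩

theorem phi_hh {n : ℕ} (hn : 4 ≤ n) (i j : ℤ) (r s : ℕ) : phi n ⁅H n i r, H n j s⁆ = 0 := by
  obtain ⟨k, l, a, b, hk, hl, h⟩ := phi_H_mem hn i r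
  obtain ⟨k', l', a', b', hk', hl', h'⟩ := phi_H_mem hn j s
  rw [LieHom.map_lie, h, h']
  simp only [add_lie, lie_add, smul_lie, lie_smul, lie_f_diag_diag _ _ _ _ _ _ hk hk',
    lie_f_diag_diag _ _ _ _ _ _ hk hl', lie_f_diag_diag _ _ _ _ _ _ hl hk',
    lie_f_diag_diag _ _ _ _ _ _ hl hl', smul_zero, add_zero]

/-- The coefficient with which `f_{k,k} v^r` acts on `f_{p,q} v^s`. -/
def diagCoeff (r : ℕ) (k p q : ℤ) : ℤ :=
  ((if k = p then 1 else 0) - (if q = k then 1 else 0)) -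
      (-1) ^ r * ((if p = -k then 1 else 0) - (if q = -k then 1 else 0))

theorem lie_f_diag' {n : ℕ} (k p q r r' : ℤ) (s s' : ℕ) (hk : k ≠ 0 ∧ -(n : ℤ) ≤ k ∧ k ≤ n)
    (hp : p ≠ 0 ∧ -(n : ℤ) ≤ p ∧ p ≤ n) (hq : q ≠ 0 ∧ -(n : ℤ) ≤ q ∧ q ≤ n) :
    ⁅f n k k r s, f n p q r' s'⁆ = diagCoeff s k p q • f n p q (r + r') (s + s') :=
  lie_f_diag k p q r r' s s' hk hp hq

/-- `φ(H_{i,r})` acts on `f_{p,q} v^s` by this coefficient. -/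
def hCoeff (n r : ℕ) (i p q : ℤ) : ℤ :=
  if i = 0 then -(diagCoeff r 1 p q + diagCoeff r 2 p q)
  else if i = n then diagCoeff r (n - 1) p q + diagCoeff r n p q
  else diagCoeff r i p q - diagCoeff r (i + 1) p q

theorem lie_phi_H {n : ℕ} (hn : 4 ≤ n) {i : ℤ} {r : ℕ}
    (hi : (1 ≤ i ∧ i ≤ n - 1) ∨ ((i = 0 ∨ i = n) ∧ Even r)) (p q r' : ℤ) (s : ℕ)
    (hp : p ≠ 0 ∧ -(n : ℤ) ≤ p ∧ p ≤ n) (hq : q ≠ 0 ∧ -(n : ℤ) ≤ q ∧ q ≤ n) :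
    ⁅phi n (H n i r), f n p q r' s⁆ = hCoeff n r i p q • f n p q r' (r + s) := by
  rcases hi with h | ⟨rfl | rfl, h⟩
  · rw [phi_H_mid h]
    simp (disch := omega) only [hCoeff, if_neg, sub_lie, lie_f_diag', zero_add, sub_smul]
  · rw [phi_H_zero n h]
    simp (disch := omega) only [hCoeff, if_true, neg_lie, add_lie, lie_f_diag', zero_add, neg_smul,
      add_smul]
  · rw [phi_H_last hn h]
    simp (disch := omega) only [hCoeff, if_true, if_neg, add_lie, lie_f_diag', zero_add, add_smul]

theorem hCoeff_mid {n : ℕ} (hn : 4 ≤ n) {i j : ℤ} {r : ℕ}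
    (hi : (1 ≤ i ∧ i ≤ n - 1) ∨ ((i = 0 ∨ i = n) ∧ Even r)) (hj : 1 ≤ j ∧ j ≤ n - 1) :
    hCoeff n r i j (j + 1) = a n r i j ∧ hCoeff n r i (j + 1) j = -a n r i j := by
  rcases hi with h | ⟨rfl | rfl, h⟩
  · have e : a n r i j = if i = j then 2 else if i + 1 = j ∨ j + 1 = i then -1 else 0 := by
      unfold a Edge
      split_ifs <;> omega
    rw [e]
    rcases (by omega : i = j ∨ i = j + 1 ∨ i + 1 = j ∨ (i ≠ j ∧ i ≠ j + 1 ∧ i + 1 ≠ j))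
      with h1 | h1 | h1 | h1 <;>
    simp (disch := omega) only [hCoeff, diagCoeff, if_neg, if_pos] <;> simp
  · have e : a n r 0 j = if j = 2 then -1 else 0 := by
      unfold a Edge
      split_ifs <;> omega
    rw [e]
    rcases (by omega : j = 1 ∨ j = 2 ∨ 3 ≤ j) with h1 | h1 | h1 <;>
    simp (disch := omega) only [hCoeff, diagCoeff, if_neg, if_pos] <;> simp
  · have e : a n r n j = if j = n - 2 then -1 else 0 := by
      unfold a Edge
      split_ifs <;> omega
    rw [e]
    rcases (by omega : j = n - 1 ∨ j = n - 2 ∨ j < n - 2) with h1 | h1 | h1 <;>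
    simp (disch := omega) only [hCoeff, diagCoeff, if_neg, if_pos] <;> simp

/-- In row `n - 1` the element `f_{n,n} v^r` meets the index `-n` through `E_{-n,-n}`, which carries
the sign `(-1)^r`. The coefficient is `1 - (-1)^r`: the Cartan integer `0` for even `r` and the
modified entry `2` for odd `r`. -/
theorem hCoeff_last {n : ℕ} (hn : 4 ≤ n) {i : ℤ} {r : ℕ}
    (hi : (1 ≤ i ∧ i ≤ n - 1) ∨ ((i = 0 ∨ i = n) ∧ Even r)) :
    hCoeff n r i (n - 1) (-n) = a n r i n ∧ hCoeff n r i (-n) (n - 1) = -a n r i n := by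
  rcases hi with h | ⟨rfl | rfl, h⟩
  · have e : a n r i n = if i = n - 2 then -1 else if i = n - 1 then 1 - (-1) ^ r else 0 := by
      unfold a Edge
      rcases Nat.even_or_odd r with hr | hr
      · have hr' := Nat.not_odd_iff_even.2 hr
        simp only [hr.neg_one_pow, hr', false_and, and_true, if_false]
        split_ifs <;> omega
      · simp only [hr.neg_one_pow, hr, true_and, and_true]
        split_ifs <;> omega
    rw [e]
    rcases (by omega : i = n - 2 ∨ i = n - 1 ∨ i < n - 2)
      with h1 | h1 | h1 <;>
    simp (disch := omega) only [hCoeff, diagCoeff, if_neg, if_pos] <;> simp <;> ring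
  · have e : a n r 0 n = 0 := by
      unfold a Edge
      split_ifs <;> omega
    rw [e]
    simp (disch := omega) only [hCoeff, diagCoeff, if_neg]
    simp
  · have e : a n r n n = 2 := by
      unfold a
      simp
    rw [e]
    simp (disch := omega) only [hCoeff, diagCoeff, if_neg, if_pos, h.neg_one_pow]
    simp

/-- As for the node `n`, with a further factor `(-1)^r`: it turns the sign `(-1)^s` in the image of
`X_{0,s}` into the sign `(-1)^{r+s}` in the image of `X_{0,r+s}`. -/
theorem hCoeff_zero {n : ℕ} (hn : 4 ≤ n) {i : ℤ} {r : ℕ}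
    (hi : (1 ≤ i ∧ i ≤ n - 1) ∨ ((i = 0 ∨ i = n) ∧ Even r)) :
    hCoeff n r i (-2) 1 = a n r i 0 * (-1) ^ r ∧ hCoeff n r i 1 (-2) = -(a n r i 0 * (-1) ^ r) := by
  rcases hi with h | ⟨rfl | rfl, h⟩
  · have e : a n r i 0 = if i = 2 then -1 else if i = 1 then 1 - (-1) ^ r else 0 := by
      unfold a Edge
      rcases Nat.even_or_odd r with hr | hr
      · have hr' := Nat.not_odd_iff_even.2 hr
        simp only [hr.neg_one_pow, hr', false_and, true_and, and_true, if_false]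
        split_ifs <;> omega
      · simp only [hr.neg_one_pow, hr, true_and, and_true]
        split_ifs <;> omega
    rw [e]
    rcases Nat.even_or_odd r with hr | hr <;>
    rcases (by omega : i = 2 ∨ i = 1 ∨ 2 < i)
      with h1 | h1 | h1 <;>
    simp (disch := omega) only [hCoeff, diagCoeff, if_neg, if_pos, hr.neg_one_pow] <;> simp
  · have e : a n r 0 0 = 2 := by
      unfold a
      simp
    rw [e]
    simp (disch := omega) only [hCoeff, diagCoeff, if_neg, if_pos, h.neg_one_pow]
    simp
  · have e : a n r n 0 = 0 := by
      unfold a Edge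
      split_ifs <;> omega
    rw [e]
    simp (disch := omega) only [hCoeff, diagCoeff, if_neg, h.neg_one_pow]
    simp

theorem phi_hx {n : ℕ} (hn : 4 ≤ n) (e : ℤˣ) (i j : ℤ) (r s : ℕ)
    (hi : (1 ≤ i ∧ i ≤ n - 1) ∨ ((i = 0 ∨ i = n) ∧ Even r)) (hj : 0 ≤ j ∧ j ≤ n) :
    phi n ⁅H n i r, X n e j s⁆ = phi n (((e : ℤ) * a n r i j) • X n e j (r + s)) := by
  have hp : ((-1 : ℤ) ^ r) * (-1) ^ r = 1 := by rw [← mul_pow]; simp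
  have hh := @lie_phi_H n hn i r hi
  rw [LieHom.map_lie, map_zsmul]
  rcases (by omega : j = 0 ∨ (1 ≤ j ∧ j ≤ n - 1) ∨ j = n) with rfl | h | rfl <;>
  rcases Int.units_eq_one_or e with rfl | rfl
  · rw [phi_X_zero, phi_X_zero, lie_smul, hh _ _ _ _ (by omega) (by omega), (hCoeff_zero hn hi).1,
      smul_smul, smul_smul, pow_add]
    congr 1
    push_cast
    ring
  · rw [phi_X_zero', phi_X_zero', lie_smul, hh _ _ _ _ (by omega) (by omega),
      (hCoeff_zero hn hi).2, smul_smul, smul_smul, pow_add]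
    congr 1
    push_cast
    ring
  · rw [phi_X_mid h, phi_X_mid h, hh _ _ _ _ (by omega) (by omega), (hCoeff_mid hn hi h).1]
    simp
  · rw [phi_X_mid' h, phi_X_mid' h, hh _ _ _ _ (by omega) (by omega), (hCoeff_mid hn hi h).2]
    simp
  · rw [phi_X_last hn, phi_X_last hn, hh _ _ _ _ (by omega) (by omega), (hCoeff_last hn hi).1]
    simp
  · rw [phi_X_last' hn, phi_X_last' hn, hh _ _ _ _ (by omega) (by omega), (hCoeff_last hn hi).2]
    simp

/-! ### Verification of the relations between the `X^±_{i,r}` -/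

set_option linter.unusedSimpArgs false

theorem phi_xx_ne {n : ℕ} (hn : 4 ≤ n) (i j : ℤ) (r s : ℕ) (hi : 0 ≤ i ∧ i ≤ n)
    (hj : 0 ≤ j ∧ j ≤ n) (hij : i ≠ j) (hexc : ¬ Exc n i j) :
    phi n ⁅X n 1 i r, X n (-1) j s⁆ = 0 := by
  unfold Exc at hexc
  rw [LieHom.map_lie]
  rcases (by omega : i = 0 ∨ (1 ≤ i ∧ i ≤ n - 1) ∨ i = n) with rfl | h | rfl <;>
  rcases (by omega : j = 0 ∨ (1 ≤ j ∧ j ≤ n - 1) ∨ j = n) with rfl | h' | rfl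
  · exact absurd rfl hij
  · rw [phi_X_zero, phi_X_mid' h']
    simp (disch := omega) only [smul_lie, lie_f, if_neg, sub_self, smul_zero]
  · rw [phi_X_zero, phi_X_last' hn]
    simp (disch := omega) only [smul_lie, lie_f, if_neg, sub_self, smul_zero]
  · rw [phi_X_zero', phi_X_mid h]
    simp (disch := omega) only [lie_smul, lie_f, if_neg, sub_self, smul_zero]
  · rw [phi_X_mid h, phi_X_mid' h']
    simp (disch := omega) only [lie_f, if_neg, sub_self, smul_zero]
  · rw [phi_X_mid h, phi_X_last' hn]
    simp (disch := omega) only [lie_f, if_neg, sub_self, smul_zero]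
  · rw [phi_X_zero', phi_X_last hn]
    simp (disch := omega) only [lie_smul, lie_f, if_neg, sub_self, smul_zero]
  · rw [phi_X_last hn, phi_X_mid' h']
    simp (disch := omega) only [lie_f, if_neg, sub_self, smul_zero]
  · exact absurd rfl hij

theorem phi_xx_eq {n : ℕ} (i : ℤ) (r s : ℕ) (h : 1 ≤ i ∧ i ≤ n - 1) :
    phi n ⁅X n 1 i r, X n (-1) i s⁆ = phi n (H n i (r + s)) := by
  rw [LieHom.map_lie, phi_X_mid h, phi_X_mid' h, phi_H_mid h]
  simp (disch := omega) only [lie_f, if_neg, if_true, sub_self, smul_zero, sub_zero, zero_add]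

/-- The bracket is `f_{n-1,n-1} - f_{-n,-n}`, and `f_{-n,-n} = -(-1)^{r+s} f_{n,n}`. So it is the
sum that represents `H_n` in even degree and the difference that represents `H_{n-1}` in odd degree.
-/
theorem phi_xx_n {n : ℕ} (hn : 4 ≤ n) (r s : ℕ) :
    phi n ⁅X n 1 n r, X n (-1) n s⁆ =
      phi n (if Even (r + s) then H n n (r + s) else H n (n - 1) (r + s)) := by
  rw [LieHom.map_lie, phi_X_last hn, phi_X_last' hn]
  simp (disch := omega) only [lie_f, if_neg, if_pos, if_true, sub_self, smul_zero, sub_zero, zero_add,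
    f_flip]
  rcases Nat.even_or_odd (r + s) with h | h
  · simp [h, phi_H_last hn h, h.neg_one_pow]
  · rw [if_neg (Nat.not_even_iff_odd.2 h), phi_H_mid (by omega), h.neg_one_pow]
    simp

/-- The same flip as at the node `n`. In odd degree the matrices give `f_{2,2} - f_{1,1}`, and the
sign `(-1)^{r+s} = -1` of the two images turns this into `H_1`. -/
theorem phi_xx_zero {n : ℕ} (hn : 4 ≤ n) (r s : ℕ) :
    phi n ⁅X n 1 0 r, X n (-1) 0 s⁆ =
      phi n (if Even (r + s) then H n 0 (r + s) else H n 1 (r + s)) := by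
  rw [LieHom.map_lie, phi_X_zero, phi_X_zero', smul_lie, lie_smul, smul_smul, ← pow_add]
  simp (disch := omega) only [lie_f, if_neg, if_pos, if_true, sub_self, smul_zero, sub_zero, f_flip]
  rcases Nat.even_or_odd (r + s) with h | h
  · simp [h, phi_H_zero n h, h.neg_one_pow]
    abel
  · rw [if_neg (Nat.not_even_iff_odd.2 h), phi_H_mid (by omega), h.neg_one_pow]
    simp

theorem phi_exc_n₁ {n : ℕ} (hn : 4 ≤ n) (r s : ℕ) :
    phi n ⁅X n 1 (n - 1) r, X n (-1) n s⁆ =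
      phi n (if Odd (r + s) then -X n (-1) (n + 1) (r + s) else 0) := by
  rw [LieHom.map_lie, phi_X_mid (by omega), phi_X_last' hn]
  simp (disch := omega) only [lie_f, if_neg, if_pos, if_true, sub_self, smul_zero, sub_zero, zero_add,
    zero_sub, sub_add_cancel]
  rcases Nat.even_or_odd (r + s) with h | h
  · simp [Nat.not_odd_iff_even.2 h, f_neg_eq_zero' n _ h]
  · simp [h, phi_X_top' n h]

theorem phi_exc_n₂ {n : ℕ} (hn : 4 ≤ n) (r s : ℕ) :
    phi n ⁅X n 1 n r, X n (-1) (n - 1) s⁆ =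
      phi n (if Odd (r + s) then -X n 1 (n + 1) (r + s) else 0) := by
  rw [LieHom.map_lie, phi_X_mid' (by omega), phi_X_last hn]
  simp (disch := omega) only [lie_f, if_neg, if_pos, if_true, sub_self, smul_zero, sub_zero, zero_add,
    zero_sub, sub_add_cancel]
  rcases Nat.even_or_odd (r + s) with h | h
  · simp [Nat.not_odd_iff_even.2 h, f_neg_eq_zero n _ h]
  · simp [h, phi_X_top n h]

theorem phi_exc_zero₁ {n : ℕ} (hn : 4 ≤ n) (r s : ℕ) :
    phi n ⁅X n 1 0 r, X n (-1) 1 s⁆ =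
      phi n (if Odd (r + s) then -X n 1 (-1) (r + s) else 0) := by
  rw [LieHom.map_lie, phi_X_mid' (by omega), phi_X_zero, smul_lie]
  simp (disch := omega) only [lie_f, if_neg, if_pos, if_true, sub_self, smul_zero, sub_zero, zero_sub]
  rw [smul_neg, smul_smul, ← mul_pow]
  rcases Nat.even_or_odd (r + s) with h | h
  · have e := f_neg_eq_zero' (n := n) 1 1 h
    simp [Nat.not_odd_iff_even.2 h, e]
  · simp [h, phi_X_bot n h]

theorem phi_exc_zero₂ {n : ℕ} (hn : 4 ≤ n) (r s : ℕ) :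
    phi n ⁅X n 1 1 r, X n (-1) 0 s⁆ =
      phi n (if Odd (r + s) then -X n (-1) (-1) (r + s) else 0) := by
  rw [LieHom.map_lie, phi_X_mid (by omega), phi_X_zero', lie_smul]
  simp (disch := omega) only [lie_f, if_neg, if_pos, if_true, sub_self, smul_zero, sub_zero, zero_sub]
  rw [smul_neg, smul_neg, smul_neg, neg_neg, smul_smul, ← pow_add, add_comm s r]
  rcases Nat.even_or_odd (r + s) with h | h
  · have e := f_neg_eq_zero (n := n) 1 (-1) h
    simp [Nat.not_odd_iff_even.2 h, e]
  · simp [h, phi_X_bot' n h, h.neg_one_pow]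

theorem phi_top_comm {n : ℕ} (hn : 4 ≤ n) (e e' : ℤˣ) (i : ℤ) (r s : ℕ)
    (hi : 1 ≤ i ∧ i ≤ n - 2) (hs : Odd s) : phi n ⁅X n e i r, X n e' (n + 1) s⁆ = 0 := by
  have h : 1 ≤ i ∧ i ≤ (n : ℤ) - 1 := by omega
  rw [LieHom.map_lie]
  rcases Int.units_eq_one_or e with rfl | rfl <;> rcases Int.units_eq_one_or e' with rfl | rfl
  · rw [phi_X_mid h, phi_X_top n hs]
    simp (disch := omega) only [lie_f, if_neg, sub_self, smul_zero]
  · rw [phi_X_mid h, phi_X_top' n hs]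
    simp (disch := omega) only [lie_f, if_neg, sub_self, smul_zero]
  · rw [phi_X_mid' h, phi_X_top n hs]
    simp (disch := omega) only [lie_f, if_neg, sub_self, smul_zero]
  · rw [phi_X_mid' h, phi_X_top' n hs]
    simp (disch := omega) only [lie_f, if_neg, sub_self, smul_zero]

theorem phi_bot_comm {n : ℕ} (hn : 4 ≤ n) (e e' : ℤˣ) (i : ℤ) (r s : ℕ)
    (hi : 2 ≤ i ∧ i ≤ n + 1) (hs : Odd s) : phi n ⁅X n e i r, X n e' (-1) s⁆ = 0 := by
  rw [LieHom.map_lie]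
  rcases (by omega : (1 ≤ i ∧ i ≤ (n : ℤ) - 1) ∨ i = n ∨ i = n + 1) with h | rfl | rfl
  · rcases Int.units_eq_one_or e with rfl | rfl <;> rcases Int.units_eq_one_or e' with rfl | rfl
    · rw [phi_X_mid h, phi_X_bot n hs]
      simp (disch := omega) only [lie_f, if_neg, sub_self, smul_zero]
    · rw [phi_X_mid h, phi_X_bot' n hs]
      simp (disch := omega) only [lie_f, if_neg, sub_self, smul_zero]
    · rw [phi_X_mid' h, phi_X_bot n hs]
      simp (disch := omega) only [lie_f, if_neg, sub_self, smul_zero]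
    · rw [phi_X_mid' h, phi_X_bot' n hs]
      simp (disch := omega) only [lie_f, if_neg, sub_self, smul_zero]
  · rcases Int.units_eq_one_or e with rfl | rfl <;> rcases Int.units_eq_one_or e' with rfl | rfl
    · rw [phi_X_last hn, phi_X_bot n hs]
      simp (disch := omega) only [lie_f, if_neg, sub_self, smul_zero]
    · rw [phi_X_last hn, phi_X_bot' n hs]
      simp (disch := omega) only [lie_f, if_neg, sub_self, smul_zero]
    · rw [phi_X_last' hn, phi_X_bot n hs]
      simp (disch := omega) only [lie_f, if_neg, sub_self, smul_zero]
    · rw [phi_X_last' hn, phi_X_bot' n hs]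
      simp (disch := omega) only [lie_f, if_neg, sub_self, smul_zero]
  · rcases Nat.even_or_odd r with hr | hr
    · have h0 : ¬ Odd r := Nat.not_odd_iff_even.2 hr
      rw [X_eq_zero n e (n + 1) r (by simp only [h0, and_false, or_false]; omega), map_zero, zero_lie]
    rcases Int.units_eq_one_or e with rfl | rfl <;> rcases Int.units_eq_one_or e' with rfl | rfl
    · rw [phi_X_top n hr, phi_X_bot n hs]
      simp (disch := omega) only [lie_f, if_neg, sub_self, smul_zero]
    · rw [phi_X_top n hr, phi_X_bot' n hs]
      simp (disch := omega) only [lie_f, if_neg, sub_self, smul_zero]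
    · rw [phi_X_top' n hr, phi_X_bot n hs]
      simp (disch := omega) only [lie_f, if_neg, sub_self, smul_zero]
    · rw [phi_X_top' n hr, phi_X_bot' n hs]
      simp (disch := omega) only [lie_f, if_neg, sub_self, smul_zero]

theorem f_flip' (n : ℕ) {i j i' j' : ℤ} (r : ℤ) (s : ℕ) (hi : i' = -i) (hj : j' = -j) :
    f n j' i' r s = -((-1 : ℤ) ^ s • f n i j r s) := by
  rw [hi, hj, f_flip]

/-- Both indices of `f_{n,-n}` contract with the other factor. For odd `s` the two results agree
after a flip, and this is the factor `2`; the same happens in the other relations with that factor.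
-/
theorem phi_top₁ {n : ℕ} (hn : 4 ≤ n) (e : ℤˣ) (r s : ℕ) (hs : Odd s) :
    phi n ⁅X n e (n - 1) r, X n e (n + 1) s⁆ = phi n ((2 * (e : ℤ)) • X n e n (r + s)) := by
  rw [LieHom.map_lie, map_zsmul]
  rcases Int.units_eq_one_or e with rfl | rfl
  · rw [phi_X_mid (by omega), phi_X_top n hs, phi_X_last hn]
    simp (disch := omega) only [lie_f, if_neg, if_pos, if_true, sub_self, smul_zero, sub_zero, zero_sub,
      sub_add_cancel, zero_add]
    rw [f_flip' n (i := n - 1) (j := -n) (i' := -(n - 1)) _ _ rfl (neg_neg _).symm]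
    rcases Nat.even_or_odd r with hr | hr <;>
      simp only [pow_add, hr.neg_one_pow, hs.neg_one_pow, Units.val_one, Units.val_neg] <;> module
  · rw [phi_X_mid' (by omega), phi_X_top' n hs, phi_X_last' hn]
    simp (disch := omega) only [lie_f, if_neg, if_pos, if_true, sub_self, smul_zero, sub_zero, zero_sub,
      sub_add_cancel, zero_add]
    rw [f_flip' n (i := -n) (j := n - 1) (j' := -(n - 1)) _ _ (neg_neg _).symm rfl]
    rcases Nat.even_or_odd r with hr | hr <;>
      simp only [pow_add, hr.neg_one_pow, hs.neg_one_pow, Units.val_one, Units.val_neg] <;> module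

theorem phi_top₂ {n : ℕ} (hn : 4 ≤ n) (e : ℤˣ) (r s : ℕ) (hs : Odd s) :
    phi n ⁅X n (-e) (n - 1) r, X n e (n + 1) s⁆ = 0 := by
  rw [LieHom.map_lie]
  rcases Int.units_eq_one_or e with rfl | rfl
  · rw [phi_X_mid' (by omega), phi_X_top n hs]
    simp (disch := omega) only [lie_f, if_neg, sub_self, smul_zero]
  · rw [neg_neg, phi_X_mid (by omega), phi_X_top' n hs]
    simp (disch := omega) only [lie_f, if_neg, sub_self, smul_zero]

theorem phi_top₃ {n : ℕ} (hn : 4 ≤ n) (e : ℤˣ) (r s : ℕ) (hs : Odd s) :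
    phi n ⁅X n e n r, X n e (n + 1) s⁆ = 0 := by
  rw [LieHom.map_lie]
  rcases Int.units_eq_one_or e with rfl | rfl
  · rw [phi_X_last hn, phi_X_top n hs]
    simp (disch := omega) only [lie_f, if_neg, sub_self, smul_zero]
  · rw [phi_X_last' hn, phi_X_top' n hs]
    simp (disch := omega) only [lie_f, if_neg, sub_self, smul_zero]

theorem phi_top₄ {n : ℕ} (hn : 4 ≤ n) (e : ℤˣ) (r s : ℕ) (hs : Odd s) :
    phi n ⁅X n (-e) n r, X n e (n + 1) s⁆ =
      phi n (-((2 * (e : ℤ)) • X n (-e) (n - 1) (r + s))) := by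
  rw [LieHom.map_lie, map_neg, map_zsmul]
  rcases Int.units_eq_one_or e with rfl | rfl
  · rw [phi_X_last' hn, phi_X_top n hs, phi_X_mid' (by omega)]
    simp (disch := omega) only [lie_f, if_neg, if_pos, if_true, sub_self, smul_zero, sub_zero, zero_sub,
      sub_add_cancel, zero_add]
    rw [f_flip' n (i := n) (j := n - 1) _ _ rfl rfl]
    rcases Nat.even_or_odd r with hr | hr <;>
      simp only [pow_add, hr.neg_one_pow, hs.neg_one_pow, Units.val_one, Units.val_neg] <;> module
  · rw [neg_neg, phi_X_last hn, phi_X_top' n hs, phi_X_mid (by omega)]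
    simp (disch := omega) only [lie_f, if_neg, if_pos, if_true, sub_self, smul_zero, sub_zero, zero_sub,
      sub_add_cancel, zero_add]
    rw [f_flip' n (i := n - 1) (j := n) _ _ rfl rfl]
    rcases Nat.even_or_odd r with hr | hr <;>
      simp only [pow_add, hr.neg_one_pow, hs.neg_one_pow, Units.val_one, Units.val_neg] <;> module

theorem phi_bot₁ {n : ℕ} (hn : 4 ≤ n) (e : ℤˣ) (r s : ℕ) (hs : Odd s) :
    phi n ⁅X n e 0 r, X n e (-1) s⁆ = 0 := by
  rw [LieHom.map_lie]
  rcases Int.units_eq_one_or e with rfl | rfl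
  · rw [phi_X_zero, phi_X_bot n hs]
    simp (disch := omega) only [smul_lie, lie_f, if_neg, sub_self, smul_zero]
  · rw [phi_X_zero', phi_X_bot' n hs]
    simp (disch := omega) only [smul_lie, lie_f, if_neg, sub_self, smul_zero]

theorem phi_bot₂ {n : ℕ} (hn : 4 ≤ n) (e : ℤˣ) (r s : ℕ) (hs : Odd s) :
    phi n ⁅X n (-e) 0 r, X n e (-1) s⁆ = phi n (-((2 * (e : ℤ)) • X n (-e) 1 (r + s))) := by
  rw [LieHom.map_lie, map_neg, map_zsmul]
  rcases Int.units_eq_one_or e with rfl | rfl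
  · rw [phi_X_zero', phi_X_bot n hs, phi_X_mid' (by omega)]
    simp (disch := omega) only [smul_lie, lie_f, if_neg, if_pos, if_true, sub_self, smul_zero, sub_zero,
      zero_sub, neg_neg, neg_add_cancel, add_neg_cancel, zero_add, one_add_one_eq_two]
    rw [f_flip' n (i := 2) (j := 1) (i' := -2) (j' := -1) _ _ (by norm_num) (by norm_num)]
    rcases Nat.even_or_odd r with hr | hr <;>
      simp only [pow_add, hr.neg_one_pow, hs.neg_one_pow, Units.val_one, Units.val_neg] <;> module
  · rw [neg_neg, phi_X_zero, phi_X_bot' n hs, phi_X_mid (by omega)]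
    simp (disch := omega) only [smul_lie, lie_f, if_neg, if_pos, if_true, sub_self, smul_zero, sub_zero,
      zero_sub, neg_neg, neg_add_cancel, add_neg_cancel, zero_add, one_add_one_eq_two]
    rw [f_flip' n (i := 1) (j := 2) (i' := -1) (j' := -2) _ _ (by norm_num) (by norm_num)]
    rcases Nat.even_or_odd r with hr | hr <;>
      simp only [pow_add, hr.neg_one_pow, hs.neg_one_pow, Units.val_one, Units.val_neg] <;> module

theorem phi_bot₃ {n : ℕ} (hn : 4 ≤ n) (e : ℤˣ) (r s : ℕ) (hs : Odd s) :
    phi n ⁅X n e 1 r, X n e (-1) s⁆ = phi n ((2 * (e : ℤ)) • X n e 0 (r + s)) := by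
  rw [LieHom.map_lie, map_zsmul]
  rcases Int.units_eq_one_or e with rfl | rfl
  · rw [phi_X_mid (by omega), phi_X_bot n hs, phi_X_zero]
    simp (disch := omega) only [lie_f, if_neg, if_pos, if_true, sub_self, smul_zero, sub_zero,
      zero_sub, neg_neg, neg_add_cancel, add_neg_cancel, zero_add, one_add_one_eq_two]
    rw [f_flip' n (i := -2) (j := 1) (i' := 2) (j' := -1) _ _ (by norm_num) (by norm_num)]
    rcases Nat.even_or_odd r with hr | hr <;>
      simp only [pow_add, hr.neg_one_pow, hs.neg_one_pow, Units.val_one, Units.val_neg] <;> module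
  · rw [phi_X_mid' (by omega), phi_X_bot' n hs, phi_X_zero']
    simp (disch := omega) only [lie_f, if_neg, if_pos, if_true, sub_self, smul_zero, sub_zero,
      zero_sub, neg_neg, neg_add_cancel, add_neg_cancel, zero_add, one_add_one_eq_two]
    rw [f_flip' n (i := 1) (j := -2) (i' := -1) (j' := 2) _ _ (by norm_num) (by norm_num)]
    rcases Nat.even_or_odd r with hr | hr <;>
      simp only [pow_add, hr.neg_one_pow, hs.neg_one_pow, Units.val_one, Units.val_neg] <;> module

theorem phi_bot₄ {n : ℕ} (hn : 4 ≤ n) (e : ℤˣ) (r s : ℕ) (hs : Odd s) :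
    phi n ⁅X n (-e) 1 r, X n e (-1) s⁆ = 0 := by
  rw [LieHom.map_lie]
  rcases Int.units_eq_one_or e with rfl | rfl
  · rw [phi_X_mid' (by omega), phi_X_bot n hs]
    simp (disch := omega) only [lie_f, if_neg, sub_self, smul_zero]
  · rw [neg_neg, phi_X_mid (by omega), phi_X_bot' n hs]
    simp (disch := omega) only [lie_f, if_neg, sub_self, smul_zero]

theorem phi_same {n : ℕ} (hn : 4 ≤ n) (e : ℤˣ) (i : ℤ) (r s : ℕ) :
    phi n ⁅X n e i r, X n e i s⁆ = 0 := by
  by_cases hr : (0 ≤ i ∧ i ≤ n) ∨ ((i = -1 ∨ i = n + 1) ∧ Odd r)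
  swap
  · rw [X_eq_zero n e i r hr, zero_lie, map_zero]
  by_cases hs : (0 ≤ i ∧ i ≤ n) ∨ ((i = -1 ∨ i = n + 1) ∧ Odd s)
  swap
  · rw [X_eq_zero n e i s hs, lie_zero, map_zero]
  rw [LieHom.map_lie]
  rcases hr with hr | ⟨rfl | rfl, hr⟩
  · rcases (by omega : i = 0 ∨ (1 ≤ i ∧ i ≤ (n : ℤ) - 1) ∨ i = n) with rfl | h | rfl <;>
    rcases Int.units_eq_one_or e with rfl | rfl
    · rw [phi_X_zero, phi_X_zero, smul_lie, lie_smul]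
      simp (disch := omega) only [lie_f, if_neg, sub_self, smul_zero]
    · rw [phi_X_zero', phi_X_zero', smul_lie, lie_smul]
      simp (disch := omega) only [lie_f, if_neg, sub_self, smul_zero]
    · rw [phi_X_mid h, phi_X_mid h]
      simp (disch := omega) only [lie_f, if_neg, sub_self, smul_zero]
    · rw [phi_X_mid' h, phi_X_mid' h]
      simp (disch := omega) only [lie_f, if_neg, sub_self, smul_zero]
    · rw [phi_X_last hn, phi_X_last hn]
      simp (disch := omega) only [lie_f, if_neg, sub_self, smul_zero]
    · rw [phi_X_last' hn, phi_X_last' hn]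
      simp (disch := omega) only [lie_f, if_neg, sub_self, smul_zero]
  · have hs : Odd s := by tauto
    rcases Int.units_eq_one_or e with rfl | rfl
    · rw [phi_X_bot n hr, phi_X_bot n hs]
      simp (disch := omega) only [lie_f, if_neg, sub_self, smul_zero]
    · rw [phi_X_bot' n hr, phi_X_bot' n hs]
      simp (disch := omega) only [lie_f, if_neg, sub_self, smul_zero]
  · have hs : Odd s := by
      rcases hs with hs | hs
      · omega
      · exact hs.2
    rcases Int.units_eq_one_or e with rfl | rfl
    · rw [phi_X_top n hr, phi_X_top n hs]
      simp (disch := omega) only [lie_f, if_neg, sub_self, smul_zero]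
    · rw [phi_X_top' n hr, phi_X_top' n hs]
      simp (disch := omega) only [lie_f, if_neg, sub_self, smul_zero]

theorem phi_shift {n : ℕ} (hn : 4 ≤ n) (e : ℤˣ) (i j : ℤ) (r s : ℕ) (hi : 0 ≤ i) (hij : i ≤ j)
    (hj : j ≤ n) (hexc : ¬ Exc n i j) :
    phi n ⁅X n e i (r + 1), X n e j s⁆ = phi n ⁅X n e i r, X n e j (s + 1)⁆ := by
  by_cases h0 : i = j
  · subst h0
    rw [phi_same hn, phi_same hn]
  unfold Exc at hexc
  have hd : r + 1 + s = r + (s + 1) := by omega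
  rw [LieHom.map_lie, LieHom.map_lie]
  rcases (by omega : i = 0 ∨ (1 ≤ i ∧ i ≤ (n : ℤ) - 1)) with rfl | h <;>
  rcases (by omega : (1 ≤ j ∧ j ≤ (n : ℤ) - 1) ∨ j = n) with h' | rfl <;>
  rcases Int.units_eq_one_or e with rfl | rfl
  · rw [phi_X_zero, phi_X_zero, phi_X_mid h', phi_X_mid h']
    -- The contraction between `f_{-2,1}` and `f_{2,3}` goes through the transposed term and
    -- produces `(-1)^r`. The sign put into the image of `X_{0,r}` cancels exactly this.
    rcases (by omega : j = 2 ∨ 3 ≤ j) with rfl | h2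
    · simp (disch := omega) only [smul_lie, lie_f, if_neg, if_pos, if_true, sub_self, smul_zero, hd,
        pow_succ]
      module
    · simp (disch := omega) only [smul_lie, lie_f, if_neg, sub_self, smul_zero]
  · rw [phi_X_zero', phi_X_zero', phi_X_mid' h', phi_X_mid' h']
    rcases (by omega : j = 2 ∨ 3 ≤ j) with rfl | h2
    · simp (disch := omega) only [smul_lie, lie_f, if_neg, if_pos, if_true, sub_self, smul_zero, hd,
        pow_succ]
      module
    · simp (disch := omega) only [smul_lie, lie_f, if_neg, sub_self, smul_zero]
  · rw [phi_X_zero, phi_X_zero, phi_X_last hn, phi_X_last hn]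
    simp (disch := omega) only [smul_lie, lie_f, if_neg, sub_self, smul_zero]
  · rw [phi_X_zero', phi_X_zero', phi_X_last' hn, phi_X_last' hn]
    simp (disch := omega) only [smul_lie, lie_f, if_neg, sub_self, smul_zero]
  · rw [phi_X_mid h, phi_X_mid h, phi_X_mid h', phi_X_mid h']
    simp (disch := omega) only [lie_f, if_neg, sub_self, smul_zero, hd]
  · rw [phi_X_mid' h, phi_X_mid' h, phi_X_mid' h', phi_X_mid' h']
    simp (disch := omega) only [lie_f, if_neg, sub_self, smul_zero, hd]
  · rw [phi_X_mid h, phi_X_mid h, phi_X_last hn, phi_X_last hn]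
    simp (disch := omega) only [lie_f, if_neg, sub_self, smul_zero, hd]
  · rw [phi_X_mid' h, phi_X_mid' h, phi_X_last' hn, phi_X_last' hn]
    simp (disch := omega) only [lie_f, if_neg, sub_self, smul_zero, hd]

/-- Here the indices contract directly, so the sign `(-1)^r` in the image of `X_{0,r}` is not
compensated and the relation acquires a minus sign. -/
theorem phi_shift_zero {n : ℕ} (hn : 4 ≤ n) (e : ℤˣ) (r s : ℕ) :
    phi n ⁅X n e 0 (r + 1), X n e 1 s⁆ = phi n (-⁅X n e 0 r, X n e 1 (s + 1)⁆) := by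
  have hd : r + 1 + s = r + (s + 1) := by omega
  rw [LieHom.map_lie, map_neg, LieHom.map_lie]
  rcases Int.units_eq_one_or e with rfl | rfl
  · rw [phi_X_zero, phi_X_zero, phi_X_mid (by omega), phi_X_mid (by omega)]
    simp (disch := omega) only [smul_lie, lie_f, if_neg, if_pos, if_true, sub_self, smul_zero, hd,
      pow_succ]
    module
  · rw [phi_X_zero', phi_X_zero', phi_X_mid' (by omega), phi_X_mid' (by omega)]
    simp (disch := omega) only [smul_lie, lie_f, if_neg, if_pos, if_true, sub_self, smul_zero, hd,
      pow_succ]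
    module

/-- The only contraction goes through the transposed term of the first factor and carries `(-1)^r`,
which changes sign when a power of `v` moves to the other factor. -/
theorem phi_shift_n {n : ℕ} (hn : 4 ≤ n) (e : ℤˣ) (r s : ℕ) :
    phi n ⁅X n e (n - 1) (r + 1), X n e n s⁆ = phi n (-⁅X n e (n - 1) r, X n e n (s + 1)⁆) := by
  have hd : r + 1 + s = r + (s + 1) := by omega
  rw [LieHom.map_lie, map_neg, LieHom.map_lie]
  rcases Int.units_eq_one_or e with rfl | rfl
  · rw [phi_X_last hn, phi_X_last hn, phi_X_mid (by omega), phi_X_mid (by omega)]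
    simp (disch := omega) only [smul_lie, lie_f, if_neg, if_pos, if_true, sub_self, smul_zero, hd,
      pow_succ]
    module
  · rw [phi_X_last' hn, phi_X_last' hn, phi_X_mid' (by omega), phi_X_mid' (by omega)]
    simp (disch := omega) only [smul_lie, lie_f, if_neg, if_pos, if_true, sub_self, smul_zero, hd,
      pow_succ]
    module

theorem lie_eq_zero_symm {L : Type*} [LieRing L] {x y : L} (h : ⁅x, y⁆ = 0) : ⁅y, x⁆ = 0 := by
  rw [← lie_skew, h, neg_zero]

theorem phi_serre_zero_of_lt {n : ℕ} (hn : 4 ≤ n) (e : ℤˣ) (i j : ℤ) (r s : ℕ) (hi : 0 ≤ i)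
    (hij : i < j) (hj : j ≤ n) (ha : a n 0 i j = 0) (h : ¬ Exc n i j ∨ Even (r + s)) :
    phi n ⁅X n e i r, X n e j s⁆ = 0 := by
  have hE : ¬ ((i = 0 ∧ j = 2) ∨ (1 ≤ i ∧ i ≤ n - 2 ∧ j = i + 1) ∨ (i = n - 2 ∧ j = n)) := by
    intro hE
    have h0 : ¬ Odd 0 := by decide
    rw [a, if_neg hij.ne, if_neg (by simp only [h0, false_and, not_false_eq_true]),
      if_pos (show Edge n i j ∨ Edge n j i from Or.inl hE)] at ha
    omega
  unfold Exc at h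
  rw [LieHom.map_lie]
  rcases (by omega : i = 0 ∨ (1 ≤ i ∧ i ≤ (n : ℤ) - 1)) with rfl | h1 <;>
  rcases (by omega : (1 ≤ j ∧ j ≤ (n : ℤ) - 1) ∨ j = n) with h2 | rfl <;>
  rcases Int.units_eq_one_or e with rfl | rfl
  · rw [phi_X_zero, phi_X_mid h2]
    rcases (by omega : j = 1 ∨ 3 ≤ j) with rfl | h3
    -- For an exceptional pair the bracket need not be zero for reasons of indices: it is a multiple
    -- of an `f_{i,-i}`, which vanishes in even degree.
    · have hz := f_neg_eq_zero' (n := n) 2 1 (h.resolve_left (by omega))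
      simp (disch := omega) only [smul_lie, lie_f, if_neg, if_pos, if_true, sub_self, smul_zero,
        sub_zero, one_add_one_eq_two, add_zero, hz]
    · simp (disch := omega) only [smul_lie, lie_f, if_neg, sub_self, smul_zero]
  · rw [phi_X_zero', phi_X_mid' h2]
    rcases (by omega : j = 1 ∨ 3 ≤ j) with rfl | h3
    · have hz := f_neg_eq_zero (n := n) 2 (-1) (h.resolve_left (by omega))
      simp (disch := omega) only [smul_lie, lie_f, if_neg, if_pos, if_true, sub_self, smul_zero,
        sub_zero, one_add_one_eq_two, add_zero, hz]
    · simp (disch := omega) only [smul_lie, lie_f, if_neg, sub_self, smul_zero]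
  · rw [phi_X_zero, phi_X_last hn]
    simp (disch := omega) only [smul_lie, lie_f, if_neg, sub_self, smul_zero]
  · rw [phi_X_zero', phi_X_last' hn]
    simp (disch := omega) only [smul_lie, lie_f, if_neg, sub_self, smul_zero]
  · rw [phi_X_mid h1, phi_X_mid h2]
    simp (disch := omega) only [lie_f, if_neg, sub_self, smul_zero]
  · rw [phi_X_mid' h1, phi_X_mid' h2]
    simp (disch := omega) only [lie_f, if_neg, sub_self, smul_zero]
  · rw [phi_X_mid h1, phi_X_last hn]
    rcases (by omega : i = n - 1 ∨ i < n - 2) with rfl | h3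
    · have hz := f_neg_eq_zero (n := n) (n - 1) 0 (h.resolve_left (by omega))
      simp (disch := omega) only [smul_lie, lie_f, if_neg, if_pos, if_true, sub_self, smul_zero,
        sub_zero, add_zero, hz]
    · simp (disch := omega) only [lie_f, if_neg, sub_self, smul_zero]
  · rw [phi_X_mid' h1, phi_X_last' hn]
    rcases (by omega : i = n - 1 ∨ i < n - 2) with rfl | h3
    · have hz := f_neg_eq_zero' (n := n) (n - 1) 0 (h.resolve_left (by omega))
      simp (disch := omega) only [smul_lie, lie_f, if_neg, if_pos, if_true, sub_self, smul_zero,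
        sub_zero, add_zero, hz]
    · simp (disch := omega) only [lie_f, if_neg, sub_self, smul_zero]

theorem a_zero_symm (n : ℕ) (i j : ℤ) : a n 0 i j = a n 0 j i := by
  have h0 : ¬ Odd 0 := by decide
  simp only [a, h0, false_and, if_false, eq_comm (a := j) (b := i)]
  split_ifs <;> first | rfl | (exfalso; tauto)

theorem phi_serre_zero {n : ℕ} (hn : 4 ≤ n) (e : ℤˣ) (i j : ℤ) (r s : ℕ) (hi : 0 ≤ i ∧ i ≤ n)
    (hj : 0 ≤ j ∧ j ≤ n) (hij : i ≠ j) (ha : a n 0 i j = 0) (h : ¬ Exc n i j ∨ Even (r + s)) :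
    phi n ⁅X n e i r, X n e j s⁆ = 0 := by
  rcases lt_or_gt_of_ne hij with hlt | hlt
  · exact phi_serre_zero_of_lt hn e i j r s hi.1 hlt hj.2 ha h
  · have h' : ¬ Exc n j i ∨ Even (s + r) := by
      rw [add_comm]
      unfold Exc at h ⊢
      exact h.imp (fun h => by omega) id
    rw [← lie_skew, map_neg, phi_serre_zero_of_lt hn e j i s r hj.1 hlt hi.2
      (by rw [a_zero_symm, ha]) h', neg_zero]

theorem phi_serre {n : ℕ} (hn : 4 ≤ n) (e : ℤˣ) (i j : ℤ) (r s t : ℕ) (hi : 0 ≤ i ∧ i ≤ n)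
    (hj : 0 ≤ j ∧ j ≤ n) (ha : a n 0 i j = -1) :
    phi n ⁅X n e i r, ⁅X n e i s, X n e j t⁆⁆ = 0 := by
  have hE : ((i = 0 ∧ j = 2) ∨ (1 ≤ i ∧ i ≤ n - 2 ∧ j = i + 1) ∨ (i = n - 2 ∧ j = n)) ∨
      ((j = 0 ∧ i = 2) ∨ (1 ≤ j ∧ j ≤ n - 2 ∧ i = j + 1) ∨ (j = n - 2 ∧ i = n)) := by
    by_contra hE
    have h0 : ¬ Odd 0 := by decide
    rw [a] at ha
    split_ifs at ha with h1 h2 h3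
    exact hE h3
  rw [LieHom.map_lie, LieHom.map_lie]
  rcases hE with (⟨rfl, rfl⟩ | ⟨h1, h2, rfl⟩ | ⟨rfl, rfl⟩) | (⟨rfl, rfl⟩ | ⟨h1, h2, rfl⟩ | ⟨rfl, rfl⟩) <;>
  rcases Int.units_eq_one_or e with rfl | rfl
  · rw [phi_X_zero, phi_X_zero, phi_X_mid (by omega)]
    simp (disch := omega) only [smul_lie, lie_smul, lie_f, if_neg, if_pos, if_true, sub_self,
      smul_zero, sub_zero, zero_sub, lie_neg]
    simp
  · rw [phi_X_zero', phi_X_zero', phi_X_mid' (by omega)]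
    simp (disch := omega) only [smul_lie, lie_smul, lie_f, if_neg, if_pos, if_true, sub_self,
      smul_zero, sub_zero, zero_sub, lie_neg]
    simp
  · rw [phi_X_mid (by omega), phi_X_mid (by omega), phi_X_mid (by omega)]
    simp (disch := omega) only [smul_lie, lie_smul, lie_f, if_neg, if_pos, if_true, sub_self,
      smul_zero, sub_zero, zero_sub, lie_neg]
  · rw [phi_X_mid' (by omega), phi_X_mid' (by omega), phi_X_mid' (by omega)]
    simp (disch := omega) only [smul_lie, lie_smul, lie_f, if_neg, if_pos, if_true, sub_self,
      smul_zero, sub_zero, zero_sub, lie_neg]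
    simp
  · rw [phi_X_mid (by omega), phi_X_mid (by omega), phi_X_last hn]
    simp (disch := omega) only [smul_lie, lie_smul, lie_f, if_neg, if_pos, if_true, sub_self,
      smul_zero, sub_zero, zero_sub, lie_neg]
  · rw [phi_X_mid' (by omega), phi_X_mid' (by omega), phi_X_last' hn]
    simp (disch := omega) only [smul_lie, lie_smul, lie_f, if_neg, if_pos, if_true, sub_self,
      smul_zero, sub_zero, zero_sub, lie_neg]
    simp
  · rw [phi_X_mid (by omega), phi_X_mid (by omega), phi_X_zero]
    simp (disch := omega) only [smul_lie, lie_smul, lie_f, if_neg, if_pos, if_true, sub_self,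
      smul_zero, sub_zero, zero_sub, lie_neg]
    simp
  · rw [phi_X_mid' (by omega), phi_X_mid' (by omega), phi_X_zero']
    simp (disch := omega) only [smul_lie, lie_smul, lie_f, if_neg, if_pos, if_true, sub_self,
      smul_zero, sub_zero, zero_sub, lie_neg]
    simp
  · rw [phi_X_mid (by omega), phi_X_mid (by omega), phi_X_mid (by omega)]
    simp (disch := omega) only [smul_lie, lie_smul, lie_f, if_neg, if_pos, if_true, sub_self,
      smul_zero, sub_zero, zero_sub, lie_neg]
    simp
  · rw [phi_X_mid' (by omega), phi_X_mid' (by omega), phi_X_mid' (by omega)]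
    simp (disch := omega) only [smul_lie, lie_smul, lie_f, if_neg, if_pos, if_true, sub_self,
      smul_zero, sub_zero, zero_sub, lie_neg]
  · rw [phi_X_last hn, phi_X_last hn, phi_X_mid (by omega)]
    simp (disch := omega) only [smul_lie, lie_smul, lie_f, if_neg, if_pos, if_true, sub_self,
      smul_zero, sub_zero, zero_sub, lie_neg]
    simp
  · rw [phi_X_last' hn, phi_X_last' hn, phi_X_mid' (by omega)]
    simp (disch := omega) only [smul_lie, lie_smul, lie_f, if_neg, if_pos, if_true, sub_self,
      smul_zero, sub_zero, zero_sub, lie_neg]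

theorem phi_serre_exc {n : ℕ} (hn : 4 ≤ n) (e : ℤˣ) (i j : ℤ) (r : ℕ) (h : Exc n i j) :
    phi n ⁅X n e i 0, ⁅X n e i 0, X n e j r⁆⁆ = 0 := by
  rw [LieHom.map_lie, LieHom.map_lie]
  rcases h with ⟨rfl, rfl⟩ | ⟨rfl, rfl⟩ | ⟨rfl, rfl⟩ | ⟨rfl, rfl⟩ <;>
  rcases Int.units_eq_one_or e with rfl | rfl
  · rw [phi_X_zero, phi_X_mid (by omega)]
    simp (disch := omega) only [smul_lie, lie_smul, lie_f, if_neg, if_pos, if_true, sub_self,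
      smul_zero, sub_zero, zero_sub, lie_neg, neg_zero]
  · rw [phi_X_zero', phi_X_mid' (by omega)]
    simp (disch := omega) only [smul_lie, lie_smul, lie_f, if_neg, if_pos, if_true, sub_self,
      smul_zero, sub_zero, zero_sub, lie_neg, neg_zero]
  · rw [phi_X_zero, phi_X_mid (by omega)]
    simp (disch := omega) only [smul_lie, lie_smul, lie_f, if_neg, if_pos, if_true, sub_self,
      smul_zero, sub_zero, zero_sub, lie_neg, neg_zero]
  · rw [phi_X_zero', phi_X_mid' (by omega)]
    simp (disch := omega) only [smul_lie, lie_smul, lie_f, if_neg, if_pos, if_true, sub_self,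
      smul_zero, sub_zero, zero_sub, lie_neg, neg_zero]
  · rw [phi_X_last hn, phi_X_mid (by omega)]
    simp (disch := omega) only [smul_lie, lie_smul, lie_f, if_neg, if_pos, if_true, sub_self,
      smul_zero, sub_zero, zero_sub, lie_neg, neg_zero]
  · rw [phi_X_last' hn, phi_X_mid' (by omega)]
    simp (disch := omega) only [smul_lie, lie_smul, lie_f, if_neg, if_pos, if_true, sub_self,
      smul_zero, sub_zero, zero_sub, lie_neg, neg_zero]
  · rw [phi_X_last hn, phi_X_mid (by omega)]
    simp (disch := omega) only [smul_lie, lie_smul, lie_f, if_neg, if_pos, if_true, sub_self,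
      smul_zero, sub_zero, zero_sub, lie_neg, neg_zero]
  · rw [phi_X_last' hn, phi_X_mid' (by omega)]
    simp (disch := omega) only [smul_lie, lie_smul, lie_f, if_neg, if_pos, if_true, sub_self,
      smul_zero, sub_zero, zero_sub, lie_neg, neg_zero]

/-! ### The loop elements `(f_{1,1} - f_{2,2}) t^p` and relation 9 -/

theorem sbr_one {n : ℕ} (x y : Free n) : sbr 1 x y = ⁅x, y⁆ := by simp [sbr]

theorem sbr_neg_one {n : ℕ} (x y : Free n) : sbr (-1) x y = -⁅x, y⁆ := by simp [sbr]

theorem phi_rootA {n : ℕ} (hn : 4 ≤ n) (m : ℕ) (hm : m + 3 ≤ n) :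
    phi n (rootA n 1 m) = f n 2 (m + 3) 0 0 ∧ phi n (rootA n (-1) m) = f n (m + 3) 2 0 0 := by
  induction m with
  | zero =>
    rw [rootA, rootA, phi_X_mid (by omega), phi_X_mid' (by omega)]
    norm_num
  | succ m ih =>
    obtain ⟨h1, h2⟩ := ih (by omega)
    have e : (((m + 1 : ℕ) : ℤ)) + 3 = (m : ℤ) + 3 + 1 := by push_cast; ring
    rw [rootA, rootA, sbr_one, sbr_neg_one, map_neg, LieHom.map_lie, LieHom.map_lie, h1, h2,
      phi_X_mid (by omega), phi_X_mid' (by omega), e]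
    simp (disch := omega) only [lie_f, if_neg, if_pos, if_true, sub_self, smul_zero, sub_zero,
      zero_sub, add_zero, neg_neg, and_self]

/-- Bracketing `f_{2,-(n-m)}` with `f_{n-1-m,n-m}` yields `f_{n-1-m,-2}`, the negative of the
desired root vector; the minus sign in the recursion corrects this flip. -/
theorem phi_rootB {n : ℕ} (hn : 4 ≤ n) (m : ℕ) (hm : m + 3 ≤ n) :
    phi n (rootB n 1 m) = f n 2 (-(n - m)) 0 0 ∧
      phi n (rootB n (-1) m) = f n (-(n - m)) 2 0 0 := by
  induction m with
  | zero =>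
    obtain ⟨h1, h2⟩ := phi_rootA hn (n - 4) (by omega)
    have e : ((n - 4 : ℕ) : ℤ) + 3 = n - 1 := by omega
    rw [rootB, rootB, sbr_one, sbr_neg_one, map_neg, LieHom.map_lie, LieHom.map_lie, h1, h2,
      phi_X_last hn, phi_X_last' hn, e]
    simp (disch := omega) only [lie_f, if_neg, if_pos, if_true, sub_self, smul_zero, sub_zero,
      zero_sub, add_zero, neg_neg, and_self, Nat.cast_zero]
  | succ m ih =>
    obtain ⟨h1, h2⟩ := ih (by omega)
    have e : (n : ℤ) - ((m + 1 : ℕ) : ℤ) = n - 1 - m := by push_cast; ring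
    have e' : (n : ℤ) - 1 - m + 1 = n - m := by ring
    rw [rootB, rootB, sbr_one, sbr_neg_one, map_neg, map_neg, map_neg, LieHom.map_lie,
      LieHom.map_lie, h1, h2, phi_X_mid (by omega), phi_X_mid' (by omega), e, e']
    simp (disch := omega) only [lie_f, if_neg, if_pos, if_true, sub_self, smul_zero, sub_zero,
      zero_sub, add_zero, neg_neg, pow_zero, one_smul]
    rw [f_flip' n (i := 2) (j := -(n - 1 - m)) _ _ rfl (neg_neg _).symm,
      f_flip' n (i := -(n - 1 - m)) (j := 2) _ _ (neg_neg _).symm rfl]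
    simp

/-- For the sign `+` the inner bracket is `-f_{-3,1} t`, and contracting it with `f_{2,-3}` leaves
`-f_{2,1} t`. -/
theorem phi_rootC {n : ℕ} (hn : 4 ≤ n) :
    phi n (rootC n 1) = f n 2 1 1 0 ∧ phi n (rootC n (-1)) = f n 1 2 (-1) 0 := by
  obtain ⟨h1, h2⟩ := phi_rootB hn (n - 3) (by omega)
  have e : (n : ℤ) - ((n - 3 : ℕ) : ℤ) = 3 := by omega
  rw [e] at h1 h2
  have e3 : (2 : ℤ) + 1 = 3 := by norm_num
  simp only [rootC, sbr_one, sbr_neg_one, map_neg, LieHom.map_lie, h1, h2, lie_neg, neg_neg,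
    phi_X_zero, phi_X_zero', phi_X_mid (n := n) (i := 2) (by omega),
    phi_X_mid' (n := n) (i := 2) (by omega), e3, pow_zero, one_smul]
  simp (disch := omega) only [lie_f, if_neg, if_pos, if_true, sub_self, smul_zero, sub_zero,
    zero_sub, add_zero, neg_neg, pow_zero, one_smul, lie_neg, zero_add, and_self]

/-- The inner bracket is `(f_{1,1} - f_{2,2}) t`, under which `f_{2,1}` has weight `-2`; the factor
`-1/2` undoes it. For the other sign everything is transposed. -/
theorem phi_loopRoot {n : ℕ} (hn : 4 ≤ n) (m : ℕ) :
    phi n (loopRoot n 1 m) = f n 2 1 (m + 1) 0 ∧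
      phi n (loopRoot n (-1) m) = f n 1 2 (-(m + 1)) 0 := by
  obtain ⟨hC, hC'⟩ := phi_rootC hn
  induction m with
  | zero => simpa [loopRoot] using ⟨hC, hC'⟩
  | succ m ih =>
    obtain ⟨h1, h2⟩ := ih
    have e : (((m + 1 : ℕ) : ℤ)) + 1 = 1 + (m + 1) := by push_cast; ring
    have e' : -((1 : ℤ) + (m + 1)) = -1 + -(m + 1) := by ring
    have two (x : Gl n) : (1 / 2 : ℂ) • (2 : ℤ) • x = x := by
      rw [← Int.cast_smul_eq_zsmul ℂ, smul_smul]
      norm_num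
    have e2 (x : Gl n) : x + x = (2 : ℤ) • x := by module
    rw [loopRoot, loopRoot, e, e']
    simp only [sbr_one, sbr_neg_one, map_neg, map_smul, LieHom.map_lie, h1, h2, hC, hC', lie_neg,
      neg_neg, phi_X_mid (n := n) (i := 1) (by omega), phi_X_mid' (n := n) (i := 1) (by omega),
      one_add_one_eq_two, neg_lie]
    simp (disch := omega) only [lie_f, if_neg, if_pos, if_true, sub_self, smul_zero, sub_zero,
      zero_sub, add_zero, zero_add, neg_neg, pow_zero, one_smul, sub_lie]
    constructor
    · rw [← neg_add', e2, smul_neg, two, neg_neg]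
    · rw [← neg_add', e2, smul_neg, two, neg_neg]

theorem phi_loopH {n : ℕ} (hn : 4 ≤ n) (p : ℤ) :
    phi n (loopH n p) = f n 1 1 p 0 - f n 2 2 p 0 := by
  match p with
  | .ofNat 0 =>
    rw [loopH, phi_H_mid (by omega)]
    rfl
  | .ofNat (m + 1) =>
    rw [loopH, sbr_one, LieHom.map_lie, (phi_loopRoot hn m).1, phi_X_mid (by omega)]
    simp (disch := omega) only [lie_f, if_neg, if_pos, if_true, sub_self, smul_zero, sub_zero,
      zero_add, one_add_one_eq_two]
    rfl
  | .negSucc m =>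
    rw [loopH, sbr_neg_one, map_neg, LieHom.map_lie, (phi_loopRoot hn m).2, phi_X_mid' (by omega)]
    simp (disch := omega) only [lie_f, if_neg, if_pos, if_true, sub_self, smul_zero, sub_zero,
      zero_add, one_add_one_eq_two, neg_sub, Int.negSucc_eq]

/-- None of the contractions here uses the transposed term, so no sign depends on how the single
factor `v` is distributed, and both double brackets have the same value. -/
theorem phi_loop {n : ℕ} (hn : 4 ≤ n) (p : ℤ) :
    phi n (⁅X n 1 1 1, ⁅X n (-1) 1 0, loopH n p⁆⁆ -
      ⁅X n 1 1 0, ⁅X n (-1) 1 1, loopH n p⁆⁆) = 0 := by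
  simp only [map_sub, LieHom.map_lie, phi_loopH hn, phi_X_mid (n := n) (i := 1) (by omega),
    phi_X_mid' (n := n) (i := 1) (by omega), one_add_one_eq_two, lie_sub]
  simp (disch := omega) only [lie_f, if_neg, if_pos, if_true, sub_self, smul_zero, sub_zero,
    zero_sub, zero_add, add_zero, lie_neg]

theorem phi_rel {n : ℕ} (hn : 4 ≤ n) {x y : Free n} (h : Rel n x y) : phi n x = phi n y := by
  cases h with
  | hh i j r s => rw [phi_hh hn, map_zero]
  | hx e i j r s hi hj => exact phi_hx hn e i j r s hi hj
  | xx_ne i j r s hi hj hij hexc => rw [phi_xx_ne hn i j r s hi hj hij hexc, map_zero]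
  | xx_eq i r s hi => exact phi_xx_eq i r s hi
  | xx_n r s => rw [phi_xx_n hn]
  | xx_zero r s => rw [phi_xx_zero hn]
  | exc_n₁ r s => rw [phi_exc_n₁ hn]
  | exc_n₂ r s => rw [phi_exc_n₂ hn]
  | exc_zero₁ r s => rw [phi_exc_zero₁ hn]
  | exc_zero₂ r s => rw [phi_exc_zero₂ hn]
  | top_comm e e' i r s hi hs => rw [phi_top_comm hn e e' i r s hi hs, map_zero]
  | bot_comm e e' i r s hi hs => rw [phi_bot_comm hn e e' i r s hi hs, map_zero]
  | top₁ e r s hs => exact phi_top₁ hn e r s hs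
  | top₂ e r s hs => rw [phi_top₂ hn e r s hs, map_zero]
  | top₃ e r s hs => rw [phi_top₃ hn e r s hs, map_zero]
  | top₄ e r s hs => exact phi_top₄ hn e r s hs
  | bot₁ e r s hs => rw [phi_bot₁ hn e r s hs, map_zero]
  | bot₂ e r s hs => exact phi_bot₂ hn e r s hs
  | bot₃ e r s hs => exact phi_bot₃ hn e r s hs
  | bot₄ e r s hs => rw [phi_bot₄ hn e r s hs, map_zero]
  | same e i r s => rw [phi_same hn, map_zero]
  | shift e i j r s hi hij hj hexc => exact phi_shift hn e i j r s hi hij hj hexc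
  | shift_zero e r s => exact phi_shift_zero hn e r s
  | shift_n e r s => exact phi_shift_n hn e r s
  | serre_zero e i j r s hi hj hij ha h =>
    rw [phi_serre_zero hn e i j r s hi hj hij ha h, map_zero]
  | serre e i j r s t hi hj ha => rw [phi_serre hn e i j r s t hi hj ha, map_zero]
  | serre_exc e i j r h hr => rw [phi_serre_exc hn e i j r h, map_zero]
  | loop p => rw [phi_loop hn, map_zero]

/-! ### Homomorphisms from `D(2n)` -/

/-- A homomorphism from the free Lie algebra that respects the relations factors through `D(2n)`. -/
def liftD {n : ℕ} {L : Type*} [LieRing L] [LieAlgebra ℂ L] (F : Free n →ₗ⁅ℂ⁆ L)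
    (hF : ∀ x y, Rel n x y → F x = F y) : D n →ₗ⁅ℂ⁆ L :=
  { (relIdeal n).toSubmodule.liftQ (F : Free n →ₗ[ℂ] L) (by
      have h : relIdeal n ≤ F.ker := LieSubmodule.lieSpan_le.2 (by
        rintro z ⟨x, y, hxy, rfl⟩
        exact F.mem_ker.2 (by rw [map_sub, hF x y hxy, sub_self]))
      exact fun x hx => F.mem_ker.1 (h hx)) with
    map_lie' := by
      rintro ⟨x⟩ ⟨y⟩
      exact F.map_lie x y }

theorem image_mem_slTau {n : ℕ} (hn : 4 ≤ n) (g : Gen n) : image n g.1 ∈ slTau n := by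
  obtain ⟨g, hg⟩ := g
  cases g with
  | H i r =>
    have e := phi_H n i r hg
    change image n (.H i r) ∈ _
    rw [← e]
    rcases hg with h | ⟨rfl | rfl, h⟩
    · rw [phi_H_mid h]
      exact f_sub_f_mem_slTau n _ _ _ _ (by omega) (by omega)
    · rw [phi_H_zero n h]
      exact neg_mem (add_mem (f_mem_slTau n _ _ _ _ (by omega) (by omega) (Or.inr h))
        (f_mem_slTau n _ _ _ _ (by omega) (by omega) (Or.inr h)))
    · rw [phi_H_last hn h]
      exact add_mem (f_mem_slTau n _ _ _ _ (by omega) (by omega) (Or.inr h))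
        (f_mem_slTau n _ _ _ _ (by omega) (by omega) (Or.inr h))
  | X e i r =>
    have h1 := phi_X n e i r hg
    change image n (.X e i r) ∈ _
    rw [← h1]
    rcases hg with h | ⟨rfl | rfl, h⟩
    · rcases (by omega : i = 0 ∨ (1 ≤ i ∧ i ≤ (n : ℤ) - 1) ∨ i = n) with rfl | h | rfl <;>
      rcases Int.units_eq_one_or e with rfl | rfl
      · rw [phi_X_zero]
        exact smul_int_mem_slTau (f_mem_slTau n _ _ _ _ (by omega) (by omega) (Or.inl (by omega))) _
      · rw [phi_X_zero']
        exact smul_int_mem_slTau (f_mem_slTau n _ _ _ _ (by omega) (by omega) (Or.inl (by omega))) _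
      · rw [phi_X_mid h]
        exact f_mem_slTau n _ _ _ _ (by omega) (by omega) (Or.inl (by omega))
      · rw [phi_X_mid' h]
        exact f_mem_slTau n _ _ _ _ (by omega) (by omega) (Or.inl (by omega))
      · rw [phi_X_last hn]
        exact f_mem_slTau n _ _ _ _ (by omega) (by omega) (Or.inl (by omega))
      · rw [phi_X_last' hn]
        exact f_mem_slTau n _ _ _ _ (by omega) (by omega) (Or.inl (by omega))
    · rcases Int.units_eq_one_or e with rfl | rfl
      · rw [phi_X_bot n h]
        exact f_mem_slTau n _ _ _ _ (by omega) (by omega) (Or.inl (by omega))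
      · rw [phi_X_bot' n h]
        exact f_mem_slTau n _ _ _ _ (by omega) (by omega) (Or.inl (by omega))
    · rcases Int.units_eq_one_or e with rfl | rfl
      · rw [phi_X_top n h]
        exact f_mem_slTau n _ _ _ _ (by omega) (by omega) (Or.inl (by omega))
      · rw [phi_X_top' n h]
        exact f_mem_slTau n _ _ _ _ (by omega) (by omega) (Or.inl (by omega))

/-- The homomorphism `φ` with values in `sl(2n)[u^{±1}, v]^τ`. -/
def phiTau {n : ℕ} (hn : 4 ≤ n) : Free n →ₗ⁅ℂ⁆ slTau n :=
  FreeLieAlgebra.lift ℂ fun g : Gen n => (⟨image n g.1, image_mem_slTau hn g⟩ : slTau n)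

theorem coe_phiTau {n : ℕ} (hn : 4 ≤ n) (x : Free n) : (phiTau hn x : Gl n) = phi n x := by
  have h : (slTau n).incl.comp (phiTau hn) = phi n :=
    FreeLieAlgebra.hom_ext fun g => by
      simp [phiTau, phi, FreeLieAlgebra.lift_of_apply]
  exact congrArg (fun F : Free n →ₗ⁅ℂ⁆ Gl n => F x) h

/-- The homomorphism `π : D(2n) → sl(2n)[u^{±1}, v]^τ`. -/
def piD {n : ℕ} (hn : 4 ≤ n) : D n →ₗ⁅ℂ⁆ slTau n :=
  liftD (phiTau hn) fun x y h => Subtype.ext (by rw [coe_phiTau, coe_phiTau, phi_rel hn h])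

theorem coe_piD_toD {n : ℕ} (hn : 4 ≤ n) (x : Free n) : (piD hn (toD n x) : Gl n) = phi n x :=
  coe_phiTau hn x

open scoped TensorProduct

/-! ### The grading -/

/-- The quotient map as a homomorphism of Lie algebras. -/
def toDHom (n : ℕ) : Free n →ₗ⁅ℂ⁆ D n :=
  { (LieSubmodule.Quotient.mk' (relIdeal n) : Free n →ₗ[ℂ] D n) with
    map_lie' := fun {x y} => LieSubmodule.Quotient.mk_bracket (I := relIdeal n) x y }

theorem toDHom_apply (n : ℕ) (x : Free n) : toDHom n x = toD n x := rfl

theorem toD_lie (n : ℕ) (x y : Free n) : toD n ⁅x, y⁆ = ⁅toD n x, toD n y⁆ :=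
  (toDHom n).map_lie x y

theorem toD_surjective (n : ℕ) : Function.Surjective (toD n) := Quot.mk_surjective

theorem toD_rel {n : ℕ} {x y : Free n} (h : Rel n x y) : toD n x = toD n y := by
  rw [← sub_eq_zero, ← toDHom_apply, ← toDHom_apply, ← map_sub]
  exact (LieSubmodule.Quotient.mk_eq_zero' (N := relIdeal n)).2
    (LieSubmodule.subset_lieSpan ⟨x, y, h, rfl⟩)

/-- The group algebra of `Q × ℕ`. -/
abbrev GrpAlg (n : ℕ) : Type := AddMonoidAlgebra ℂ (Q n × ℕ)

/-- The element `T^d` of the group algebra. -/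
def gexp {n : ℕ} (d : Q n × ℕ) : GrpAlg n := AddMonoidAlgebra.single d 1

theorem gexp_mul {n : ℕ} (d d' : Q n × ℕ) : gexp d * gexp d' = gexp (d + d') := by
  simp [gexp, AddMonoidAlgebra.single_mul_single]

/-- The homomorphism from the free Lie algebra with `g ↦ T^{deg g} ⊗ g`. -/
def coactFree (n : ℕ) : Free n →ₗ⁅ℂ⁆ GrpAlg n ⊗[ℂ] D n :=
  FreeLieAlgebra.lift ℂ fun g : Gen n => gexp (deg n g.1) ⊗ₜ[ℂ] toD n (FreeLieAlgebra.of ℂ g)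

/-- The element `x` of the free Lie algebra is homogeneous of degree `d` in `D(2n)`. -/
def Homog {n : ℕ} (x : Free n) (d : Q n × ℕ) : Prop :=
  coactFree n x = gexp d ⊗ₜ[ℂ] toD n x

theorem homog_sym (n : ℕ) (g : Symb) : Homog (sym n g) (deg n g) := by
  by_cases h : IsGen n g
  · rw [Homog, sym, dif_pos h, coactFree, FreeLieAlgebra.lift_of_apply]
  · rw [Homog, sym_eq_zero n g h, map_zero, ← toDHom_apply, map_zero, TensorProduct.tmul_zero]

theorem homog_zero {n : ℕ} (d : Q n × ℕ) : Homog (0 : Free n) d := by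
  rw [Homog, map_zero, ← toDHom_apply, map_zero, TensorProduct.tmul_zero]

theorem Homog.lie {n : ℕ} {x y : Free n} {d d' : Q n × ℕ} (hx : Homog x d) (hy : Homog y d') :
    Homog ⁅x, y⁆ (d + d') := by
  unfold Homog at *
  rw [LieHom.map_lie, hx, hy, LieAlgebra.ExtendScalars.bracket_tmul, gexp_mul, toD_lie]

theorem Homog.add {n : ℕ} {x y : Free n} {d : Q n × ℕ} (hx : Homog x d) (hy : Homog y d) :
    Homog (x + y) d := by
  unfold Homog at *
  rw [map_add, hx, hy, ← toDHom_apply, ← toDHom_apply, ← toDHom_apply, map_add,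
    TensorProduct.tmul_add]

theorem Homog.neg {n : ℕ} {x : Free n} {d : Q n × ℕ} (hx : Homog x d) : Homog (-x) d := by
  unfold Homog at *
  rw [map_neg, hx, ← toDHom_apply, ← toDHom_apply, map_neg, TensorProduct.tmul_neg]

theorem Homog.smul {n : ℕ} {x : Free n} {d : Q n × ℕ} (hx : Homog x d) (c : ℂ) :
    Homog (c • x) d := by
  unfold Homog at *
  rw [map_smul, hx, ← toDHom_apply, ← toDHom_apply, map_smul, TensorProduct.tmul_smul]

theorem Homog.zsmul {n : ℕ} {x : Free n} {d : Q n × ℕ} (hx : Homog x d) (c : ℤ) :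
    Homog (c • x) d := by
  rw [← Int.cast_smul_eq_zsmul ℂ]
  exact hx.smul _

/-- The degree of `X^+_{i,r}` in the root lattice. -/
def rt (n : ℕ) (i : ℤ) : Q n :=
  if i = n + 1 then simple n n - simple n (n - 1)
  else if i = -1 then simple n 0 - simple n 1 else simple n i

theorem homog_X (n : ℕ) (e : ℤˣ) (i : ℤ) (r : ℕ) : Homog (X n e i r) ((e : ℤ) • rt n i, r) :=
  homog_sym n (.X e i r)

theorem homog_H (n : ℕ) (i : ℤ) (r : ℕ) : Homog (H n i r) (0, r) :=
  homog_sym n (.H i r)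

theorem rt_of_mem {n : ℕ} {i : ℤ} (h : 0 ≤ i ∧ i ≤ n) : rt n i = simple n i := by
  rw [rt, if_neg (by omega), if_neg (by omega)]

theorem rt_top (n : ℕ) : rt n (n + 1) = simple n n - simple n (n - 1) := by
  rw [rt, if_pos rfl]

theorem rt_bot (n : ℕ) : rt n (-1) = simple n 0 - simple n 1 := by
  rw [rt, if_neg (by omega), if_pos rfl]

/-- For relation 9 it is enough that `loopH n p` has some degree: the same element occurs on both
sides, so its value is never needed. -/
theorem Homog.sbr {n : ℕ} {x y : Free n} (e : ℤˣ) (hx : ∃ d, Homog x d) (hy : ∃ d, Homog y d) :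
    ∃ d, Homog (sbr e x y) d := by
  obtain ⟨d, hx⟩ := hx
  obtain ⟨d', hy⟩ := hy
  exact ⟨_, (hx.lie hy).zsmul _⟩

theorem homog_rootA (n : ℕ) (e : ℤˣ) (m : ℕ) : ∃ d, Homog (rootA n e m) d := by
  induction m with
  | zero => exact ⟨_, homog_X n e 2 0⟩
  | succ m ih => exact Homog.sbr e ih ⟨_, homog_X n e _ 0⟩

theorem homog_rootB (n : ℕ) (e : ℤˣ) (m : ℕ) : ∃ d, Homog (rootB n e m) d := by
  induction m with
  | zero => exact Homog.sbr e (homog_rootA n e _) ⟨_, homog_X n e _ 0⟩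
  | succ m ih => exact (Homog.sbr e ih ⟨_, homog_X n e _ 0⟩).imp fun _ h => h.neg

theorem homog_rootC (n : ℕ) (e : ℤˣ) : ∃ d, Homog (rootC n e) d :=
  (Homog.sbr e (homog_rootB n e _)
    (Homog.sbr e ⟨_, homog_X n e 2 0⟩ ⟨_, homog_X n e 0 0⟩)).imp fun _ h => h.neg

theorem homog_loopRoot (n : ℕ) (e : ℤˣ) (m : ℕ) : ∃ d, Homog (loopRoot n e m) d := by
  induction m with
  | zero => exact homog_rootC n e
  | succ m ih =>
    exact (Homog.sbr e (Homog.sbr e ⟨_, homog_X n e 1 0⟩ (homog_rootC n e)) ih).imp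
      fun _ h => (h.smul _).neg

theorem homog_loopH (n : ℕ) (p : ℤ) : ∃ d, Homog (loopH n p) d := by
  match p with
  | .ofNat 0 => exact ⟨_, homog_H n 1 0⟩
  | .ofNat (m + 1) => exact Homog.sbr 1 ⟨_, homog_X n 1 1 0⟩ (homog_loopRoot n 1 m)
  | .negSucc m => exact Homog.sbr (-1) ⟨_, homog_X n (-1) 1 0⟩ (homog_loopRoot n (-1) m)

/-- This is what lets the coaction descend to `D(2n)`. As `0` is homogeneous of every degree,
degrees have to be compared only in the relations whose right side can be non-zero. -/
theorem homog_rel {n : ℕ} (hn : 4 ≤ n) {x y : Free n} (h : Rel n x y) : ∃ d, Homog x d ∧ Homog y d := by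
  cases h with
  | hh i j r s => exact ⟨_, (homog_H n i r).lie (homog_H n j s), homog_zero _⟩
  | hx e i j r s hi hj =>
    refine ⟨_, (homog_H n i r).lie (homog_X n e j s), ?_⟩
    rw [Prod.mk_add_mk, zero_add]
    exact (homog_X n e j (r + s)).zsmul _
  | xx_ne i j r s hi hj hij hexc =>
    exact ⟨_, (homog_X n _ i r).lie (homog_X n _ j s), homog_zero _⟩
  | xx_eq i r s hi =>
    refine ⟨_, (homog_X n _ i r).lie (homog_X n _ i s), ?_⟩
    convert homog_H n i (r + s) using 1
    simp
  | xx_n r s =>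
    refine ⟨_, (homog_X n _ n r).lie (homog_X n _ n s), ?_⟩
    have e : (((1 : ℤˣ) : ℤ) • rt n n, r) + (((-1 : ℤˣ) : ℤ) • rt n n, s) = (0, r + s) := by simp
    rw [e]
    split_ifs
    · exact homog_H n n (r + s)
    · exact homog_H n (n - 1) (r + s)
  | xx_zero r s =>
    refine ⟨_, (homog_X n _ 0 r).lie (homog_X n _ 0 s), ?_⟩
    have e : (((1 : ℤˣ) : ℤ) • rt n 0, r) + (((-1 : ℤˣ) : ℤ) • rt n 0, s) = (0, r + s) := by simp
    rw [e]
    split_ifs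
    · exact homog_H n 0 (r + s)
    · exact homog_H n 1 (r + s)
  | exc_n₁ r s =>
    refine ⟨_, (homog_X n _ _ r).lie (homog_X n _ _ s), ?_⟩
    split_ifs
    · convert (homog_X n (-1) (n + 1) (r + s)).neg using 1
      rw [rt_top, rt_of_mem (by omega), rt_of_mem (by omega)]
      exact Prod.ext (by simp; abel) rfl
    · exact homog_zero _
  | exc_n₂ r s =>
    refine ⟨_, (homog_X n _ _ r).lie (homog_X n _ _ s), ?_⟩
    split_ifs
    · convert (homog_X n 1 (n + 1) (r + s)).neg using 1
      rw [rt_top, rt_of_mem (by omega), rt_of_mem (by omega)]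
      exact Prod.ext (by simp; abel) rfl
    · exact homog_zero _
  | exc_zero₁ r s =>
    refine ⟨_, (homog_X n _ _ r).lie (homog_X n _ _ s), ?_⟩
    split_ifs
    · convert (homog_X n 1 (-1) (r + s)).neg using 1
      rw [rt_bot, rt_of_mem (by omega), rt_of_mem (by omega)]
      exact Prod.ext (by simp; abel) rfl
    · exact homog_zero _
  | exc_zero₂ r s =>
    refine ⟨_, (homog_X n _ _ r).lie (homog_X n _ _ s), ?_⟩
    split_ifs
    · convert (homog_X n (-1) (-1) (r + s)).neg using 1
      rw [rt_bot, rt_of_mem (by omega), rt_of_mem (by omega)]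
      exact Prod.ext (by simp; abel) rfl
    · exact homog_zero _
  | top_comm e e' i r s hi hs =>
    exact ⟨_, (homog_X n _ _ r).lie (homog_X n _ _ s), homog_zero _⟩
  | bot_comm e e' i r s hi hs =>
    exact ⟨_, (homog_X n _ _ r).lie (homog_X n _ _ s), homog_zero _⟩
  | top₁ e r s hs =>
    refine ⟨_, (homog_X n _ _ r).lie (homog_X n _ _ s), ?_⟩
    convert (homog_X n e n (r + s)).zsmul _ using 1
    rw [rt_top, rt_of_mem (by omega), rt_of_mem (by omega)]
    exact Prod.ext (by rw [Prod.fst_add]; module) rfl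
  | top₂ e r s hs => exact ⟨_, (homog_X n _ _ r).lie (homog_X n _ _ s), homog_zero _⟩
  | top₃ e r s hs => exact ⟨_, (homog_X n _ _ r).lie (homog_X n _ _ s), homog_zero _⟩
  | top₄ e r s hs =>
    refine ⟨_, (homog_X n _ _ r).lie (homog_X n _ _ s), ?_⟩
    convert ((homog_X n (-e) (n - 1) (r + s)).zsmul _).neg using 1
    rw [rt_top, rt_of_mem (by omega), rt_of_mem (by omega)]
    exact Prod.ext (by rw [Prod.fst_add, Units.val_neg]; module) rfl
  | bot₁ e r s hs => exact ⟨_, (homog_X n _ _ r).lie (homog_X n _ _ s), homog_zero _⟩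
  | bot₂ e r s hs =>
    refine ⟨_, (homog_X n _ _ r).lie (homog_X n _ _ s), ?_⟩
    convert ((homog_X n (-e) 1 (r + s)).zsmul _).neg using 1
    rw [rt_bot, rt_of_mem (by omega), rt_of_mem (by omega)]
    exact Prod.ext (by rw [Prod.fst_add, Units.val_neg]; module) rfl
  | bot₃ e r s hs =>
    refine ⟨_, (homog_X n _ _ r).lie (homog_X n _ _ s), ?_⟩
    convert (homog_X n e 0 (r + s)).zsmul _ using 1
    rw [rt_bot, rt_of_mem (by omega), rt_of_mem (by omega)]
    exact Prod.ext (by rw [Prod.fst_add]; module) rfl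
  | bot₄ e r s hs => exact ⟨_, (homog_X n _ _ r).lie (homog_X n _ _ s), homog_zero _⟩
  | same e i r s => exact ⟨_, (homog_X n _ _ r).lie (homog_X n _ _ s), homog_zero _⟩
  | shift e i j r s hi hij hj hexc =>
    refine ⟨_, (homog_X n _ _ (r + 1)).lie (homog_X n _ _ s), ?_⟩
    convert (homog_X n e i r).lie (homog_X n e j (s + 1)) using 1
    exact Prod.ext rfl (by simp only [Prod.snd_add]; omega)
  | shift_zero e r s =>
    refine ⟨_, (homog_X n _ _ (r + 1)).lie (homog_X n _ _ s), ?_⟩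
    convert ((homog_X n e 0 r).lie (homog_X n e 1 (s + 1))).neg using 1
    exact Prod.ext rfl (by simp only [Prod.snd_add]; omega)
  | shift_n e r s =>
    refine ⟨_, (homog_X n _ _ (r + 1)).lie (homog_X n _ _ s), ?_⟩
    convert ((homog_X n e (n - 1) r).lie (homog_X n e n (s + 1))).neg using 1
    exact Prod.ext rfl (by simp only [Prod.snd_add]; omega)
  | serre_zero e i j r s hi hj hij ha h =>
    exact ⟨_, (homog_X n _ _ r).lie (homog_X n _ _ s), homog_zero _⟩
  | serre e i j r s t hi hj ha =>
    exact ⟨_, (homog_X n _ _ r).lie ((homog_X n _ _ s).lie (homog_X n _ _ t)), homog_zero _⟩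
  | serre_exc e i j r h hr =>
    exact ⟨_, (homog_X n _ _ 0).lie ((homog_X n _ _ 0).lie (homog_X n _ _ r)), homog_zero _⟩
  | loop p =>
    obtain ⟨d, hd⟩ := homog_loopH n p
    have h1 := (homog_X n 1 1 1).lie ((homog_X n (-1) 1 0).lie hd)
    have h2 := (homog_X n 1 1 0).lie ((homog_X n (-1) 1 1).lie hd)
    refine ⟨_, ?_, homog_zero ((((1 : ℤˣ) : ℤ) • rt n 1, 1) +
      ((((-1 : ℤˣ) : ℤ) • rt n 1, 0) + d))⟩
    rw [sub_eq_add_neg]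
    refine h1.add ?_
    convert h2.neg using 1
    exact Prod.ext rfl (by simp only [Prod.snd_add]; omega)

/-- The coaction of the group algebra of `Q × ℕ` on `D(2n)`. -/
def coact {n : ℕ} (hn : 4 ≤ n) : D n →ₗ⁅ℂ⁆ GrpAlg n ⊗[ℂ] D n :=
  liftD (coactFree n) fun x y h => by
    obtain ⟨d, hx, hy⟩ := homog_rel hn h
    rw [hx, hy, toD_rel h]

theorem coact_toD {n : ℕ} (hn : 4 ≤ n) (x : Free n) : coact hn (toD n x) = coactFree n x := rfl

/-- The bracket of the scalar extension multiplies the group elements, so degrees add along iterated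
brackets. -/
theorem coact_monomial {n : ℕ} (hn : 4 ≤ n) {x : D n} {d : Q n × ℕ} (h : IsMonomial n x d) :
    coact hn x = gexp d ⊗ₜ[ℂ] x := by
  induction h with
  | gen g => rw [coact_toD, coactFree, FreeLieAlgebra.lift_of_apply]
  | lie _ _ ihx ihy =>
    rw [LieHom.map_lie, ihx, ihy, LieAlgebra.ExtendScalars.bracket_tmul, gexp_mul]

/-- The coefficient of `T^d`. -/
def gcoeff {n : ℕ} (d : Q n × ℕ) : GrpAlg n →ₗ[ℂ] ℂ :=
  Finsupp.lapply d ∘ₗ (AddMonoidAlgebra.coeffLinearEquiv ℂ).toLinearMap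

theorem gcoeff_gexp {n : ℕ} (d d' : Q n × ℕ) :
    gcoeff d (gexp d' : GrpAlg n) = if d' = d then 1 else 0 := by
  simp [gcoeff, gexp, Finsupp.single_apply]

/-- The homogeneous component of degree `d`. -/
def proj {n : ℕ} (hn : 4 ≤ n) (d : Q n × ℕ) : D n →ₗ[ℂ] D n :=
  (TensorProduct.lid ℂ (D n)).toLinearMap ∘ₗ LinearMap.rTensor (D n) (gcoeff d) ∘ₗ
      (coact hn : D n →ₗ[ℂ] GrpAlg n ⊗[ℂ] D n)

theorem proj_monomial {n : ℕ} (hn : 4 ≤ n) {x : D n} {d : Q n × ℕ} (h : IsMonomial n x d)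
    (d' : Q n × ℕ) : proj hn d' x = if d = d' then x else 0 := by
  have e : proj hn d' x = TensorProduct.lid ℂ (D n) (LinearMap.rTensor (D n)
    (gcoeff d') (coact hn x)) := rfl
  rw [e, coact_monomial hn h, LinearMap.rTensor_tmul, gcoeff_gexp, TensorProduct.lid_tmul]
  split_ifs <;> simp

theorem proj_piece {n : ℕ} (hn : 4 ≤ n) {x : D n} {α : Q n} {k : ℕ} (h : x ∈ piece n α k)
    (d : Q n × ℕ) : proj hn d x = if (α, k) = d then x else 0 := by
  induction h using Submodule.span_induction with
  | mem x h => exact proj_monomial hn h d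
  | zero => simp
  | add x y _ _ hx hy =>
    rw [map_add, hx, hy]
    split_ifs <;> simp
  | smul c x _ hx =>
    rw [map_smul, hx]
    split_ifs <;> simp

/-- By freeness the quotient map factors through the subalgebra generated by the images of the
generators, and it is surjective. -/
theorem lieSpan_gen (n : ℕ) : LieSubalgebra.lieSpan ℂ (D n)
    (Set.range fun g : Gen n => toD n (FreeLieAlgebra.of ℂ g)) = ⊤ := by
  set S := LieSubalgebra.lieSpan ℂ (D n)
    (Set.range fun g : Gen n => toD n (FreeLieAlgebra.of ℂ g)) with hS
  let F : Free n →ₗ⁅ℂ⁆ S := FreeLieAlgebra.lift ℂ fun g : Gen n =>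
    (⟨toD n (FreeLieAlgebra.of ℂ g), LieSubalgebra.subset_lieSpan ⟨g, rfl⟩⟩ : S)
  have h : S.incl.comp F = toDHom n := FreeLieAlgebra.hom_ext fun g => by
    simp [F, FreeLieAlgebra.lift_of_apply, toDHom_apply]
  rw [eq_top_iff]
  rintro x -
  obtain ⟨y, rfl⟩ := toD_surjective n x
  rw [← toDHom_apply, ← h]
  exact (F y).2

theorem lie_mem_piece {n : ℕ} {x y : D n} {α β : Q n} {k l : ℕ} (hx : x ∈ piece n α k)
    (hy : y ∈ piece n β l) : ⁅x, y⁆ ∈ piece n (α + β) (k + l) := by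
  induction hx using Submodule.span_induction with
  | zero => rw [zero_lie]; exact zero_mem _
  | add a b _ _ ha hb => rw [add_lie]; exact add_mem ha hb
  | smul c a _ ha => rw [smul_lie]; exact Submodule.smul_mem _ _ ha
  | mem x h =>
    induction hy using Submodule.span_induction with
    | zero => rw [lie_zero]; exact zero_mem _
    | add a b _ _ ha hb => rw [lie_add]; exact add_mem ha hb
    | smul c a _ ha => rw [lie_smul]; exact Submodule.smul_mem _ _ ha
    | mem y h' => exact Submodule.subset_span (h.lie h')

/-- Brackets of pieces lie in pieces, so the sum is a subalgebra; it contains the generators. -/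
theorem iSup_piece (n : ℕ) : (⨆ d : Q n × ℕ, piece n d.1 d.2) = ⊤ := by
  let M : LieSubalgebra ℂ (D n) :=
    { (⨆ d : Q n × ℕ, piece n d.1 d.2 : Submodule ℂ (D n)) with
      lie_mem' := by
        intro x y hx hy
        change x ∈ (⨆ d : Q n × ℕ, piece n d.1 d.2 : Submodule ℂ (D n)) at hx
        change y ∈ (⨆ d : Q n × ℕ, piece n d.1 d.2 : Submodule ℂ (D n)) at hy
        change ⁅x, y⁆ ∈ (⨆ d : Q n × ℕ, piece n d.1 d.2 : Submodule ℂ (D n))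
        induction hx using Submodule.iSup_induction' with
        | zero => rw [zero_lie]; exact zero_mem _
        | add a b _ _ ha hb => rw [add_lie]; exact add_mem ha hb
        | mem d x hx =>
          induction hy using Submodule.iSup_induction' with
          | zero => rw [lie_zero]; exact zero_mem _
          | add a b _ _ ha hb => rw [lie_add]; exact add_mem ha hb
          | mem d' y hy =>
            exact Submodule.mem_iSup_of_mem (d + d') (lie_mem_piece hx hy) }
  have h : (⊤ : LieSubalgebra ℂ (D n)) ≤ M := by
    rw [← lieSpan_gen, LieSubalgebra.lieSpan_le]
    rintro _ ⟨g, rfl⟩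
    exact Submodule.mem_iSup_of_mem (deg n g.1)
      (Submodule.subset_span (IsMonomial.gen g))
  exact eq_top_iff.2 fun x _ => h (LieSubalgebra.mem_top x)

/-- `proj hn d` is the identity on the piece of degree `d` and kills all the others, so an element
of both a piece and the sum of the others equals its own projection, which is zero. -/
theorem isInternal_piece {n : ℕ} (hn : 4 ≤ n) :
    DirectSum.IsInternal (fun d : Q n × ℕ => piece n d.1 d.2) := by
  rw [DirectSum.isInternal_submodule_iff_iSupIndep_and_iSup_eq_top]
  refine ⟨fun d => ?_, iSup_piece n⟩
  rw [Submodule.disjoint_def]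
  intro x hx hx'
  have h : (⨆ j, ⨆ (_ : j ≠ d), piece n j.1 j.2) ≤ LinearMap.ker (proj hn d) :=
    iSup₂_le fun j hj y hy => by
      rw [LinearMap.mem_ker, proj_piece hn hy, if_neg hj]
  have h1 := proj_piece hn hx d
  rw [if_pos rfl] at h1
  rw [← h1, LinearMap.mem_ker.1 (h hx')]

theorem proj_mem_piece {n : ℕ} (hn : 4 ≤ n) (d : Q n × ℕ) (x : D n) :
    proj hn d x ∈ piece n d.1 d.2 := by
  have hx : x ∈ ⨆ d : Q n × ℕ, piece n d.1 d.2 := by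
    rw [iSup_piece]
    trivial
  induction hx using Submodule.iSup_induction' with
  | zero => rw [map_zero]; exact zero_mem _
  | add a b _ _ ha hb => rw [map_add]; exact add_mem ha hb
  | mem d' y hy =>
    rw [proj_piece hn hy]
    split_ifs with h
    · rwa [← h]
    · exact zero_mem _

/-! ### The defining relations in `D(2n)` -/

/-- The element `X^±_{i,r}` of `D(2n)`. -/
def xD (n : ℕ) (e : ℤˣ) (i : ℤ) (r : ℕ) : D n := toD n (X n e i r)

/-- The element `H_{i,r}` of `D(2n)`. -/
def hD (n : ℕ) (i : ℤ) (r : ℕ) : D n := toD n (H n i r)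

theorem toD_zero (n : ℕ) : toD n 0 = 0 := map_zero (toDHom n)

theorem toD_neg {n : ℕ} (x : Free n) : toD n (-x) = -toD n x := map_neg (toDHom n) x

theorem toD_zsmul {n : ℕ} (c : ℤ) (x : Free n) : toD n (c • x) = c • toD n x :=
  map_zsmul (toDHom n) c x

theorem toD_of {n : ℕ} (g : Gen n) : toD n (FreeLieAlgebra.of ℂ g) = toD n (sym n g.1) := by
  rw [sym, dif_pos g.2]

theorem xD_eq_zero (n : ℕ) (e : ℤˣ) (i : ℤ) (r : ℕ)
    (h : ¬ ((0 ≤ i ∧ i ≤ n) ∨ ((i = -1 ∨ i = n + 1) ∧ Odd r))) : xD n e i r = 0 := by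
  rw [xD, X_eq_zero n e i r h, toD_zero]

theorem xD_top_even (n : ℕ) (e : ℤˣ) {r : ℕ} (h : ¬ Odd r) : xD n e (n + 1) r = 0 :=
  xD_eq_zero n e _ r (fun h' => h'.elim (fun h' => by omega) fun h' => h h'.2)

theorem xD_bot_even (n : ℕ) (e : ℤˣ) {r : ℕ} (h : ¬ Odd r) : xD n e (-1) r = 0 :=
  xD_eq_zero n e _ r (fun h' => h'.elim (fun h' => by omega) fun h' => h h'.2)

theorem lie_hD_xD {n : ℕ} (e : ℤˣ) (i j : ℤ) (r s : ℕ)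
    (hi : (1 ≤ i ∧ i ≤ n - 1) ∨ ((i = 0 ∨ i = n) ∧ Even r)) (hj : 0 ≤ j ∧ j ≤ n) :
    ⁅hD n i r, xD n e j s⁆ = ((e : ℤ) * a n r i j) • xD n e j (r + s) := by
  have h := toD_rel (Rel.hx e i j r s hi hj)
  rwa [toD_lie, toD_zsmul] at h

theorem lie_xD_xD_ne {n : ℕ} (e : ℤˣ) (i j : ℤ) (r s : ℕ) (hi : 0 ≤ i ∧ i ≤ n) (hj : 0 ≤ j ∧ j ≤ n)
    (hij : i ≠ j) (hexc : ¬ Exc n i j) : ⁅xD n e i r, xD n (-e) j s⁆ = 0 := by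
  have hexc' : ¬ Exc n j i := by
    unfold Exc at hexc ⊢
    omega
  rcases Int.units_eq_one_or e with rfl | rfl
  · have h := toD_rel (Rel.xx_ne i j r s hi hj hij hexc)
    rwa [toD_lie, toD_zero] at h
  · have h := toD_rel (Rel.xx_ne j i s r hj hi hij.symm hexc')
    rw [toD_lie, toD_zero] at h
    rw [neg_neg]
    exact lie_eq_zero_symm h

theorem lie_xD_same {n : ℕ} (e : ℤˣ) (i : ℤ) (r s : ℕ) : ⁅xD n e i r, xD n e i s⁆ = 0 := by
  have h := toD_rel (Rel.same (n := n) e i r s)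
  rwa [toD_lie, toD_zero] at h

/-- A symbol that is not a generator stands for `0`, so `xD n e (n + 1)` vanishes in even degree and
absorbs the parity case of relation 3; the factor `-e` merges the two signs. -/
theorem lie_xD_last_pred {n : ℕ} (e : ℤˣ) (r s : ℕ) :
    ⁅xD n e n r, xD n (-e) (n - 1) s⁆ = (-(e : ℤ)) • xD n e (n + 1) (r + s) := by
  rcases Int.units_eq_one_or e with rfl | rfl
  · have h := toD_rel (Rel.exc_n₂ (n := n) r s)
    rw [toD_lie] at h
    change ⁅xD n 1 n r, xD n (-1) (n - 1) s⁆ = _ at h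
    rw [h]
    split_ifs with h'
    · rw [toD_neg, Units.val_one, neg_one_smul, xD]
    · rw [xD_top_even n _ h', toD_zero, smul_zero]
  · have h := toD_rel (Rel.exc_n₁ (n := n) s r)
    rw [toD_lie] at h
    change ⁅xD n 1 (n - 1) s, xD n (-1) n r⁆ = _ at h
    rw [neg_neg, ← lie_skew, h, add_comm s r]
    split_ifs with h'
    · rw [toD_neg, neg_neg, Units.val_neg, Units.val_one, neg_neg, one_smul, xD]
    · rw [xD_top_even n _ h', toD_zero, smul_zero, neg_zero]

theorem lie_xD_pred_last {n : ℕ} (e : ℤˣ) (r s : ℕ) :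
    ⁅xD n e (n - 1) r, xD n (-e) n s⁆ = (-(e : ℤ)) • xD n (-e) (n + 1) (r + s) := by
  have h := lie_xD_last_pred (n := n) (-e) s r
  rw [neg_neg] at h
  rw [← lie_skew, h, add_comm s r, Units.val_neg, neg_neg, neg_smul]

theorem lie_xD_zero_one {n : ℕ} (e : ℤˣ) (r s : ℕ) :
    ⁅xD n e 0 r, xD n (-e) 1 s⁆ = (-(e : ℤ)) • xD n e (-1) (r + s) := by
  rcases Int.units_eq_one_or e with rfl | rfl
  · have h := toD_rel (Rel.exc_zero₁ (n := n) r s)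
    rw [toD_lie] at h
    change ⁅xD n 1 0 r, xD n (-1) 1 s⁆ = _ at h
    rw [h]
    split_ifs with h'
    · rw [toD_neg, Units.val_one, neg_one_smul, xD]
    · rw [xD_bot_even n _ h', toD_zero, smul_zero]
  · have h := toD_rel (Rel.exc_zero₂ (n := n) s r)
    rw [toD_lie] at h
    change ⁅xD n 1 1 s, xD n (-1) 0 r⁆ = _ at h
    rw [neg_neg, ← lie_skew, h, add_comm s r]
    split_ifs with h'
    · rw [toD_neg, neg_neg, Units.val_neg, Units.val_one, neg_neg, one_smul, xD]
    · rw [xD_bot_even n _ h', toD_zero, smul_zero, neg_zero]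

theorem lie_xD_one_zero {n : ℕ} (e : ℤˣ) (r s : ℕ) :
    ⁅xD n e 1 r, xD n (-e) 0 s⁆ = (-(e : ℤ)) • xD n (-e) (-1) (r + s) := by
  have h := lie_xD_zero_one (n := n) (-e) s r
  rw [neg_neg] at h
  rw [← lie_skew, h, add_comm s r, Units.val_neg, neg_neg, neg_smul]

/-- At the nodes `0` and `n` the index on the right depends on parity. Later arguments need only
that the symbol is a generator, hence acts diagonally, and that the index is `i` in even degree. -/
theorem lie_xD_xD_eq {n : ℕ} (hn : 4 ≤ n) (e : ℤˣ) (i : ℤ) (r s : ℕ) (hi : 0 ≤ i ∧ i ≤ n) :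
    ∃ j : ℤ, ((1 ≤ j ∧ j ≤ n - 1) ∨ ((j = 0 ∨ j = n) ∧ Even (r + s))) ∧
      (Even (r + s) → j = i) ∧ ⁅xD n e i r, xD n (-e) i s⁆ = (e : ℤ) • hD n j (r + s) := by
  have key (r s : ℕ) : ∃ j : ℤ, ((1 ≤ j ∧ j ≤ n - 1) ∨ ((j = 0 ∨ j = n) ∧ Even (r + s))) ∧
      (Even (r + s) → j = i) ∧ ⁅xD n 1 i r, xD n (-1) i s⁆ = hD n j (r + s) := by
    rcases (by omega : i = 0 ∨ (1 ≤ i ∧ i ≤ (n : ℤ) - 1) ∨ i = n) with rfl | h | rfl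
    · have h := toD_rel (Rel.xx_zero (n := n) r s)
      rw [toD_lie] at h
      change ⁅xD n 1 0 r, xD n (-1) 0 s⁆ = _ at h
      rw [h]
      split_ifs with h'
      · exact ⟨0, Or.inr ⟨Or.inl rfl, h'⟩, fun _ => rfl, rfl⟩
      · exact ⟨1, Or.inl (by omega), fun h => absurd h h', rfl⟩
    · have h1 := toD_rel (Rel.xx_eq (n := n) i r s h)
      rw [toD_lie] at h1
      exact ⟨i, Or.inl h, fun _ => rfl, h1⟩
    · have h := toD_rel (Rel.xx_n (n := n) r s)
      rw [toD_lie] at h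
      change ⁅xD n 1 n r, xD n (-1) n s⁆ = _ at h
      rw [h]
      split_ifs with h'
      · exact ⟨n, Or.inr ⟨Or.inr rfl, h'⟩, fun _ => rfl, rfl⟩
      · exact ⟨n - 1, Or.inl (by omega), fun h => absurd h h', rfl⟩
  rcases Int.units_eq_one_or e with rfl | rfl
  · obtain ⟨j, h1, h2, h3⟩ := key r s
    exact ⟨j, h1, h2, by rw [h3, Units.val_one, one_smul]⟩
  · obtain ⟨j, h1, h2, h3⟩ := key s r
    rw [add_comm s r] at *
    exact ⟨j, h1, h2, by rw [neg_neg, ← lie_skew, h3, Units.val_neg, Units.val_one, neg_one_smul]⟩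

theorem lie_xD_eq_zero {n : ℕ} (e : ℤˣ) (i j : ℤ) (r s : ℕ) (hi : 0 ≤ i ∧ i ≤ n)
    (hj : 0 ≤ j ∧ j ≤ n) (hij : i ≠ j) (ha : a n 0 i j = 0) (h : ¬ Exc n i j ∨ Even (r + s)) :
    ⁅xD n e i r, xD n e j s⁆ = 0 := by
  have h := toD_rel (Rel.serre_zero e i j r s hi hj hij ha h)
  rwa [toD_lie, toD_zero] at h

theorem a_eq_zero {n : ℕ} {i j : ℤ} (hij : i ≠ j) (h : ¬ Edge n i j) (h' : ¬ Edge n j i) :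
    a n 0 i j = 0 := by
  have h0 : ¬ Odd 0 := by decide
  rw [a, if_neg hij, if_neg (by simp only [h0, false_and, not_false_eq_true]),
    if_neg (by tauto)]

/-- The `X^±_{i,r}` with `0 ≤ i ≤ n` are permuted, up to scalars, by the `X^±_{n+1,s}`. -/
theorem lie_xD_top {n : ℕ} (hn : 4 ≤ n) (e e' : ℤˣ) (i : ℤ) (r s : ℕ) (hi : 0 ≤ i ∧ i ≤ n) :
    ∃ j : ℤ, (0 ≤ j ∧ j ≤ n) ∧ ∃ c : ℤ,
      ⁅xD n e i r, xD n e' (n + 1) s⁆ = c • xD n e j (r + s) := by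
  by_cases hs : Odd s
  swap
  · exact ⟨0, by omega, 0, by rw [xD_top_even n _ hs, lie_zero, zero_smul]⟩
  have he : e' = e ∨ e' = -e := by
    rcases Int.units_eq_one_or e with rfl | rfl <;>
    rcases Int.units_eq_one_or e' with rfl | rfl <;> simp
  rcases (by omega : i = 0 ∨ (1 ≤ i ∧ i ≤ (n : ℤ) - 2) ∨ i = n - 1 ∨ i = n)
    with rfl | h | rfl | rfl
  · refine ⟨0, by omega, 0, ?_⟩
    -- Relation 4 does not list `[X_{0,r}, X_{n+1,s}]`. It vanishes because `X_{n+1,s}` is a bracket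
    -- of `X_n` and `X_{n-1}` of opposite signs, and `X_{0,r}` commutes with both.
    have h1 := lie_xD_last_pred (n := n) e' s 0
    have h2 : ⁅xD n e 0 r, ⁅xD n e' n s, xD n (-e') (n - 1) 0⁆⁆ = 0 := by
      have hz (e'' : ℤˣ) (j : ℤ) (t : ℕ) (hj : j = n - 1 ∨ j = n) :
          ⁅xD n e 0 r, xD n e'' j t⁆ = 0 := by
        have he : e'' = e ∨ e'' = -e := by
          rcases Int.units_eq_one_or e with rfl | rfl <;>
          rcases Int.units_eq_one_or e'' with rfl | rfl <;> simp
        have hexc : ¬ Exc n 0 j := by unfold Exc; omega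
        rcases he with rfl | rfl
        · exact lie_xD_eq_zero _ _ _ _ _ (by omega) (by omega) (by omega)
            (a_eq_zero (by omega) (by unfold Edge; omega) (by unfold Edge; omega)) (Or.inl hexc)
        · exact lie_xD_xD_ne _ _ _ _ _ (by omega) (by omega) (by omega) hexc
      rw [leibniz_lie, hz _ _ _ (Or.inr rfl), hz _ _ _ (Or.inl rfl), zero_lie, lie_zero, add_zero]
    rw [h1, add_zero, lie_smul] at h2
    have h3 := congrArg (fun z => (-(e' : ℤ)) • z) h2
    simp only [smul_smul, smul_zero, neg_mul_neg] at h3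
    rw [← Units.val_mul, Int.units_mul_self, Units.val_one, one_smul] at h3
    rw [h3, zero_smul]
  · refine ⟨i, by omega, 0, ?_⟩
    have h1 := toD_rel (Rel.top_comm (n := n) e e' i r s h hs)
    rw [toD_lie, toD_zero] at h1
    rw [zero_smul]
    exact h1
  · rcases he with rfl | rfl
    · have h1 := toD_rel (Rel.top₁ (n := n) e' r s hs)
      rw [toD_lie, toD_zsmul] at h1
      exact ⟨n, by omega, _, h1⟩
    · have h1 := toD_rel (Rel.top₂ (n := n) (-e) r s hs)
      rw [toD_lie, toD_zero, neg_neg] at h1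
      exact ⟨0, by omega, 0, by rw [zero_smul]; exact h1⟩
  · rcases he with rfl | rfl
    · have h1 := toD_rel (Rel.top₃ (n := n) e' r s hs)
      rw [toD_lie, toD_zero] at h1
      exact ⟨0, by omega, 0, by rw [zero_smul]; exact h1⟩
    · have h1 := toD_rel (Rel.top₄ (n := n) (-e) r s hs)
      rw [toD_lie, toD_neg, toD_zsmul, neg_neg, ← neg_smul] at h1
      exact ⟨n - 1, by omega, _, h1⟩

/-- The `X^±_{i,r}` with `0 ≤ i ≤ n` are permuted, up to scalars, by the `X^±_{-1,s}`. -/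
theorem lie_xD_bot {n : ℕ} (hn : 4 ≤ n) (e e' : ℤˣ) (i : ℤ) (r s : ℕ) (hi : 0 ≤ i ∧ i ≤ n) :
    ∃ j : ℤ, (0 ≤ j ∧ j ≤ n) ∧ ∃ c : ℤ,
      ⁅xD n e i r, xD n e' (-1) s⁆ = c • xD n e j (r + s) := by
  by_cases hs : Odd s
  swap
  · exact ⟨0, by omega, 0, by rw [xD_bot_even n _ hs, lie_zero, zero_smul]⟩
  have he : e' = e ∨ e' = -e := by
    rcases Int.units_eq_one_or e with rfl | rfl <;>
    rcases Int.units_eq_one_or e' with rfl | rfl <;> simp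
  rcases (by omega : i = 0 ∨ i = 1 ∨ (2 ≤ i ∧ i ≤ (n : ℤ) + 1)) with rfl | rfl | h
  · rcases he with rfl | rfl
    · have h1 := toD_rel (Rel.bot₁ (n := n) e' r s hs)
      rw [toD_lie, toD_zero] at h1
      exact ⟨0, by omega, 0, by rw [zero_smul]; exact h1⟩
    · have h1 := toD_rel (Rel.bot₂ (n := n) (-e) r s hs)
      rw [toD_lie, toD_neg, toD_zsmul, neg_neg, ← neg_smul] at h1
      exact ⟨1, by omega, _, h1⟩
  · rcases he with rfl | rfl
    · have h1 := toD_rel (Rel.bot₃ (n := n) e' r s hs)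
      rw [toD_lie, toD_zsmul] at h1
      exact ⟨0, by omega, _, h1⟩
    · have h1 := toD_rel (Rel.bot₄ (n := n) (-e) r s hs)
      rw [toD_lie, toD_zero, neg_neg] at h1
      exact ⟨0, by omega, 0, by rw [zero_smul]; exact h1⟩
  · refine ⟨i, by omega, 0, ?_⟩
    have h1 := toD_rel (Rel.bot_comm (n := n) e e' i r s h hs)
    rw [toD_lie, toD_zero] at h1
    rw [zero_smul]
    exact h1

/-- The Lie algebra `D(2n)` is generated by the `X^±_{i,r}` with `0 ≤ i ≤ n`. -/
theorem lieSpan_xD {n : ℕ} (hn : 4 ≤ n) : LieSubalgebra.lieSpan ℂ (D n)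
    {x | ∃ e i r, (0 ≤ i ∧ i ≤ (n : ℤ)) ∧ x = xD n e i r} = ⊤ := by
  set S := LieSubalgebra.lieSpan ℂ (D n) {x | ∃ e i r, (0 ≤ i ∧ i ≤ (n : ℤ)) ∧ x = xD n e i r}
  have hS (e : ℤˣ) (i : ℤ) (r : ℕ) (h : 0 ≤ i ∧ i ≤ (n : ℤ)) : toD n (X n e i r) ∈ S :=
    LieSubalgebra.subset_lieSpan ⟨e, i, r, h, rfl⟩
  rw [eq_top_iff, ← lieSpan_gen, LieSubalgebra.lieSpan_le]
  rintro _ ⟨⟨g, hg⟩, rfl⟩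
  change toD n (FreeLieAlgebra.of ℂ ⟨g, hg⟩) ∈ S
  rw [toD_of]
  cases g with
  | H i r =>
    change toD n (H n i r) ∈ S
    rcases hg with h | ⟨rfl | rfl, h⟩
    · have h1 := toD_rel (Rel.xx_eq i r 0 h)
      rw [add_zero] at h1
      rw [← h1, toD_lie]
      exact S.lie_mem (hS _ _ _ (by omega)) (hS _ _ _ (by omega))
    · have h1 := toD_rel (Rel.xx_zero (n := n) r 0)
      rw [add_zero, if_pos h] at h1
      rw [← h1, toD_lie]
      exact S.lie_mem (hS _ _ _ (by omega)) (hS _ _ _ (by omega))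
    · have h1 := toD_rel (Rel.xx_n (n := n) r 0)
      rw [add_zero, if_pos h] at h1
      rw [← h1, toD_lie]
      exact S.lie_mem (hS _ _ _ (by omega)) (hS _ _ _ (by omega))
  | X e i r =>
    change toD n (X n e i r) ∈ S
    rcases hg with h | ⟨rfl | rfl, h⟩
    · exact hS _ _ _ h
    -- Relation 3 gives `e • X_{-1,r}` as minus a bracket; a second factor `e` isolates the
    -- generator, since `e * e = 1`.
    · have h1 : e • (e • xD n e (-1) r) = e • -⁅xD n e 0 r, xD n (-e) 1 0⁆ := by
        rw [lie_xD_zero_one, add_zero, neg_smul, neg_neg]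
        rfl
      rw [smul_smul, Int.units_mul_self, one_smul] at h1
      change xD n e (-1) r ∈ S
      rw [h1]
      exact zsmul_mem (S := AddSubgroup (D n)) (K := S.toSubmodule.toAddSubgroup)
        (S.neg_mem_iff.2 (S.lie_mem (hS _ _ _ (by omega)) (hS _ _ _ (by omega)))) (e : ℤ)
    · have h1 : e • (e • xD n e (n + 1) r) = e • -⁅xD n e n r, xD n (-e) (n - 1) 0⁆ := by
        rw [lie_xD_last_pred, add_zero, neg_smul, neg_neg]
        rfl
      rw [smul_smul, Int.units_mul_self, one_smul] at h1
      change xD n e (n + 1) r ∈ S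
      rw [h1]
      exact zsmul_mem (S := AddSubgroup (D n)) (K := S.toSubmodule.toAddSubgroup)
        (S.neg_mem_iff.2 (S.lie_mem (hS _ _ _ (by omega)) (hS _ _ _ (by omega)))) (e : ℤ)

/-! ### The triangular decomposition -/

/-- The span of the `H_{i,r}`, `X^±_{n+1,r}` and `X^±_{-1,r}`. -/
def zeroPart (n : ℕ) : Submodule ℂ (D n) := Submodule.span ℂ
  ({x | ∃ i r, ((1 ≤ i ∧ i ≤ (n : ℤ) - 1) ∨ ((i = 0 ∨ i = n) ∧ Even r)) ∧ x = hD n i r} ∪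
    {x | ∃ e r, x = xD n e (n + 1) r ∨ x = xD n e (-1) r})

/-- The subalgebra generated by the `X^±_{i,r}`, `0 ≤ i ≤ n`, of one sign. -/
def nil (n : ℕ) (e : ℤˣ) : LieSubalgebra ℂ (D n) :=
  LieSubalgebra.lieSpan ℂ (D n) {x | ∃ i r, (0 ≤ i ∧ i ≤ (n : ℤ)) ∧ x = xD n e i r}

theorem xD_mem_nil {n : ℕ} (e : ℤˣ) {i : ℤ} (r : ℕ) (h : 0 ≤ i ∧ i ≤ n) : xD n e i r ∈ nil n e :=
  LieSubalgebra.subset_lieSpan ⟨i, r, h, rfl⟩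

theorem zsmul_mem_nil {n : ℕ} {e : ℤˣ} {x : D n} (h : x ∈ nil n e) (c : ℤ) : c • x ∈ nil n e :=
  zsmul_mem (S := AddSubgroup (D n)) (K := (nil n e).toSubmodule.toAddSubgroup) h c

/-- The `H_{j,s}` act on the `X_{i,r}` by scalars, and `X_{n+1,s}`, `X_{-1,s}` send them to
multiples of other `X_{j,r+s}` of the same sign. The middle part thus normalizes both nilpotent
parts. -/
theorem lie_zeroPart_xD {n : ℕ} (hn : 4 ≤ n) {z : D n} (hz : z ∈ zeroPart n) (e : ℤˣ) {i : ℤ}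
    (r : ℕ) (hi : 0 ≤ i ∧ i ≤ n) : ⁅xD n e i r, z⁆ ∈ nil n e := by
  induction hz using Submodule.span_induction with
  | zero => rw [lie_zero]; exact zero_mem _
  | add x y _ _ hx hy => rw [lie_add]; exact add_mem hx hy
  | smul c x _ hx => rw [lie_smul]; exact (nil n e).smul_mem c hx
  | mem x hx =>
    rcases hx with ⟨j, s, hj, rfl⟩ | ⟨e', s, rfl | rfl⟩
    · rw [← lie_skew, lie_hD_xD e j i s r hj hi, ← neg_smul]
      exact zsmul_mem_nil (xD_mem_nil e _ hi) _
    · obtain ⟨j, hj, c, h⟩ := lie_xD_top hn e e' i r s hi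
      rw [h]
      exact zsmul_mem_nil (xD_mem_nil e _ hj) _
    · obtain ⟨j, hj, c, h⟩ := lie_xD_bot hn e e' i r s hi
      rw [h]
      exact zsmul_mem_nil (xD_mem_nil e _ hj) _

theorem lie_nil_zeroPart {n : ℕ} (hn : 4 ≤ n) {e : ℤˣ} {y z : D n} (hy : y ∈ nil n e)
    (hz : z ∈ zeroPart n) : ⁅y, z⁆ ∈ nil n e := by
  induction hy using LieSubalgebra.lieSpan_induction with
  | mem x h =>
    obtain ⟨i, r, hi, rfl⟩ := h
    exact lie_zeroPart_xD hn hz e r hi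
  | zero => rw [zero_lie]; exact zero_mem _
  | add x y _ _ hx hy => rw [add_lie]; exact add_mem hx hy
  | smul c x _ hx => rw [smul_lie]; exact (nil n e).smul_mem c hx
  | lie x y hx' hy' hx hy =>
    rw [lie_lie]
    exact sub_mem ((nil n e).lie_mem hx' hy) ((nil n e).lie_mem hy' hx)

theorem lie_xD_mem_zeroPart {n : ℕ} (hn : 4 ≤ n) (e : ℤˣ) {i j : ℤ} (r s : ℕ)
    (hi : 0 ≤ i ∧ i ≤ n) (hj : 0 ≤ j ∧ j ≤ n) : ⁅xD n e i r, xD n (-e) j s⁆ ∈ zeroPart n := by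
  have hsmul {x : D n} (h : x ∈ zeroPart n) (c : ℤ) : c • x ∈ zeroPart n :=
    zsmul_mem (S := AddSubgroup (D n)) (K := (zeroPart n).toAddSubgroup) h c
  by_cases hij : i = j
  · subst hij
    obtain ⟨j, hj', _, h⟩ := lie_xD_xD_eq hn e i r s hi
    rw [h]
    exact hsmul (Submodule.subset_span (Or.inl ⟨j, _, hj', rfl⟩)) _
  by_cases hexc : Exc n i j
  · rcases hexc with ⟨rfl, rfl⟩ | ⟨rfl, rfl⟩ | ⟨rfl, rfl⟩ | ⟨rfl, rfl⟩
    · rw [lie_xD_zero_one]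
      exact hsmul (Submodule.subset_span (Or.inr ⟨_, _, Or.inr rfl⟩)) _
    · rw [lie_xD_one_zero]
      exact hsmul (Submodule.subset_span (Or.inr ⟨_, _, Or.inr rfl⟩)) _
    · rw [lie_xD_pred_last]
      exact hsmul (Submodule.subset_span (Or.inr ⟨_, _, Or.inl rfl⟩)) _
    · rw [lie_xD_last_pred]
      exact hsmul (Submodule.subset_span (Or.inr ⟨_, _, Or.inl rfl⟩)) _
  · rw [lie_xD_xD_ne e i j r s hi hj hij hexc]
    exact zero_mem _

/-- The bracket of a generator with the opposite subalgebra. -/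
theorem lie_xD_nil_neg {n : ℕ} (hn : 4 ≤ n) (e : ℤˣ) {i : ℤ} (r : ℕ) (hi : 0 ≤ i ∧ i ≤ n)
    {y : D n} (hy : y ∈ nil n (-e)) :
    ⁅xD n e i r, y⁆ ∈ (nil n (-e)).toSubmodule ⊔ zeroPart n := by
  induction hy using LieSubalgebra.lieSpan_induction with
  | mem x h =>
    obtain ⟨j, s, hj, rfl⟩ := h
    exact Submodule.mem_sup_right (lie_xD_mem_zeroPart hn e r s hi hj)
  | zero => rw [lie_zero]; exact zero_mem _
  | add x y _ _ hx hy => rw [lie_add]; exact add_mem hx hy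
  | smul c x _ hx => rw [lie_smul]; exact Submodule.smul_mem _ _ hx
  | lie x y hx' hy' hx hy =>
    -- `nil n (-e)` absorbs brackets with itself and with `zeroPart n`, so the two terms of the
    -- Leibniz rule land in `nil n (-e)` itself and the induction closes.
    have key {u v : D n} (hu : u ∈ nil n (-e)) (hv : v ∈ (nil n (-e)).toSubmodule ⊔ zeroPart n) :
        ⁅u, v⁆ ∈ nil n (-e) := by
      obtain ⟨p, hp, q, hq, rfl⟩ := Submodule.mem_sup.1 hv
      rw [lie_add]
      exact add_mem ((nil n (-e)).lie_mem hu hp) (lie_nil_zeroPart hn hu hq)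
    rw [leibniz_lie]
    refine Submodule.mem_sup_left (add_mem ?_ (key hx' hy))
    rw [← lie_skew]
    exact neg_mem (key hy' hx)

/-- The sum is stable under `ad` of each `X^±_{i,r}`, hence under `ad` of everything these generate,
which is all of `D(2n)`. So it is a subalgebra, and it contains generators of `D(2n)`. -/
theorem triangular {n : ℕ} (hn : 4 ≤ n) (e : ℤˣ) :
    ((nil n e).toSubmodule ⊔ ((nil n (-e)).toSubmodule ⊔ zeroPart n)) = ⊤ := by
  have key (e : ℤˣ) (i : ℤ) (r : ℕ) (hi : 0 ≤ i ∧ i ≤ n) (z : D n)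
      (hz : z ∈ (nil n e).toSubmodule ⊔ ((nil n (-e)).toSubmodule ⊔ zeroPart n)) :
      ⁅xD n e i r, z⁆ ∈ (nil n e).toSubmodule ⊔ ((nil n (-e)).toSubmodule ⊔ zeroPart n) := by
    obtain ⟨p, hp, q, hq, rfl⟩ := Submodule.mem_sup.1 hz
    obtain ⟨q, hq', z, hz', rfl⟩ := Submodule.mem_sup.1 hq
    rw [lie_add, lie_add]
    exact add_mem (Submodule.mem_sup_left ((nil n e).lie_mem (xD_mem_nil e r hi) hp))
      (add_mem (Submodule.mem_sup_right (lie_xD_nil_neg hn e r hi hq'))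
        (Submodule.mem_sup_left (lie_zeroPart_xD hn hz' e r hi)))
  set T := (nil n e).toSubmodule ⊔ ((nil n (-e)).toSubmodule ⊔ zeroPart n) with hT
  -- The sum does not change when the sign is reversed, so stability under the generators of one
  -- sign covers both.
  have hT' : (nil n (-e)).toSubmodule ⊔ ((nil n (- -e)).toSubmodule ⊔ zeroPart n) = T := by
    rw [neg_neg, hT, sup_left_comm]
  have gens (e' : ℤˣ) (i : ℤ) (r : ℕ) (hi : 0 ≤ i ∧ i ≤ n) :
      xD n e' i r ∈ T ∧ ∀ z ∈ T, ⁅xD n e' i r, z⁆ ∈ T := by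
    have he : e' = e ∨ e' = -e := by
      rcases Int.units_eq_one_or e with rfl | rfl <;>
      rcases Int.units_eq_one_or e' with rfl | rfl <;> simp
    rcases he with rfl | rfl
    · exact ⟨Submodule.mem_sup_left (xD_mem_nil _ r hi), key e' i r hi⟩
    · have h := key (-e) i r hi
      rw [hT'] at h
      exact ⟨Submodule.mem_sup_right (Submodule.mem_sup_left (xD_mem_nil _ r hi)), h⟩
  have stable (x : D n) : ∀ z ∈ T, ⁅x, z⁆ ∈ T := by
    have hx : x ∈ LieSubalgebra.lieSpan ℂ (D n)
        {x | ∃ e i r, (0 ≤ i ∧ i ≤ (n : ℤ)) ∧ x = xD n e i r} := by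
      rw [lieSpan_xD hn]
      trivial
    induction hx using LieSubalgebra.lieSpan_induction with
    | mem x h =>
      obtain ⟨e', i, r, hi, rfl⟩ := h
      exact (gens e' i r hi).2
    | zero => intro z _; rw [zero_lie]; exact zero_mem _
    | add x y _ _ hx hy => intro z hz; rw [add_lie]; exact add_mem (hx z hz) (hy z hz)
    | smul c x _ hx => intro z hz; rw [smul_lie]; exact Submodule.smul_mem _ _ (hx z hz)
    | lie x y _ _ hx hy =>
      intro z hz
      rw [lie_lie]
      exact sub_mem (hx _ (hy _ hz)) (hy _ (hx _ hz))
  let S : LieSubalgebra ℂ (D n) := { T with lie_mem' := fun {x y} _ hy => stable x y hy }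
  have h : (⊤ : LieSubalgebra ℂ (D n)) ≤ S := by
    rw [← lieSpan_xD hn, LieSubalgebra.lieSpan_le]
    rintro _ ⟨e', i, r, hi, rfl⟩
    exact (gens e' i r hi).1
  exact eq_top_iff.2 fun x _ => h (LieSubalgebra.mem_top x)

/-! ### Coordinates on the root lattice -/

/-- The coefficient of `α_j`, which is `0` if `j` is not in `{0, …, n}`. -/
def co (n : ℕ) (j : ℤ) : Q n →+ ℤ :=
  if h : 0 ≤ j ∧ j ≤ n then Pi.evalAddMonoidHom (fun _ : Fin (n + 1) => ℤ) ⟨j.toNat, by omega⟩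
  else 0

theorem co_simple {n : ℕ} {i : ℤ} (hi : 0 ≤ i ∧ i ≤ n) (j : ℤ) :
    co n j (simple n i) = if j = i then 1 else 0 := by
  unfold co
  split_ifs with h1 h2 h2
  · simp only [Pi.evalAddMonoidHom_apply, simple]
    exact if_pos (show ((j.toNat : ℕ) : ℤ) = i by omega)
  · simp only [Pi.evalAddMonoidHom_apply, simple]
    exact if_neg (show ¬ ((j.toNat : ℕ) : ℤ) = i by omega)
  · omega
  · rfl

theorem ext_co {n : ℕ} {α β : Q n} (h : ∀ j, 0 ≤ j ∧ j ≤ (n : ℤ) → co n j α = co n j β) :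
    α = β := by
  ext k
  have h1 := h k (by omega)
  unfold co at h1
  rw [dif_pos (by omega)] at h1
  simpa using h1

theorem co_eq_zero {n : ℕ} {j : ℤ} (h : ¬ (0 ≤ j ∧ j ≤ n)) (α : Q n) : co n j α = 0 := by
  rw [co, dif_neg h, AddMonoidHom.zero_apply]

/-! ### The support of the grading -/

theorem proj_of_coact {n : ℕ} (hn : 4 ≤ n) {x : D n} {d : Q n × ℕ}
    (h : coact hn x = gexp d ⊗ₜ[ℂ] x) (d' : Q n × ℕ) :
    proj hn d' x = if d = d' then x else 0 := by
  have e : proj hn d' x = TensorProduct.lid ℂ (D n) (LinearMap.rTensor (D n)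
    (gcoeff d') (coact hn x)) := rfl
  rw [e, h, LinearMap.rTensor_tmul, gcoeff_gexp, TensorProduct.lid_tmul]
  split_ifs <;> simp

theorem coact_xD {n : ℕ} (hn : 4 ≤ n) (e : ℤˣ) (i : ℤ) (r : ℕ) :
    coact hn (xD n e i r) = gexp ((e : ℤ) • rt n i, r) ⊗ₜ[ℂ] xD n e i r :=
  homog_X n e i r

theorem coact_hD {n : ℕ} (hn : 4 ≤ n) (i : ℤ) (r : ℕ) :
    coact hn (hD n i r) = gexp (0, r) ⊗ₜ[ℂ] hD n i r :=
  homog_H n i r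

/-- A homogeneous element of the subalgebra `nil n e`, with what its degree says about it. -/
def NilHomog {n : ℕ} (hn : 4 ≤ n) (e : ℤˣ) (x : D n) (d : Q n × ℕ) : Prop :=
  coact hn x = gexp d ⊗ₜ[ℂ] x ∧ (∀ j, 0 ≤ co n j ((e : ℤ) • d.1)) ∧ d.1 ≠ 0 ∧
    ∀ i m : ℤ, 0 ≤ i ∧ i ≤ n → (e : ℤ) • d.1 = m • simple n i →
      x = 0 ∨ (m = 1 ∧ ∃ c : ℂ, x = c • xD n e i d.2)

theorem nilHomog_xD {n : ℕ} (hn : 4 ≤ n) (e : ℤˣ) {i : ℤ} (hi : 0 ≤ i ∧ i ≤ n) (r : ℕ) :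
    NilHomog hn e (xD n e i r) ((e : ℤ) • rt n i, r) := by
  have h1 : (e : ℤ) • (e : ℤ) • simple n i = simple n i := by
    rw [smul_smul, ← Units.val_mul, Int.units_mul_self, Units.val_one, one_smul]
  have hne : ((e : ℤ) • simple n i) ≠ 0 := by
    intro h
    rw [h, smul_zero] at h1
    have h2 := congrArg (co n i) h1
    rw [co_simple hi, if_pos rfl, map_zero] at h2
    omega
  refine ⟨coact_xD hn e i r, ?_⟩
  rw [rt_of_mem hi]
  refine ⟨fun j => ?_, hne, fun j m hj h => ?_⟩
  · rw [h1, co_simple hi]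
    split_ifs <;> omega
  · rw [h1] at h
    have h2 := congrArg (co n i) h
    rw [co_simple hi, if_pos rfl, map_zsmul, co_simple hj] at h2
    split_ifs at h2 with h3
    · subst h3
      exact Or.inr ⟨by simpa using h2.symm, 1, by rw [one_smul]⟩
    · simp at h2

/-- If a sum of two vectors with non-negative coefficients is a multiple of `α_i`, both summands
are. Then both factors are multiples of elements `X_{i,r}` or zero, and these commute. So brackets
contribute nothing in degrees proportional to a simple root. -/
theorem NilHomog.lie {n : ℕ} {hn : 4 ≤ n} {e : ℤˣ} {x y : D n} {d d' : Q n × ℕ}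
    (hx : NilHomog hn e x d) (hy : NilHomog hn e y d') : NilHomog hn e ⁅x, y⁆ (d + d') := by
  obtain ⟨x1, x2, x3, x4⟩ := hx
  obtain ⟨y1, y2, y3, y4⟩ := hy
  refine ⟨?_, fun j => ?_, fun h => x3 ?_, fun i m hi h => Or.inl ?_⟩
  · rw [LieHom.map_lie, x1, y1, LieAlgebra.ExtendScalars.bracket_tmul, gexp_mul]
  · rw [Prod.fst_add, smul_add, map_add]
    exact add_nonneg (x2 j) (y2 j)
  · have h1 : (e : ℤ) • d.1 = 0 := ext_co fun j _ => by
      have h2 := congrArg (co n j) (congrArg (fun z => (e : ℤ) • z) h)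
      simp only [Prod.fst_add, smul_add, map_add, smul_zero, map_zero] at h2
      have := x2 j
      have := y2 j
      rw [map_zero]
      omega
    have h2 := congrArg (fun z => (e : ℤ) • z) h1
    simpa only [smul_smul, ← Units.val_mul, Int.units_mul_self, Units.val_one, one_smul,
      smul_zero] using h2
  · rw [Prod.fst_add, smul_add] at h
    have key (j : ℤ) (hj : j ≠ i) : co n j ((e : ℤ) • d.1) = 0 ∧ co n j ((e : ℤ) • d'.1) = 0 := by
      have h2 := congrArg (co n j) h
      rw [map_add, map_zsmul (co n j) m, co_simple hi, if_neg hj, smul_zero] at h2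
      have := x2 j
      have := y2 j
      omega
    have h1 : (e : ℤ) • d.1 = (co n i ((e : ℤ) • d.1)) • simple n i := ext_co fun j _ => by
      rw [map_zsmul (co n j) (co n i _), co_simple hi]
      split_ifs with hj
      · rw [hj, smul_eq_mul, mul_one]
      · rw [(key j hj).1, smul_zero]
    have h2 : (e : ℤ) • d'.1 = (co n i ((e : ℤ) • d'.1)) • simple n i := ext_co fun j _ => by
      rw [map_zsmul (co n j) (co n i _), co_simple hi]
      split_ifs with hj
      · rw [hj, smul_eq_mul, mul_one]
      · rw [(key j hj).2, smul_zero]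
    rcases x4 _ _ hi h1 with rfl | ⟨_, c, hc⟩
    · rw [zero_lie]
    rcases y4 _ _ hi h2 with rfl | ⟨_, c', hc'⟩
    · rw [lie_zero]
    rw [hc, hc', smul_lie, lie_smul, lie_xD_same, smul_zero, smul_zero]

theorem nil_le_span {n : ℕ} (hn : 4 ≤ n) (e : ℤˣ) :
    (nil n e).toSubmodule ≤ Submodule.span ℂ {x | ∃ d, NilHomog hn e x d} := by
  let M : LieSubalgebra ℂ (D n) :=
    { Submodule.span ℂ {x | ∃ d, NilHomog hn e x d} with
      lie_mem' := by
        intro x y hx hy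
        change x ∈ Submodule.span ℂ {x | ∃ d, NilHomog hn e x d} at hx
        change y ∈ Submodule.span ℂ {x | ∃ d, NilHomog hn e x d} at hy
        change ⁅x, y⁆ ∈ Submodule.span ℂ {x | ∃ d, NilHomog hn e x d}
        induction hx using Submodule.span_induction with
        | zero => rw [zero_lie]; exact zero_mem _
        | add a b _ _ ha hb => rw [add_lie]; exact add_mem ha hb
        | smul c a _ ha => rw [smul_lie]; exact Submodule.smul_mem _ _ ha
        | mem x hx =>
          obtain ⟨d, hx⟩ := hx
          induction hy using Submodule.span_induction with
          | zero => rw [lie_zero]; exact zero_mem _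
          | add a b _ _ ha hb => rw [lie_add]; exact add_mem ha hb
          | smul c a _ ha => rw [lie_smul]; exact Submodule.smul_mem _ _ ha
          | mem y hy =>
            obtain ⟨d', hy⟩ := hy
            exact Submodule.subset_span ⟨_, hx.lie hy⟩ }
  have h : nil n e ≤ M := by
    rw [nil, LieSubalgebra.lieSpan_le]
    rintro _ ⟨i, r, hi, rfl⟩
    exact Submodule.subset_span ⟨_, nilHomog_xD hn e hi r⟩
  exact h

/-- To bound a graded piece it is enough to look at the homogeneous elements of the three parts of
the triangular decomposition. -/
theorem piece_le {n : ℕ} (hn : 4 ≤ n) {α : Q n} {k : ℕ} {W : Submodule ℂ (D n)}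
    (h1 : ∀ e x, NilHomog hn e x (α, k) → x ∈ W) (h2 : α = 0 → ∀ i, hD n i k ∈ W)
    (h3 : ∀ e : ℤˣ, α = (e : ℤ) • rt n (n + 1) → xD n e (n + 1) k ∈ W)
    (h4 : ∀ e : ℤˣ, α = (e : ℤ) • rt n (-1) → xD n e (-1) k ∈ W) : piece n α k ≤ W := by
  intro x hx
  have hp := proj_piece hn hx (α, k)
  rw [if_pos rfl] at hp
  rw [← hp]
  have hT : x ∈ (nil n 1).toSubmodule ⊔ ((nil n (-1)).toSubmodule ⊔ zeroPart n) := by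
    rw [triangular hn 1]
    trivial
  have hnil (e : ℤˣ) : (nil n e).toSubmodule ≤ W.comap (proj hn (α, k)) := by
    refine (nil_le_span hn e).trans (Submodule.span_le.2 ?_)
    rintro y ⟨d, hy⟩
    change proj hn (α, k) y ∈ W
    rw [proj_of_coact hn hy.1]
    split_ifs with h
    · exact h1 e y (h ▸ hy)
    · exact zero_mem _
  have hzero : zeroPart n ≤ W.comap (proj hn (α, k)) := by
    refine Submodule.span_le.2 ?_
    rintro y (⟨i, r, -, rfl⟩ | ⟨e, r, rfl | rfl⟩)
    · change proj hn (α, k) _ ∈ W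
      rw [proj_of_coact hn (coact_hD hn i r)]
      split_ifs with h
      · obtain ⟨rfl, rfl⟩ := Prod.mk.inj h
        exact h2 rfl i
      · exact zero_mem _
    · change proj hn (α, k) _ ∈ W
      rw [proj_of_coact hn (coact_xD hn e _ r)]
      split_ifs with h
      · have h' := Prod.mk.inj h
        rw [h'.2]
        exact h3 e h'.1.symm
      · exact zero_mem _
    · change proj hn (α, k) _ ∈ W
      rw [proj_of_coact hn (coact_xD hn e _ r)]
      split_ifs with h
      · have h' := Prod.mk.inj h
        rw [h'.2]
        exact h4 e h'.1.symm
      · exact zero_mem _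
  exact (sup_le (hnil 1) (sup_le (hnil (-1)) hzero)) hT

theorem co_rt_top {n : ℕ} (hn : 4 ≤ n) (j : ℤ) :
    co n j (rt n (n + 1)) = (if j = n then 1 else 0) - (if j = n - 1 then 1 else 0) := by
  rw [rt_top, map_sub, co_simple (by omega), co_simple (by omega)]

theorem co_rt_bot {n : ℕ} (hn : 4 ≤ n) (j : ℤ) :
    co n j (rt n (-1)) = (if j = 0 then 1 else 0) - (if j = 1 then 1 else 0) := by
  rw [rt_bot, map_sub, co_simple (by omega), co_simple (by omega)]

/-- If `α ≠ 0` has coefficients of both signs, neither nilpotent part reaches it, and the only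
candidates left are the degrees of `X^±_{n+1}` and `X^±_{-1}`. -/
theorem piece_support {n : ℕ} (hn : 4 ≤ n) {α : Q n} {k : ℕ} (h : piece n α k ≠ ⊥) (h0 : α ≠ 0) :
    (∀ j, 0 ≤ co n j α) ∨ (∀ j, co n j α ≤ 0) ∨
      ∃ e : ℤˣ, α = (e : ℤ) • rt n (n + 1) ∨ α = (e : ℤ) • rt n (-1) := by
  by_contra hc
  push Not at hc
  obtain ⟨⟨j, hj⟩, ⟨j', hj'⟩, hc⟩ := hc
  refine h (le_bot_iff.1 (piece_le hn ?_ ?_ ?_ ?_))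
  · rintro e x ⟨-, h2, -⟩
    rcases Int.units_eq_one_or e with rfl | rfl
    · have := h2 j
      simp only [Units.val_one, one_smul] at this
      omega
    · have := h2 j'
      simp only [Units.val_neg, Units.val_one, neg_smul, one_smul, map_neg] at this
      omega
  · exact fun h => absurd h h0
  · exact fun e h => absurd h (hc e).1
  · exact fun e h => absurd h (hc e).2

/-- For `m ≠ ±1` the spanning set is empty, so this also says that proper multiples of a simple root
do not occur. -/
theorem piece_zsmul_simple {n : ℕ} (hn : 4 ≤ n) {i m : ℤ} (hi : 0 ≤ i ∧ i ≤ n) (hm : m ≠ 0) (k : ℕ) :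
    piece n (m • simple n i) k ≤
      Submodule.span ℂ {x | ∃ e : ℤˣ, m = e ∧ x = xD n e i k} := by
  refine piece_le hn ?_ ?_ ?_ ?_
  · rintro e x ⟨-, -, -, h⟩
    rcases h i ((e : ℤ) * m) hi (by rw [smul_smul]) with rfl | ⟨h1, c, rfl⟩
    · exact zero_mem _
    · refine Submodule.smul_mem _ _ (Submodule.subset_span ⟨e, ?_, rfl⟩)
      rcases Int.units_eq_one_or e with rfl | rfl <;> simp at h1 ⊢ <;> omega
  · intro h
    have h1 := congrArg (co n i) h
    rw [map_zsmul, co_simple hi, if_pos rfl, map_zero, smul_eq_mul, mul_one] at h1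
    exact absurd h1 hm
  · intro e h
    have h1 := congrArg (co n n) h
    have h2 := congrArg (co n (n - 1)) h
    rw [map_zsmul, map_zsmul, co_simple hi, co_rt_top hn] at h1 h2
    rcases Int.units_eq_one_or e with rfl | rfl <;> simp at h1 h2 <;> split_ifs at h1 h2 <;> omega
  · intro e h
    have h1 := congrArg (co n 0) h
    have h2 := congrArg (co n 1) h
    rw [map_zsmul, map_zsmul, co_simple hi, co_rt_bot hn] at h1 h2
    rcases Int.units_eq_one_or e with rfl | rfl <;> simp at h1 h2 <;> split_ifs at h1 h2 <;> omega

theorem co_last_rt_top {n : ℕ} (hn : 4 ≤ n) : co n n (rt n (n + 1)) = 1 := by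
  rw [co_rt_top hn, if_pos rfl, if_neg (by omega), sub_zero]

theorem co_pred_rt_top {n : ℕ} (hn : 4 ≤ n) : co n (n - 1) (rt n (n + 1)) = -1 := by
  rw [co_rt_top hn, if_pos rfl, if_neg (by omega), zero_sub]

theorem co_zero_rt_top {n : ℕ} (hn : 4 ≤ n) : co n 0 (rt n (n + 1)) = 0 := by
  rw [co_rt_top hn, if_neg (by omega), if_neg (by omega), sub_zero]

theorem co_zero_rt_bot {n : ℕ} (hn : 4 ≤ n) : co n 0 (rt n (-1)) = 1 := by
  rw [co_rt_bot hn, if_pos rfl, if_neg (by omega), sub_zero]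

theorem co_one_rt_bot {n : ℕ} (hn : 4 ≤ n) : co n 1 (rt n (-1)) = -1 := by
  rw [co_rt_bot hn, if_pos rfl, if_neg (by omega), zero_sub]

theorem co_last_rt_bot {n : ℕ} (hn : 4 ≤ n) : co n n (rt n (-1)) = 0 := by
  rw [co_rt_bot hn, if_neg (by omega), if_neg (by omega), sub_zero]

/-- The coefficients `1` and `-1` at `α_n` and `α_{n-1}` exclude both nilpotent parts, so only the
generator itself remains. -/
theorem piece_rt_top {n : ℕ} (hn : 4 ≤ n) (e : ℤˣ) (k : ℕ) :
    piece n ((e : ℤ) • rt n (n + 1)) k ≤ Submodule.span ℂ {xD n e (n + 1) k} := by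
  refine piece_le hn ?_ ?_ ?_ ?_
  · rintro e' x ⟨-, h, -⟩
    have h1 := h n
    have h2 := h (n - 1)
    simp only [map_zsmul, co_last_rt_top hn, co_pred_rt_top hn, smul_eq_mul] at h1 h2
    rcases Int.units_eq_one_or e with rfl | rfl <;>
    rcases Int.units_eq_one_or e' with rfl | rfl <;> simp at h1 h2
  · intro h
    have h1 := congrArg (co n n) h
    rw [map_zsmul, co_last_rt_top hn] at h1
    simp at h1
  · intro e' h
    have h1 := congrArg (co n n) h
    rw [map_zsmul, map_zsmul, co_last_rt_top hn, smul_eq_mul, smul_eq_mul, mul_one, mul_one] at h1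
    rw [Units.ext h1]
    exact Submodule.subset_span rfl
  · intro e' h
    have h1 := congrArg (co n n) h
    rw [map_zsmul, map_zsmul, co_last_rt_top hn, co_last_rt_bot hn] at h1
    simp at h1

theorem piece_rt_bot {n : ℕ} (hn : 4 ≤ n) (e : ℤˣ) (k : ℕ) :
    piece n ((e : ℤ) • rt n (-1)) k ≤ Submodule.span ℂ {xD n e (-1) k} := by
  refine piece_le hn ?_ ?_ ?_ ?_
  · rintro e' x ⟨-, h, -⟩
    have h1 := h 0
    have h2 := h 1
    simp only [map_zsmul, co_zero_rt_bot hn, co_one_rt_bot hn, smul_eq_mul] at h1 h2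
    rcases Int.units_eq_one_or e with rfl | rfl <;>
    rcases Int.units_eq_one_or e' with rfl | rfl <;> simp at h1 h2
  · intro h
    have h1 := congrArg (co n 0) h
    rw [map_zsmul, co_zero_rt_bot hn] at h1
    simp at h1
  · intro e' h
    have h1 := congrArg (co n 0) h
    rw [map_zsmul, map_zsmul, co_zero_rt_top hn, co_zero_rt_bot hn] at h1
    simp at h1
  · intro e' h
    have h1 := congrArg (co n 0) h
    rw [map_zsmul, map_zsmul, co_zero_rt_bot hn, smul_eq_mul, smul_eq_mul, mul_one, mul_one] at h1
    rw [Units.ext h1]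
    exact Submodule.subset_span rfl

/-! ### Weight spaces of `sl(2)` -/

section SlTwo

variable {V : Type*} [AddCommGroup V] [Module ℂ V]

/-- Moving `F` past the powers of `E` costs the weights `μ + 2, …, μ + 2j`, whose sum is `j(μ + j +
1)`. -/
theorem sl2_step {E F H : Module.End ℂ V} (hEF : E * F - F * E = H) (hHE : H * E - E * H = 2 • E)
    {v : V} {μ : ℂ} (hv : H v = μ • v) (j : ℕ) :
    H ((E ^ j) v) = (μ + 2 * j) • (E ^ j) v ∧
      F (E ((E ^ j) v)) = (E ^ j) (F (E v)) - (j * (μ + j + 1)) • (E ^ j) v := by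
  have hEF' (x : V) : F (E x) = E (F x) - H x := by
    rw [← hEF]
    simp
  have hHE' (x : V) : H (E x) = E (H x) + (2 : ℂ) • E x := by
    have h := congrArg (fun T : Module.End ℂ V => T x) hHE
    simp only [LinearMap.sub_apply, Module.End.mul_apply, LinearMap.smul_apply] at h
    rw [sub_eq_iff_eq_add] at h
    rw [h]
    module
  induction j with
  | zero => simp [hv]
  | succ j ih =>
    obtain ⟨h1, h2⟩ := ih
    have h3 : H ((E ^ (j + 1)) v) = (μ + 2 * (j + 1 : ℕ)) • (E ^ (j + 1)) v := by
      rw [pow_succ', Module.End.mul_apply, hHE', h1, map_smul]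
      push_cast
      module
    refine ⟨h3, ?_⟩
    rw [hEF', h3]
    simp only [pow_succ', Module.End.mul_apply]
    rw [h2, map_sub, map_smul]
    push_cast
    module

/-- On a weight space `F^k E^k` is a polynomial in `FE`, because `FE` preserves the weight. The
operator `T`, which is `FE` up to a scalar there, allows `E^k F^k` to be written later as a
polynomial in the same operator as `F^m E^m`. -/
theorem sl2_pow_mul_pow {E F H T : Module.End ℂ V} (hEF : E * F - F * E = H)
    (hHE : H * E - E * H = 2 • E) (hHF : H * F - F * H = -(2 • F)) {μ c : ℂ}
    (hT : ∀ v, H v = μ • v → T v = F (E v) + c • v) (k : ℕ) :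
    ∀ v : V, H v = μ • v → (F ^ k) ((E ^ k) v) =
      Polynomial.aeval T (∏ j ∈ Finset.range k,
        (Polynomial.X - Polynomial.C ((j : ℂ) * (μ + j + 1) + c))) v := by
  have comm : Commute H (F * E) := by
    have e1 : H * F = F * H - 2 • F := by rw [sub_eq_iff_eq_add] at hHF; rw [hHF]; abel
    have e2 : H * E = E * H + 2 • E := by rw [sub_eq_iff_eq_add] at hHE; rw [hHE]; abel
    change H * (F * E) = F * E * H
    rw [← mul_assoc, e1, sub_mul, mul_assoc, e2]
    simp only [mul_add, mul_smul_comm, smul_mul_assoc, mul_assoc]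
    abel
  induction k with
  | zero => intro v _; simp
  | succ k ih =>
    intro v hv
    have hw : H (F (E v) - ((k : ℂ) * (μ + k + 1)) • v) =
        μ • (F (E v) - ((k : ℂ) * (μ + k + 1)) • v) := by
      have h := congrArg (fun T : Module.End ℂ V => T v) comm.eq
      simp only [Module.End.mul_apply] at h
      rw [map_sub, map_smul, hv, h, hv, map_smul, map_smul]
      module
    have h1 : (F ^ (k + 1)) ((E ^ (k + 1)) v) =
        (F ^ k) ((E ^ k) (F (E v) - ((k : ℂ) * (μ + k + 1)) • v)) := by
      rw [pow_succ F, pow_succ' E, Module.End.mul_apply, Module.End.mul_apply,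
        (sl2_step hEF hHE hv k).2, map_sub, map_smul, map_sub, map_sub, map_smul, map_smul]
    rw [h1, ih _ hw, Finset.prod_range_succ, map_mul, Module.End.mul_apply]
    congr 1
    simp only [map_sub, Polynomial.aeval_X, Polynomial.aeval_C, LinearMap.sub_apply, hT v hv,
      Module.algebraMap_end_apply]
    module

/-- A vector of weight `-m` that is killed by `E^m` and by a power of `F` is zero. -/
theorem sl2_eq_zero {E F H : Module.End ℂ V} (hEF : E * F - F * E = H)
    (hHE : H * E - E * H = 2 • E) (hHF : H * F - F * H = -(2 • F)) {m K : ℕ} {v : V}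
    (hv : H v = (-(m : ℂ)) • v) (hE : (E ^ m) v = 0) (hF : (F ^ K) v = 0) : v = 0 := by
  rcases Nat.eq_zero_or_pos m with rfl | hm
  · simpa using hE
  have h1 := sl2_pow_mul_pow (T := F * E) (c := 0) hEF hHE hHF (fun v _ => by simp) m v hv
  rw [hE, map_zero] at h1
  have hFE : F * E - E * F = -H := by rw [← hEF]; abel
  have hHF' : -H * F - F * -H = 2 • F := by
    rw [neg_mul, mul_neg, sub_neg_eq_add, neg_add_eq_sub, ← neg_sub, hHF, neg_neg]
  have hHE' : -H * E - E * -H = -(2 • E) := by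
    rw [neg_mul, mul_neg, sub_neg_eq_add, neg_add_eq_sub, ← neg_sub, hHE]
  have hv' : (-H) v = (m : ℂ) • v := by rw [LinearMap.neg_apply, hv, neg_smul, neg_neg]
  -- The formula for the triple `(F, E, -H)`, in which `v` has weight `m`: on this weight space `FE
  -- = EF + m`, so the shift is `c = m`.
  have h2 := sl2_pow_mul_pow (T := F * E) (c := m) hFE hHF' hHE' (fun u hu => by
    rw [← hu, ← hFE]
    simp) K v hv'
  rw [hF, map_zero] at h2
  -- Both polynomials in `FE` kill `v`. The roots `i(i + 1 - m)`, `0 ≤ i < m`, of the first are at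
  -- most `0`; the roots `j(m + j + 1) + m` of the second are at least `m > 0`. Hence they are
  -- coprime, and a Bézout identity gives `v = 0`.
  have hcop : IsCoprime
      (∏ j ∈ Finset.range m, (Polynomial.X - Polynomial.C ((j : ℂ) * (-(m : ℂ) + j + 1) + 0)))
      (∏ j ∈ Finset.range K, (Polynomial.X - Polynomial.C ((j : ℂ) * ((m : ℂ) + j + 1) + m))) := by
    refine IsCoprime.prod_left fun i hi => IsCoprime.prod_right fun j _ => ?_
    refine Polynomial.isCoprime_X_sub_C_of_isUnit_sub (IsUnit.mk0 _ (sub_ne_zero.2 fun h => ?_))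
    have h3 : (i : ℤ) * (-(m : ℤ) + i + 1) + 0 = (j : ℤ) * ((m : ℤ) + j + 1) + m := by
      exact_mod_cast h
    have h4 : (i : ℤ) * (-(m : ℤ) + i + 1) ≤ 0 :=
      mul_nonpos_of_nonneg_of_nonpos (by omega) (by have := Finset.mem_range.1 hi; omega)
    have h5 : (0 : ℤ) ≤ (j : ℤ) * ((m : ℤ) + j + 1) := by positivity
    omega
  obtain ⟨p, q, hpq⟩ := hcop
  have h6 := congrArg (fun P => Polynomial.aeval (F * E) P v) hpq
  beta_reduce at h6
  rw [map_add, map_mul, map_mul, LinearMap.add_apply, Module.End.mul_apply, Module.End.mul_apply,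
    ← h1, ← h2, map_zero, map_zero, add_zero, map_one, Module.End.one_apply] at h6
  exact h6.symm

end SlTwo

/-! ### Local nilpotency -/

theorem mem_engel_of_lie {L : Type*} [LieRing L] [LieAlgebra ℂ L] {x y : L}
    (h : ⁅x, y⁆ ∈ LieSubalgebra.engel ℂ x) : y ∈ LieSubalgebra.engel ℂ x := by
  rw [LieSubalgebra.mem_engel_iff] at h ⊢
  obtain ⟨k, hk⟩ := h
  exact ⟨k + 1, by rw [pow_succ, Module.End.mul_apply, LieAlgebra.ad_apply, hk]⟩

theorem mem_engel_of_eq_zero {L : Type*} [LieRing L] [LieAlgebra ℂ L] {x y : L}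
    (h : ⁅x, y⁆ = 0) : y ∈ LieSubalgebra.engel ℂ x :=
  mem_engel_of_lie (by rw [h]; exact zero_mem _)

theorem zsmul_mem_lieSubalgebra {L : Type*} [LieRing L] [LieAlgebra ℂ L] (S : LieSubalgebra ℂ L)
    {x : L} (h : x ∈ S) (c : ℤ) : c • x ∈ S :=
  zsmul_mem (S := AddSubgroup L) (K := S.toSubmodule.toAddSubgroup) h c

/-- At most two brackets with `X_{i,0}` are needed: one for nodes that commute, two by the Serre
relations on an edge, and for an exceptional pair one or two according to the parity of `s`. -/
theorem xD_mem_engel {n : ℕ} (e : ℤˣ) {i j : ℤ} (s : ℕ) (hi : 0 ≤ i ∧ i ≤ n)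
    (hj : 0 ≤ j ∧ j ≤ n) : xD n e j s ∈ LieSubalgebra.engel ℂ (xD n e i 0) := by
  by_cases hij : i = j
  · subst hij
    exact mem_engel_of_eq_zero (lie_xD_same e i 0 s)
  by_cases hE : Edge n i j ∨ Edge n j i
  · have ha : a n 0 i j = -1 := by
      have h0 : ¬ Odd 0 := by decide
      rw [a, if_neg hij, if_neg (by simp only [h0, false_and, not_false_eq_true]), if_pos hE]
    have h := toD_rel (Rel.serre e i j 0 0 s hi hj ha)
    rw [toD_lie, toD_lie, toD_zero] at h
    exact mem_engel_of_lie (mem_engel_of_eq_zero h)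
  · have ha : a n 0 i j = 0 := a_eq_zero hij (fun h => hE (Or.inl h)) fun h => hE (Or.inr h)
    by_cases hexc : Exc n i j
    · rcases Nat.even_or_odd s with hs | hs
      · exact mem_engel_of_eq_zero (lie_xD_eq_zero e i j 0 s hi hj hij ha
          (Or.inr (by rwa [zero_add])))
      · have h := toD_rel (Rel.serre_exc e i j s hexc hs)
        rw [toD_lie, toD_lie, toD_zero] at h
        exact mem_engel_of_lie (mem_engel_of_eq_zero h)
    · exact mem_engel_of_eq_zero (lie_xD_eq_zero e i j 0 s hi hj hij ha (Or.inl hexc))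

theorem xD_special_mem_engel {n : ℕ} (hn : 4 ≤ n) (e e' : ℤˣ) {i j : ℤ} (s : ℕ)
    (hi : 0 ≤ i ∧ i ≤ n) (hj : j = n + 1 ∨ j = -1) :
    xD n e' j s ∈ LieSubalgebra.engel ℂ (xD n e i 0) := by
  refine mem_engel_of_lie ?_
  rcases hj with rfl | rfl
  · obtain ⟨j, hj, c, h⟩ := lie_xD_top hn e e' i 0 s hi
    rw [h]
    exact zsmul_mem_lieSubalgebra _ (xD_mem_engel e _ hi hj) c
  · obtain ⟨j, hj, c, h⟩ := lie_xD_bot hn e e' i 0 s hi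
    rw [h]
    exact zsmul_mem_lieSubalgebra _ (xD_mem_engel e _ hi hj) c

/-- One bracket with `X^e_{i,0}` takes a generator of opposite sign to the middle part, and another
takes that to generators of sign `e`, where nilpotency is known. -/
theorem xD_neg_mem_engel {n : ℕ} (hn : 4 ≤ n) (e : ℤˣ) {i j : ℤ} (s : ℕ) (hi : 0 ≤ i ∧ i ≤ n)
    (hj : 0 ≤ j ∧ j ≤ n) : xD n (-e) j s ∈ LieSubalgebra.engel ℂ (xD n e i 0) := by
  refine mem_engel_of_lie ?_
  by_cases hij : i = j
  · subst hij
    obtain ⟨k, hk, -, h⟩ := lie_xD_xD_eq hn e i 0 s hi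
    rw [h]
    refine zsmul_mem_lieSubalgebra _ (mem_engel_of_lie ?_) _
    rw [← lie_skew, lie_hD_xD e k i _ 0 hk hi, ← neg_smul]
    exact zsmul_mem_lieSubalgebra _ (xD_mem_engel e _ hi hi) _
  by_cases hexc : Exc n i j
  · rcases hexc with ⟨rfl, rfl⟩ | ⟨rfl, rfl⟩ | ⟨rfl, rfl⟩ | ⟨rfl, rfl⟩
    · rw [lie_xD_zero_one]
      exact zsmul_mem_lieSubalgebra _ (xD_special_mem_engel hn _ _ _ hi (Or.inr rfl)) _
    · rw [lie_xD_one_zero]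
      exact zsmul_mem_lieSubalgebra _ (xD_special_mem_engel hn _ _ _ hi (Or.inr rfl)) _
    · rw [lie_xD_pred_last]
      exact zsmul_mem_lieSubalgebra _ (xD_special_mem_engel hn _ _ _ hi (Or.inl rfl)) _
    · rw [lie_xD_last_pred]
      exact zsmul_mem_lieSubalgebra _ (xD_special_mem_engel hn _ _ _ hi (Or.inl rfl)) _
  · rw [lie_xD_xD_ne e i j 0 s hi hj hij hexc]
    exact zero_mem _

/-- The elements killed by a power of `ad x` form the Engel subalgebra of `x`, so local nilpotency
has to be checked only on the generators. -/
theorem engel_xD {n : ℕ} (hn : 4 ≤ n) (e : ℤˣ) {i : ℤ} (hi : 0 ≤ i ∧ i ≤ n) :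
    LieSubalgebra.engel ℂ (xD n e i 0) = ⊤ := by
  rw [eq_top_iff, ← lieSpan_xD hn, LieSubalgebra.lieSpan_le]
  rintro _ ⟨e', j, s, hj, rfl⟩
  have he : e' = e ∨ e' = -e := by
    rcases Int.units_eq_one_or e with rfl | rfl <;>
    rcases Int.units_eq_one_or e' with rfl | rfl <;> simp
  rcases he with rfl | rfl
  · exact xD_mem_engel e' s hi hj
  · exact xD_neg_mem_engel hn e s hi hj

/-! ### Reflections -/

/-- The pairing with the simple coroot `α_i^∨`. -/
def pr (n : ℕ) (i : ℤ) : Q n →+ ℤ := ∑ j ∈ Finset.Icc (0 : ℤ) n, a n 0 i j • co n j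

theorem pr_simple {n : ℕ} (i : ℤ) {j : ℤ} (hj : 0 ≤ j ∧ j ≤ n) : pr n i (simple n j) = a n 0 i j := by
  simp [pr, AddMonoidHom.finsetSum_apply, co_simple hj, hj]

theorem isGen_H_zero {n : ℕ} {i : ℤ} (hi : 0 ≤ i ∧ i ≤ n) :
    (1 ≤ i ∧ i ≤ (n : ℤ) - 1) ∨ ((i = 0 ∨ i = n) ∧ Even 0) := by
  have h0 : Even 0 := by decide
  simp only [h0, and_true]
  omega

/-- Relation 1 covers the nodes `0, …, n`. The symbols with index `-1` and `n + 1` are, up to sign,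
brackets of such eigenvectors, and eigenvalues add. -/
theorem lie_hD_xD' {n : ℕ} (hn : 4 ≤ n) (e : ℤˣ) {i : ℤ} (j : ℤ) (s : ℕ) (hi : 0 ≤ i ∧ i ≤ n) :
    ⁅hD n i 0, xD n e j s⁆ = pr n i ((e : ℤ) • rt n j) • xD n e j s := by
  have key (e : ℤˣ) (j : ℤ) (s : ℕ) (hj : 0 ≤ j ∧ j ≤ n) :
      ⁅hD n i 0, xD n e j s⁆ = pr n i ((e : ℤ) • simple n j) • xD n e j s := by
    rw [lie_hD_xD e i j 0 s (isGen_H_zero hi) hj, map_zsmul, pr_simple i hj, smul_eq_mul, zero_add]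
  by_cases h : (0 ≤ j ∧ j ≤ n) ∨ ((j = -1 ∨ j = n + 1) ∧ Odd s)
  swap
  · rw [xD_eq_zero n e j s h, lie_zero, smul_zero]
  have aux {x y z : D n} {p q : ℤ} {c : ℤ} (hx : ⁅hD n i 0, x⁆ = p • x) (hy : ⁅hD n i 0, y⁆ = q • y)
      (hz : ⁅x, y⁆ = c • z) (hc : c * c = 1) : ⁅hD n i 0, z⁆ = (p + q) • z := by
    have h1 : z = c • ⁅x, y⁆ := by rw [hz, smul_smul, hc, one_smul]
    rw [h1, lie_smul, leibniz_lie, hx, hy, smul_lie, lie_smul]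
    module
  have hee : -(e : ℤ) * -(e : ℤ) = 1 := by
    rw [neg_mul_neg, ← Units.val_mul, Int.units_mul_self, Units.val_one]
  rcases h with hj | ⟨rfl | rfl, -⟩
  · rw [key e j s hj, rt_of_mem hj]
  · have h1 := aux (key e 0 s (by omega)) (key (-e) 1 0 (by omega)) (lie_xD_zero_one e s 0) hee
    rw [add_zero, ← map_add] at h1
    rw [h1, rt_bot, Units.val_neg, neg_smul, ← sub_eq_add_neg, smul_sub]
  · have h1 := aux (key e n s (by omega)) (key (-e) (n - 1) 0 (by omega))
      (lie_xD_last_pred e s 0) hee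
    rw [add_zero, ← map_add] at h1
    rw [h1, rt_top, Units.val_neg, neg_smul, ← sub_eq_add_neg, smul_sub]

theorem deg_H (n : ℕ) (j : ℤ) (s : ℕ) : deg n (.H j s) = (0, s) := rfl

theorem deg_X (n : ℕ) (e : ℤˣ) (j : ℤ) (s : ℕ) : deg n (.X e j s) = ((e : ℤ) • rt n j, s) := rfl

theorem toD_hD {n : ℕ} {j : ℤ} {s : ℕ} (h : IsGen n (.H j s)) :
    toD n (FreeLieAlgebra.of ℂ ⟨.H j s, h⟩) = hD n j s := by
  rw [toD_of, hD, H]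

theorem toD_xD {n : ℕ} {e : ℤˣ} {j : ℤ} {s : ℕ} (h : IsGen n (.X e j s)) :
    toD n (FreeLieAlgebra.of ℂ ⟨.X e j s, h⟩) = xD n e j s := by
  rw [toD_of, xD, X]

/-- The eigenspaces of `ad h`. -/
def eigenSubmodule {L : Type*} [LieRing L] [LieAlgebra ℂ L] (h : L) (p : ℂ) : Submodule ℂ L where
  carrier := {x | ⁅h, x⁆ = p • x}
  zero_mem' := by simp
  add_mem' := by
    rintro x y (hx : ⁅h, x⁆ = p • x) (hy : ⁅h, y⁆ = p • y)
    change ⁅h, x + y⁆ = p • (x + y)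
    rw [lie_add, hx, hy, smul_add]
  smul_mem' := by
    rintro c x (hx : ⁅h, x⁆ = p • x)
    change ⁅h, c • x⁆ = p • (c • x)
    rw [lie_smul, hx, smul_comm]

theorem lie_eq_of_eigen {L : Type*} [LieRing L] {h x y : L} {p q : ℤ}
    (hx : ⁅h, x⁆ = p • x) (hy : ⁅h, y⁆ = q • y) : ⁅h, ⁅x, y⁆⁆ = (p + q) • ⁅x, y⁆ := by
  rw [leibniz_lie, hx, hy, smul_lie, lie_smul, add_smul]

theorem lie_hD_monomial {n : ℕ} (hn : 4 ≤ n) {i : ℤ} (hi : 0 ≤ i ∧ i ≤ n) {x : D n} {d : Q n × ℕ}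
    (h : IsMonomial n x d) : ⁅hD n i 0, x⁆ = pr n i d.1 • x := by
  induction h with
  | gen g =>
    obtain ⟨g, hg⟩ := g
    cases g with
    | H j s =>
      have h := toD_rel (Rel.hh (n := n) i j 0 s)
      rw [toD_lie, toD_zero] at h
      rw [toD_hD, deg_H, map_zero, zero_smul]
      exact h
    | X e j s => rw [toD_xD, deg_X, lie_hD_xD' hn e j s hi]
  | lie _ _ hx hy => rw [Prod.fst_add, map_add, lie_eq_of_eigen hx hy]

theorem lie_hD_piece {n : ℕ} (hn : 4 ≤ n) {i : ℤ} (hi : 0 ≤ i ∧ i ≤ n) {α : Q n} {k : ℕ} {x : D n}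
    (hx : x ∈ piece n α k) : ⁅hD n i 0, x⁆ = (pr n i α : ℂ) • x := by
  have h : piece n α k ≤ eigenSubmodule (hD n i 0) (pr n i α : ℂ) :=
    Submodule.span_le.2 fun x h => by
      have h1 := lie_hD_monomial hn hi h
      rw [← Int.cast_smul_eq_zsmul ℂ] at h1
      exact h1
  exact h hx

/-- The simple reflections of the root lattice. -/
def refl (n : ℕ) (i : ℤ) (α : Q n) : Q n := α - pr n i α • simple n i

theorem xD_mem_piece {n : ℕ} (e : ℤˣ) (i : ℤ) (r : ℕ) : xD n e i r ∈ piece n ((e : ℤ) • rt n i) r := by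
  by_cases h : IsGen n (.X e i r)
  · rw [xD, X, sym, dif_pos h]
    exact Submodule.subset_span (IsMonomial.gen ⟨_, h⟩)
  · rw [xD, X, sym_eq_zero n _ h, toD_zero]
    exact zero_mem _

theorem ad_pow_mem_piece {n : ℕ} (e : ℤˣ) {i : ℤ} (hi : 0 ≤ i ∧ i ≤ n) {α : Q n} {k : ℕ} (m : ℕ)
    {x : D n} (hx : x ∈ piece n α k) : ((LieAlgebra.ad ℂ (D n) (xD n e i 0)) ^ m) x ∈
      piece n (α + ((m : ℤ) * e) • simple n i) k := by
  induction m with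
  | zero => simpa using hx
  | succ m ih =>
    rw [pow_succ', Module.End.mul_apply, LieAlgebra.ad_apply]
    have h := lie_mem_piece (xD_mem_piece e i 0) ih
    rw [rt_of_mem hi, zero_add] at h
    convert h using 2
    push_cast
    module

/-- The power of `ad X^e_{i,0}` that leads from `α` to its reflection is injective by `sl2_eq_zero`,
since `ad X^{-e}_{i,0}` is locally nilpotent. Comparing cardinal ranks requires no finiteness of the
pieces. -/
theorem rank_piece_le_refl {n : ℕ} (hn : 4 ≤ n) {i : ℤ} (hi : 0 ≤ i ∧ i ≤ n) (α : Q n) (k : ℕ) :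
    Module.rank ℂ (piece n α k) ≤ Module.rank ℂ (piece n (refl n i α) k) := by
  -- The sign is chosen so that `α` has weight `-m ≤ 0` for the triple whose raising operator is
  -- `X^e_{i,0}`; then `s_i α = α + m e α_i`.
  obtain ⟨e, m, hm⟩ : ∃ (e : ℤˣ) (m : ℕ), pr n i α = -(m * (e : ℤ)) := by
    rcases le_total (pr n i α) 0 with h | h
    · exact ⟨1, (-pr n i α).toNat, by simp; omega⟩
    · exact ⟨-1, (pr n i α).toNat, by simp; omega⟩
  set x := xD n e i 0 with hx
  set y := xD n (-e) i 0 with hy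
  have hxy : ⁅x, y⁆ = (e : ℤ) • hD n i 0 := by
    obtain ⟨j, -, h1, h2⟩ := lie_xD_xD_eq hn e i 0 0 hi
    rw [h1 (by decide)] at h2
    exact h2
  have haii : a n 0 i i = 2 := by rw [a, if_pos rfl]
  have hee : (e : ℤ) * e = 1 := by rw [← Units.val_mul, Int.units_mul_self, Units.val_one]
  have hhx : ⁅(e : ℤ) • hD n i 0, x⁆ = 2 • x := by
    rw [smul_lie, lie_hD_xD e i i 0 0 (isGen_H_zero hi) hi, haii, smul_smul, ← mul_assoc, hee]
    module
  have hhy : ⁅(e : ℤ) • hD n i 0, y⁆ = -(2 • y) := by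
    rw [smul_lie, lie_hD_xD (-e) i i 0 0 (isGen_H_zero hi) hi, haii, smul_smul, Units.val_neg,
      ← mul_assoc, mul_neg, hee]
    module
  have hxyz (u v : D n) (w : D n) (h : ⁅u, v⁆ = w) : LieAlgebra.ad ℂ (D n) u *
      LieAlgebra.ad ℂ (D n) v - LieAlgebra.ad ℂ (D n) v * LieAlgebra.ad ℂ (D n) u =
        LieAlgebra.ad ℂ (D n) w := by
    ext z
    rw [← h]
    exact (lie_lie u v z).symm
  have hE := hxyz _ _ _ hxy
  have hHE := hxyz _ _ _ hhx
  have hHF := hxyz _ _ _ hhy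
  rw [map_nsmul] at hHE
  rw [map_neg, map_nsmul] at hHF
  have hmem (v : D n) (hv : v ∈ piece n α k) :
      ((LieAlgebra.ad ℂ (D n) x) ^ m) v ∈ piece n (refl n i α) k := by
    have h := ad_pow_mem_piece e hi m hv
    convert h using 2
    rw [refl, hm]
    module
  refine LinearMap.rank_le_of_injective
    (((LieAlgebra.ad ℂ (D n) x) ^ m).restrict hmem) ?_
  rw [injective_iff_map_eq_zero]
  rintro ⟨v, hv⟩ h
  have hv0 : ((LieAlgebra.ad ℂ (D n) x) ^ m) v = 0 := congrArg Subtype.val h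
  have hvE : v ∈ LieSubalgebra.engel ℂ y := by
    rw [hy, engel_xD hn (-e) hi]
    trivial
  obtain ⟨K, hK⟩ := (LieSubalgebra.mem_engel_iff ℂ y v).1 hvE
  refine Subtype.ext (sl2_eq_zero hE hHE hHF (m := m) (K := K) ?_ hv0 hK)
  rw [LieAlgebra.ad_apply, smul_lie, lie_hD_piece hn hi hv, hm, ← Int.cast_smul_eq_zsmul ℂ,
    smul_smul]
  congr 1
  have hee' : ((e : ℤ) : ℂ) * ((e : ℤ) : ℂ) = 1 := by exact_mod_cast hee
  push_cast
  linear_combination (-(m : ℂ)) * hee'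

/-! ### Coordinates with respect to the `ε_l` -/

/-- The coefficient of `ε_l`. -/
def ep (n : ℕ) (l : ℤ) : Q n →+ ℤ :=
  co n l - co n (l - 1) + (if l = n - 1 then co n n else 0) - (if l = 2 then co n 0 else 0)

theorem addMonoidHom_ext {n : ℕ} {F G : Q n →+ ℤ}
    (h : ∀ j : ℤ, 0 ≤ j ∧ j ≤ n → F (simple n j) = G (simple n j)) : F = G := by
  refine AddMonoidHom.functions_ext _ F G fun i x => ?_
  have hi : (Pi.single i x : Q n) = x • simple n i := by
    ext k
    by_cases hk : k = i
    · subst hk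
      simp [simple]
    · have : ¬ ((k : ℕ) : ℤ) = (i : ℕ) := fun h => hk (Fin.ext (by exact_mod_cast h))
      simp only [simple, Pi.smul_apply, if_neg this, Pi.single_eq_of_ne hk, smul_zero]
  rw [hi, map_zsmul, map_zsmul, h i (by omega)]

theorem ep_apply (n : ℕ) (l : ℤ) (α : Q n) : ep n l α = co n l α - co n (l - 1) α +
    (if l = n - 1 then co n n α else 0) - (if l = 2 then co n 0 α else 0) := by
  unfold ep
  split_ifs <;> simp

theorem ep_simple {n : ℕ} (l : ℤ) {j : ℤ} (hj : 0 ≤ j ∧ j ≤ n) : ep n l (simple n j) =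
    (if l = j then 1 else 0) - (if l - 1 = j then 1 else 0) +
      (if l = n - 1 then if (n : ℤ) = j then 1 else 0 else 0) -
        (if l = 2 then if 0 = j then 1 else 0 else 0) := by
  rw [ep_apply, co_simple hj, co_simple hj, co_simple hj, co_simple hj]

theorem a_zero_eq (n : ℕ) (i j : ℤ) : a n 0 i j = if i = j then 2 else
    if ((i = 0 ∧ j = 2) ∨ (1 ≤ i ∧ i ≤ n - 2 ∧ j = i + 1) ∨ (i = n - 2 ∧ j = n)) ∨
      ((j = 0 ∧ i = 2) ∨ (1 ≤ j ∧ j ≤ n - 2 ∧ i = j + 1) ∨ (j = n - 2 ∧ i = n)) then -1 else 0 := by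
  have h0 : ¬ Odd 0 := by decide
  simp only [a, h0, false_and, if_false, Edge]
  congr

theorem pr_mid {n : ℕ} (hn : 4 ≤ n) {i : ℤ} (hi : 1 ≤ i ∧ i ≤ n - 1) (α : Q n) :
    pr n i α = ep n i α - ep n (i + 1) α := by
  have h : pr n i = ep n i - ep n (i + 1) := addMonoidHom_ext fun j hj => by
    rw [pr_simple i hj, AddMonoidHom.sub_apply, ep_simple _ hj, ep_simple _ hj, a_zero_eq]
    omega
  rw [h, AddMonoidHom.sub_apply]

theorem pr_last {n : ℕ} (hn : 4 ≤ n) (α : Q n) : pr n n α = ep n (n - 1) α + ep n n α := by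
  have h : pr n n = ep n (n - 1) + ep n n := addMonoidHom_ext fun j hj => by
    rw [pr_simple n hj, AddMonoidHom.add_apply, ep_simple _ hj, ep_simple _ hj, a_zero_eq]
    omega
  rw [h, AddMonoidHom.add_apply]

/-- Modulo `δ` the root `α_0` is `-(ε_1 + ε_2)`, and `δ` pairs to zero with every coroot, so the
coefficient of `α_0` does not enter separately. -/
theorem pr_zero {n : ℕ} (hn : 4 ≤ n) (α : Q n) : pr n 0 α = -ep n 1 α - ep n 2 α := by
  have h : pr n 0 = -ep n 1 - ep n 2 := addMonoidHom_ext fun j hj => by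
    rw [pr_simple 0 hj, AddMonoidHom.sub_apply, AddMonoidHom.neg_apply, ep_simple _ hj,
      ep_simple _ hj, a_zero_eq]
    omega
  rw [h, AddMonoidHom.sub_apply, AddMonoidHom.neg_apply]

/-- An element of the root lattice is determined by its `ε`-coordinates and the coefficient of
`α_0`. -/
theorem ext_ep {n : ℕ} (hn : 4 ≤ n) {α β : Q n}
    (h : ∀ l, 1 ≤ l ∧ l ≤ (n : ℤ) → ep n l α = ep n l β) (h0 : co n 0 α = co n 0 β) : α = β := by
  -- Starting from `α_0`, the coordinates `ε_1, …, ε_{n-2}` determine the coefficients of `α_1, …,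
  -- α_{n-2}` one after the other. The last two coordinates then give the sum and the difference of
  -- the coefficients of `α_n` and `α_{n-1}`.
  have key (m : ℕ) : (m : ℤ) ≤ n - 2 → co n m α = co n m β := by
    induction m using Nat.strong_induction_on with
    | _ m ih =>
      intro hm
      rcases Nat.eq_zero_or_pos m with rfl | hpos
      · exact h0
      · have h1 := h m (by omega)
        have h2 := ih (m - 1) (by omega) (by omega)
        rw [ep_apply, ep_apply, if_neg (show ¬ (m : ℤ) = n - 1 by omega),
          if_neg (show ¬ (m : ℤ) = n - 1 by omega), h0] at h1
        rw [show ((m - 1 : ℕ) : ℤ) = m - 1 by omega] at h2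
        omega
  have h1 := key (n - 2) (by omega)
  rw [show ((n - 2 : ℕ) : ℤ) = n - 2 by omega] at h1
  have h2 := h (n - 1) (by omega)
  have h3 := h n (by omega)
  rw [ep_apply, ep_apply, show (n : ℤ) - 1 - 1 = n - 2 by omega] at h2
  rw [ep_apply, ep_apply] at h3
  refine ext_co fun j hj => ?_
  rcases (by omega : j ≤ n - 2 ∨ j = n - 1 ∨ j = n) with hj' | rfl | rfl
  · have h4 := key j.toNat (by omega)
    rwa [show ((j.toNat : ℕ) : ℤ) = j by omega] at h4
  · omega
  · omega

/-- The coefficient of `ε_l` in `ε_p`, where `ε_{-p} = -ε_p`. -/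
def eps (p l : ℤ) : ℤ := (if l = p then 1 else 0) - (if l = -p then 1 else 0)

/-- The signed transposition of `p` and `q`. -/
def sperm (a b p : ℤ) : ℤ :=
  if p = a then b else if p = b then a else if p = -a then -b else if p = -b then -a else p

/-- This is the orthogonal reflection in `ε_a - ε_b`. The convention `ε_{-b} = -ε_b` includes the
reflections in `ε_a + ε_b`. -/
theorem eps_sperm {a b : ℤ} (ha : a ≠ 0) (hb : b ≠ 0) (hab : a ≠ b) (hab' : a ≠ -b) (p l : ℤ) :
    eps p l - (eps p a - eps p b) * (eps a l - eps b l) = eps (sperm a b p) l := by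
  rcases (by omega : p = a ∨ p = b ∨ p = -a ∨ p = -b ∨ (p ≠ a ∧ p ≠ b ∧ p ≠ -a ∧ p ≠ -b))
    with rfl | rfl | rfl | rfl | ⟨h1, h2, h3, h4⟩ <;>
  simp (disch := omega) only [eps, sperm, if_neg, if_true, neg_neg] <;>
  omega

/-- The weight `α` is `ε_p + ε_q` modulo `δ`. -/
def IsWt (n : ℕ) (α : Q n) (p q : ℤ) : Prop :=
  ∀ l, 1 ≤ l ∧ l ≤ (n : ℤ) → ep n l α = eps p l + eps q l

/-- The nodes of the Dynkin diagram as signed transpositions. -/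
theorem exists_sperm {n : ℕ} (hn : 4 ≤ n) {i : ℤ} (hi : 0 ≤ i ∧ i ≤ n) :
    ∃ a b : ℤ, (a ≠ 0 ∧ -(n : ℤ) ≤ a ∧ a ≤ n) ∧ (b ≠ 0 ∧ -(n : ℤ) ≤ b ∧ b ≤ n) ∧ a ≠ b ∧ a ≠ -b ∧
      ∀ p q α, IsWt n α p q → IsWt n (refl n i α) (sperm a b p) (sperm a b q) := by
  -- The simple root is `c(ε_a - ε_b)` modulo `δ` with `c = ±1`; the sign occurs twice in the
  -- reflection and drops out.
  have lin (a b : ℤ) (c : ℤ) (hc : c * c = 1) (ha : a ≠ 0) (hb : b ≠ 0) (hab : a ≠ b)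
      (hab' : a ≠ -b)
      (h1 : ∀ l, 1 ≤ l ∧ l ≤ (n : ℤ) → ep n l (simple n i) = c * (eps a l - eps b l))
      (p q : ℤ) (α : Q n) (h : IsWt n α p q)
      (h2 : pr n i α = c * ((eps p a + eps q a) - (eps p b + eps q b))) :
      IsWt n (refl n i α) (sperm a b p) (sperm a b q) := by
    intro l hl
    rw [refl, map_sub, map_zsmul, h1 l hl, h2, h l hl, ← eps_sperm ha hb hab hab',
      ← eps_sperm ha hb hab hab', smul_eq_mul]
    linear_combination (-((eps p a + eps q a) - (eps p b + eps q b)) * (eps a l - eps b l)) * hc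
  have epn (p l : ℤ) : eps p (-l) = -eps p l := by
    unfold eps
    omega
  rcases (by omega : i = 0 ∨ (1 ≤ i ∧ i ≤ (n : ℤ) - 1) ∨ i = n) with rfl | h | rfl
  -- Modulo `δ` the root `α_0` is `-(ε_1 - ε_{-2})`, whence `c = -1`; at the other nodes `c = 1`.
  · refine ⟨1, -2, by omega, by omega, by omega, by omega, fun p q α h => ?_⟩
    refine lin 1 (-2) (-1) (by omega) (by omega) (by omega) (by omega) (by omega) (fun l hl => ?_)
      p q α h ?_
    · rw [ep_simple _ hi]
      unfold eps
      omega
    · rw [pr_zero hn, h 1 (by omega), h 2 (by omega), epn, epn]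
      ring
  · refine ⟨i, i + 1, by omega, by omega, by omega, by omega, fun p q α h' => ?_⟩
    refine lin i (i + 1) 1 (by omega) (by omega) (by omega) (by omega) (by omega) (fun l hl => ?_)
      p q α h' ?_
    · rw [ep_simple _ hi]
      unfold eps
      omega
    · rw [pr_mid hn h, h' i (by omega), h' (i + 1) (by omega)]
      ring
  · refine ⟨n - 1, -n, by omega, by omega, by omega, by omega, fun p q α h => ?_⟩
    refine lin (n - 1) (-n) 1 (by omega) (by omega) (by omega) (by omega) (by omega)
      (fun l hl => ?_) p q α h ?_
    · rw [ep_simple _ hi]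
      unfold eps
      omega
    · rw [pr_last hn, h (n - 1) (by omega), h n (by omega), epn, epn]
      ring

/-! ### Conjugacy under the affine Weyl group -/

/-- The elements `α` and `β` are conjugate under the group generated by the simple reflections. -/
def Conj (n : ℕ) : Q n → Q n → Prop :=
  Relation.ReflTransGen fun α β => ∃ i : ℤ, (0 ≤ i ∧ i ≤ n) ∧ β = refl n i α

theorem refl_refl {n : ℕ} {i : ℤ} (hi : 0 ≤ i ∧ i ≤ n) (α : Q n) :
    refl n i (refl n i α) = α := by
  have h : pr n i (refl n i α) = -pr n i α := by
    rw [refl, map_sub, map_zsmul, pr_simple i hi, a, if_pos rfl, smul_eq_mul]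
    ring
  rw [refl, h, refl]
  module

theorem refl_zsmul {n : ℕ} (i c : ℤ) (α : Q n) : refl n i (c • α) = c • refl n i α := by
  rw [refl, refl, map_zsmul, smul_eq_mul, smul_sub, smul_smul]

theorem Conj.zsmul {n : ℕ} {α β : Q n} (h : Conj n α β) (c : ℤ) : Conj n (c • α) (c • β) := by
  induction h with
  | refl => exact Relation.ReflTransGen.refl
  | tail _ h ih =>
    obtain ⟨i, hi, rfl⟩ := h
    exact ih.tail ⟨i, hi, (refl_zsmul i c _).symm⟩

theorem Conj.symm {n : ℕ} {α β : Q n} (h : Conj n α β) : Conj n β α := by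
  induction h with
  | refl => exact Relation.ReflTransGen.refl
  | tail _ h ih =>
    obtain ⟨i, hi, rfl⟩ := h
    exact Relation.ReflTransGen.head ⟨i, hi, (refl_refl hi _).symm⟩ ih

theorem Conj.rank_le {n : ℕ} (hn : 4 ≤ n) {α β : Q n} (h : Conj n α β) (k : ℕ) :
    Module.rank ℂ (piece n α k) ≤ Module.rank ℂ (piece n β k) := by
  induction h with
  | refl => exact le_rfl
  | tail _ h ih =>
    obtain ⟨i, hi, rfl⟩ := h
    exact ih.trans (rank_piece_le_refl hn hi _ k)

theorem Conj.rank_eq {n : ℕ} (hn : 4 ≤ n) {α β : Q n} (h : Conj n α β) (k : ℕ) :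
    Module.rank ℂ (piece n α k) = Module.rank ℂ (piece n β k) :=
  le_antisymm (h.rank_le hn k) (h.symm.rank_le hn k)

/-- Signed permutations are injective and commute with negation, so they preserve whether `p = q` or
`p = -q`: weights `±2ε_i` and weights `±ε_i ± ε_j` are never conjugate. -/
theorem Conj.isWt {n : ℕ} (hn : 4 ≤ n) {α β : Q n} (h : Conj n α β) {p q : ℤ}
    (hp : p ≠ 0 ∧ -(n : ℤ) ≤ p ∧ p ≤ n) (hq : q ≠ 0 ∧ -(n : ℤ) ≤ q ∧ q ≤ n) (hw : IsWt n α p q) :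
    ∃ p' q' : ℤ, (p' ≠ 0 ∧ -(n : ℤ) ≤ p' ∧ p' ≤ n) ∧ (q' ≠ 0 ∧ -(n : ℤ) ≤ q' ∧ q' ≤ n) ∧
      IsWt n β p' q' ∧ (p' = q' ↔ p = q) ∧ (p' = -q' ↔ p = -q) := by
  induction h with
  | refl => exact ⟨p, q, hp, hq, hw, Iff.rfl, Iff.rfl⟩
  | tail _ h ih =>
    obtain ⟨i, hi, rfl⟩ := h
    obtain ⟨p', q', hp', hq', hw', h1, h2⟩ := ih
    obtain ⟨a, b, ha, hb, hab, hab', h⟩ := exists_sperm hn hi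
    refine ⟨_, _, ?_, ?_, h p' q' _ hw', ?_, ?_⟩
    · unfold sperm
      omega
    · unfold sperm
      omega
    · rw [← h1]
      unfold sperm
      omega
    · rw [← h2]
      unfold sperm
      omega

/-- The elements of the root lattice that are multiples of `δ`. -/
def IsImag (n : ℕ) (α : Q n) : Prop := ∀ l, 1 ≤ l ∧ l ≤ (n : ℤ) → ep n l α = 0

theorem IsImag.refl_eq {n : ℕ} (hn : 4 ≤ n) {i : ℤ} (hi : 0 ≤ i ∧ i ≤ n) {α : Q n}
    (h : IsImag n α) : refl n i α = α := by
  have h1 : pr n i α = 0 := by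
    rcases (by omega : i = 0 ∨ (1 ≤ i ∧ i ≤ (n : ℤ) - 1) ∨ i = n) with rfl | h' | rfl
    · rw [pr_zero hn, h 1 (by omega), h 2 (by omega)]
      rfl
    · rw [pr_mid hn h', h i (by omega), h (i + 1) (by omega)]
      rfl
    · rw [pr_last hn, h (n - 1) (by omega), h n (by omega)]
      rfl
  rw [refl, h1, zero_smul, sub_zero]

theorem not_isImag_refl {n : ℕ} (hn : 4 ≤ n) {i : ℤ} (hi : 0 ≤ i ∧ i ≤ n) {α : Q n}
    (h : ¬ IsImag n α) : ¬ IsImag n (refl n i α) := fun h' => h <| by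
  have h1 := h'.refl_eq hn hi
  rw [refl_refl hi] at h1
  rwa [← h1] at h'

/-- If all pairings were at most `0`, the coordinates would satisfy `c_1 ≤ … ≤ c_n`, `c_1 + c_2 ≥ 0`
and `c_{n-1} + c_n ≤ 0`, which forces them all to vanish. -/
theorem exists_pr_pos {n : ℕ} (hn : 4 ≤ n) {α : Q n} (h : ¬ IsImag n α) :
    ∃ i : ℤ, (0 ≤ i ∧ i ≤ n) ∧ 0 < pr n i α := by
  by_contra hc
  push Not at hc
  have mono (m : ℕ) (l : ℤ) (hl : 1 ≤ l) : l + m ≤ n → ep n l α ≤ ep n (l + m) α := by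
    induction m with
    | zero => intro _; simp
    | succ m ih =>
      intro hm
      have h1 := ih (by omega)
      have h2 := hc (l + m) (by omega)
      rw [pr_mid hn (by omega)] at h2
      rw [show l + ((m + 1 : ℕ) : ℤ) = l + m + 1 by push_cast; ring]
      omega
  have mono' (a b : ℤ) (ha : 1 ≤ a) (hab : a ≤ b) (hb : b ≤ n) : ep n a α ≤ ep n b α := by
    have h1 := mono (b - a).toNat a ha (by omega)
    rwa [show a + ((b - a).toNat : ℤ) = b by omega] at h1
  have h1 := hc 0 (by omega)
  have h2 := hc n (by omega)
  rw [pr_zero hn] at h1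
  rw [pr_last hn] at h2
  have h3 := mono' 1 2 (by omega) (by omega) (by omega)
  have h4 := mono' 2 (n - 1) (by omega) (by omega) (by omega)
  have h5 := mono' (n - 1) n (by omega) (by omega) (by omega)
  refine h fun l hl => ?_
  have h6 := mono' 1 l (by omega) (by omega) (by omega)
  have h7 := mono' l n (by omega) (by omega) (by omega)
  omega

theorem co_refl {n : ℕ} {i : ℤ} (hi : 0 ≤ i ∧ i ≤ n) (j : ℤ) (α : Q n) :
    co n j (refl n i α) = co n j α - if j = i then pr n i α else 0 := by
  rw [refl, map_sub, map_zsmul, co_simple hi]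
  split_ifs <;> simp

/-- A positive element that is not a multiple of `δ` can be conjugated until a simple reflection
makes it cease to be positive. -/
theorem exists_conj {n : ℕ} (hn : 4 ≤ n) (N : ℕ) : ∀ α : Q n, (∀ j, 0 ≤ co n j α) →
    ¬ IsImag n α → (∑ j ∈ Finset.Icc (0 : ℤ) n, co n j α) ≤ N → ∃ β, Conj n α β ∧
      (∀ j, 0 ≤ co n j β) ∧ ∃ i : ℤ, (0 ≤ i ∧ i ≤ n) ∧ ¬ ∀ j, 0 ≤ co n j (refl n i β) := by
  induction N with
  | zero =>
    intro α hα him hN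
    refine absurd (fun l _ => ?_) him
    have h0 (j : ℤ) : co n j α = 0 := by
      by_cases hj : 0 ≤ j ∧ j ≤ n
      · have h1 := Finset.single_le_sum (f := fun j => co n j α) (fun j _ => hα j)
          (Finset.mem_Icc.2 hj)
        have h2 := hα j
        omega
      · exact co_eq_zero hj α
    rw [ep_apply]
    simp [h0]
  | succ N ih =>
    intro α hα him hN
    obtain ⟨i, hi, hpos⟩ := exists_pr_pos hn him
    by_cases h : ∀ j, 0 ≤ co n j (refl n i α)
    · have hs : ∑ j ∈ Finset.Icc (0 : ℤ) n, co n j (refl n i α) =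
          (∑ j ∈ Finset.Icc (0 : ℤ) n, co n j α) - pr n i α := by
        simp only [co_refl hi, Finset.sum_sub_distrib, Finset.sum_ite_eq']
        rw [if_pos (Finset.mem_Icc.2 hi)]
      obtain ⟨β, h1, h2⟩ := ih _ h (not_isImag_refl hn hi him) (by push_cast at hN; omega)
      exact ⟨β, Relation.ReflTransGen.head ⟨i, hi, rfl⟩ h1, h2⟩
    · exact ⟨α, Relation.ReflTransGen.refl, hα, i, hi, h⟩

/-- A non-zero graded piece whose weight is not a multiple of `δ` is conjugate to the piece of a
generator. -/
theorem exists_conj_gen {n : ℕ} (hn : 4 ≤ n) {α : Q n} (him : ¬ IsImag n α) {k : ℕ}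
    (h : piece n α k ≠ ⊥) : ∃ γ, Conj n α γ ∧ ∃ e : ℤˣ,
      (∃ i : ℤ, (0 ≤ i ∧ i ≤ n) ∧ γ = (e : ℤ) • simple n i) ∨
        γ = (e : ℤ) • rt n (n + 1) ∨ γ = (e : ℤ) • rt n (-1) := by
  have hne {β : Q n} (hβ : ¬ IsImag n β) : β ≠ 0 := by
    rintro rfl
    exact hβ fun l _ => map_zero _
  have hbot {β : Q n} (hβ : Conj n α β) : piece n β k ≠ ⊥ := by
    intro h0
    have h1 := hβ.rank_eq hn k
    rw [h0, rank_bot] at h1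
    exact h (Submodule.rank_eq_zero.1 h1)
  have himc {β : Q n} (hβ : Conj n α β) : ¬ IsImag n β := by
    induction hβ with
    | refl => exact him
    | tail _ h ih =>
      obtain ⟨i, hi, rfl⟩ := h
      exact not_isImag_refl hn hi ih
  have hee (e : ℤˣ) : (e : ℤ) * e = 1 := by rw [← Units.val_mul, Int.units_mul_self, Units.val_one]
  have main (e : ℤˣ) (hα : ∀ j, 0 ≤ co n j ((e : ℤ) • α)) : ∃ γ, Conj n α γ ∧ ∃ e : ℤˣ,
      (∃ i : ℤ, (0 ≤ i ∧ i ≤ n) ∧ γ = (e : ℤ) • simple n i) ∨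
        γ = (e : ℤ) • rt n (n + 1) ∨ γ = (e : ℤ) • rt n (-1) := by
    have him' : ¬ IsImag n ((e : ℤ) • α) := fun h => him fun l hl => by
      have h1 := h l hl
      rw [map_zsmul, smul_eq_mul] at h1
      exact (mul_eq_zero.1 h1).resolve_left e.ne_zero
    obtain ⟨β, h1, h2, i, hi, h3⟩ := exists_conj hn
      (∑ j ∈ Finset.Icc (0 : ℤ) n, co n j ((e : ℤ) • α)).toNat _ hα him' (Int.self_le_toNat _)
    have h4 := h1.zsmul (e : ℤ)
    rw [smul_smul, hee, one_smul] at h4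
    have h5 : Conj n α (refl n i ((e : ℤ) • β)) := h4.tail ⟨i, hi, rfl⟩
    -- A simple reflection changes only the coefficient of `α_i`. If it makes a non-negative `β`
    -- non-positive, then `β` is a multiple of `α_i`, and since the piece is non-zero the multiple
    -- is `±α_i`.
    have fin (hle : ∀ j, co n j (refl n i β) ≤ 0) : ∃ γ, Conj n α γ ∧ ∃ e : ℤˣ,
        (∃ i : ℤ, (0 ≤ i ∧ i ≤ n) ∧ γ = (e : ℤ) • simple n i) ∨
          γ = (e : ℤ) • rt n (n + 1) ∨ γ = (e : ℤ) • rt n (-1) := by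
      have h7 : β = co n i β • simple n i := ext_co fun j hj => by
        have h8 := hle j
        rw [co_refl hi] at h8
        have h9 := h2 j
        rw [map_zsmul, co_simple hi, smul_eq_mul]
        by_cases hji : j = i
        · rw [hji, if_pos rfl, mul_one]
        · rw [if_neg hji] at h8 ⊢
          omega
      have h8 : (e : ℤ) • β = ((e : ℤ) * co n i β) • simple n i := by
        conv_lhs => rw [h7]
        rw [smul_smul]
      have h9 : (e : ℤ) * co n i β ≠ 0 := fun h0 => hne (himc h4) (by rw [h8, h0, zero_smul])
      have h10 := piece_zsmul_simple hn hi h9 k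
      rw [← h8] at h10
      by_cases h11 : ∃ e' : ℤˣ, (e : ℤ) * co n i β = e'
      · obtain ⟨e', he'⟩ := h11
        exact ⟨_, h4, e', Or.inl ⟨i, hi, by rw [h8, he']⟩⟩
      · refine absurd ?_ (hbot h4)
        rw [eq_bot_iff]
        refine h10.trans (Submodule.span_le.2 ?_)
        rintro x ⟨e', h12, -⟩
        exact absurd ⟨e', h12⟩ h11
    -- The reflected degree still occurs. It has lost positivity, so either its coefficients are all
    -- at most `0` up to the sign `e`, or it is one of the special degrees.
    rcases piece_support hn (hbot h5) (hne (himc h5)) with h6 | h6 | ⟨e', h6⟩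
    · exact fin fun j => by
        obtain ⟨j', hj'⟩ := not_forall.1 h3
        have hcon := h6
        rw [refl_zsmul] at hcon
        have h7 := hcon j
        have h8 := hcon j'
        rw [map_zsmul, smul_eq_mul] at h7 h8
        rcases Int.units_eq_one_or e with rfl | rfl <;>
        simp only [Units.val_one, Units.val_neg, one_mul, neg_mul] at h7 h8 <;> omega
    · exact fin fun j => by
        obtain ⟨j', hj'⟩ := not_forall.1 h3
        have hcon := h6
        rw [refl_zsmul] at hcon
        have h7 := hcon j
        have h8 := hcon j'
        rw [map_zsmul, smul_eq_mul] at h7 h8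
        rcases Int.units_eq_one_or e with rfl | rfl <;>
        simp only [Units.val_one, Units.val_neg, one_mul, neg_mul] at h7 h8 <;> omega
    · exact ⟨_, h5, e', Or.inr h6⟩
  rcases piece_support hn h (hne him) with h1 | h1 | ⟨e, h1⟩
  · exact main 1 fun j => by simpa using h1 j
  · exact main (-1) fun j => by simpa using h1 j
  · exact ⟨α, Relation.ReflTransGen.refl, e, Or.inr h1⟩

/-! ### Weights and roots -/

theorem eps_neg (p l : ℤ) : eps (-p) l = -eps p l := by
  unfold eps
  omega

theorem eps_unit_mul (e : ℤˣ) (p l : ℤ) : eps (e * p) l = e * eps p l := by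
  rcases Int.units_eq_one_or e with rfl | rfl
  · simp
  · simp [eps_neg]

theorem IsWt.swap {n : ℕ} {α : Q n} {p q : ℤ} (h : IsWt n α p q) : IsWt n α q p :=
  fun l hl => (h l hl).trans (add_comm _ _)

theorem IsWt.unit_smul {n : ℕ} {α : Q n} {p q : ℤ} (h : IsWt n α p q) (e : ℤˣ) :
    IsWt n ((e : ℤ) • α) (e * p) (e * q) := fun l hl => by
  rw [map_zsmul, h l hl, eps_unit_mul, eps_unit_mul, smul_eq_mul, mul_add]

theorem IsWt.add {n : ℕ} {α β : Q n} {p j q : ℤ} (h : IsWt n α p (-j)) (h' : IsWt n β j q) :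
    IsWt n (α + β) p q := fun l hl => by
  rw [map_add, h l hl, h' l hl, eps_neg]
  ring

theorem ep_sum_simple {n : ℕ} {i m l : ℤ} (hi : 1 ≤ i) (hm : m ≤ n - 1) :
    ep n l (∑ k ∈ Finset.Icc i m, simple n k) =
      (if i ≤ l ∧ l ≤ m then 1 else 0) - (if i ≤ l - 1 ∧ l - 1 ≤ m then 1 else 0) := by
  have h : ∀ k ∈ Finset.Icc i m, ep n l (simple n k) =
      (if l = k then 1 else 0) - (if l - 1 = k then 1 else 0) := fun k hk => by
    rw [Finset.mem_Icc] at hk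
    rw [ep_simple l (by omega)]
    omega
  rw [map_sum, Finset.sum_congr rfl h, Finset.sum_sub_distrib, Finset.sum_ite_eq,
    Finset.sum_ite_eq]
  simp only [Finset.mem_Icc]

theorem co_zero_sum_simple {n : ℕ} {i m : ℤ} (hi : 1 ≤ i) (hm : m ≤ n) :
    co n 0 (∑ k ∈ Finset.Icc i m, simple n k) = 0 := by
  rw [map_sum]
  refine Finset.sum_eq_zero fun k hk => ?_
  rw [Finset.mem_Icc] at hk
  rw [co_simple (by omega), if_neg (by omega)]

theorem isWt_simple_zero {n : ℕ} (hn : 4 ≤ n) : IsWt n (simple n 0) (-2) (-1) := fun l hl => by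
  rw [ep_simple _ (by omega)]
  unfold eps
  omega

theorem isWt_simple {n : ℕ} (hn : 4 ≤ n) {i : ℤ} (hi : 1 ≤ i ∧ i ≤ n - 1) :
    IsWt n (simple n i) i (-(i + 1)) := fun l hl => by
  rw [ep_simple _ (by omega)]
  unfold eps
  omega

theorem isWt_simple_last {n : ℕ} (hn : 4 ≤ n) : IsWt n (simple n n) (n - 1) n := fun l hl => by
  rw [ep_simple _ (by omega)]
  unfold eps
  omega

theorem isWt_epsSub {n : ℕ} {i j : ℤ} (hi : 1 ≤ i) (hij : i < j) (hj : j ≤ n) :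
    IsWt n (epsSub n i j) i (-j) := fun l hl => by
  rw [epsSub, ep_sum_simple hi (by omega)]
  unfold eps
  omega

theorem isWt_long {n : ℕ} (hn : 4 ≤ n) {i : ℤ} (hi : 1 ≤ i ∧ i ≤ n - 1) :
    IsWt n (long n i) i i := fun l hl => by
  rw [long, map_add, map_add, map_zsmul, ep_sum_simple hi.1 (by omega), ep_simple _ (by omega),
    ep_simple _ (by omega), smul_eq_mul]
  unfold eps
  omega

theorem isWt_top {n : ℕ} (hn : 4 ≤ n) : IsWt n (simple n n - simple n (n - 1)) n n :=
  fun l hl => by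
  rw [map_sub, ep_simple _ (by omega), ep_simple _ (by omega)]
  unfold eps
  omega

theorem isWt_bot {n : ℕ} (hn : 4 ≤ n) : IsWt n (simple n 0 - simple n 1) (-1) (-1) :=
  fun l hl => by
  rw [map_sub, ep_simple _ (by omega), ep_simple _ (by omega)]
  unfold eps
  omega

theorem isWt_epsAdd {n : ℕ} (hn : 4 ≤ n) {i j : ℤ} (hi : 1 ≤ i) (hij : i < j) (hj : j ≤ n) :
    IsWt n (epsAdd n i j) i j := by
  unfold epsAdd
  refine (isWt_epsSub hi hij hj).add ?_
  split_ifs with h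
  · rw [h]
    exact isWt_top hn
  · exact isWt_long hn (by omega)

theorem ep_delta {n : ℕ} (hn : 4 ≤ n) {l : ℤ} (hl : 1 ≤ l ∧ l ≤ n) : ep n l (delta n) = 0 := by
  rw [delta, map_add, map_add, map_add, map_add, map_zsmul, ep_sum_simple (by omega) (by omega),
    ep_simple _ (by omega), ep_simple _ (by omega), ep_simple _ (by omega),
    ep_simple _ (by omega), smul_eq_mul]
  omega

theorem co_zero_delta {n : ℕ} (hn : 4 ≤ n) : co n 0 (delta n) = 1 := by
  rw [delta, map_add, map_add, map_add, map_add, map_zsmul,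
    co_zero_sum_simple (by omega) (by omega), co_simple (by omega), co_simple (by omega),
    co_simple (by omega), co_simple (by omega)]
  simp (disch := omega)
  omega

theorem IsWt.add_delta {n : ℕ} (hn : 4 ≤ n) {α : Q n} {p q : ℤ} (h : IsWt n α p q) (s : ℤ) :
    IsWt n (α + s • delta n) p q := fun l hl => by
  rw [map_add, map_zsmul, ep_delta hn hl, smul_zero, add_zero, h l hl]

/-- `δ` has zero `ε`-coordinates and coefficient `1` at `α_0`, so the difference of the coefficients
at `α_0` is the required multiple. -/
theorem IsWt.eq_add_delta {n : ℕ} (hn : 4 ≤ n) {α β : Q n} {p q : ℤ} (h : IsWt n α p q)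
    (h' : IsWt n β p q) : ∃ s : ℤ, α = β + s • delta n := by
  refine ⟨co n 0 α - co n 0 β, ext_ep hn (fun l hl => ?_) ?_⟩
  · rw [h'.add_delta hn _ l hl, h l hl]
  · rw [map_add, map_zsmul, co_zero_delta hn, smul_eq_mul]
    ring

theorem IsImag.eq_smul_delta {n : ℕ} (hn : 4 ≤ n) {α : Q n} (h : IsImag n α) :
    α = co n 0 α • delta n := by
  refine ext_ep hn (fun l hl => ?_) ?_
  · rw [map_zsmul, ep_delta hn hl, smul_zero, h l hl]
  · rw [map_zsmul, co_zero_delta hn, smul_eq_mul, mul_one]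

theorem isImag_smul_delta {n : ℕ} (hn : 4 ≤ n) (s : ℤ) : IsImag n (s • delta n) := fun l hl => by
  rw [map_zsmul, ep_delta hn hl, smul_zero]

/-- The weight is symmetric in `p` and `q`, so `|p| < |q|` may be assumed. The sign of `p` is the
overall sign of the root, and the relative sign of `q` decides between `ε_i + ε_j` and `ε_i - ε_j`.
-/
theorem mem_roots_of_isWt {n : ℕ} (hn : 4 ≤ n) {α : Q n} {p q : ℤ}
    (hp : p ≠ 0 ∧ -(n : ℤ) ≤ p ∧ p ≤ n) (hq : q ≠ 0 ∧ -(n : ℤ) ≤ q ∧ q ≤ n) (h1 : p ≠ q)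
    (h2 : p ≠ -q) (h : IsWt n α p q) : α ∈ roots n := by
  have main (p q : ℤ) (hp : p ≠ 0 ∧ -(n : ℤ) ≤ p ∧ p ≤ n) (hq : q ≠ 0 ∧ -(n : ℤ) ≤ q ∧ q ≤ n)
      (hpq : p.natAbs < q.natAbs) (h : IsWt n α p q) : α ∈ roots n := by
    have key (e : ℤˣ) (i j : ℤ) (hi : 1 ≤ i) (hij : i < j) (hj : j ≤ n) (hpe : p = e * i)
        (hqe : q = e * j ∨ q = e * -j) : α ∈ roots n := by
      rcases hqe with rfl | rfl <;> subst hpe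
      · obtain ⟨s, hs⟩ := h.eq_add_delta hn ((isWt_epsAdd hn hi hij hj).unit_smul e)
        exact Or.inl ⟨_, ⟨i, j, hi, hij, hj, e, Or.inr rfl⟩, s, hs⟩
      · obtain ⟨s, hs⟩ := h.eq_add_delta hn ((isWt_epsSub hi hij hj).unit_smul e)
        exact Or.inl ⟨_, ⟨i, j, hi, hij, hj, e, Or.inl rfl⟩, s, hs⟩
    rcases (by omega : 1 ≤ p ∨ p ≤ -1) with h3 | h3
    · exact key 1 p q.natAbs h3 (by omega) (by omega) (by simp)
        (by rw [Units.val_one]; omega)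
    · exact key (-1) (-p) q.natAbs (by omega) (by omega) (by omega) (by simp)
        (by rw [Units.val_neg, Units.val_one]; omega)
  rcases (by omega : p.natAbs < q.natAbs ∨ q.natAbs < p.natAbs) with h3 | h3
  · exact main p q hp hq h3 h
  · exact main q p hq hp h3 h.swap

theorem mem_extRoots_of_isWt {n : ℕ} (hn : 4 ≤ n) {α : Q n} {p : ℤ}
    (hp : p ≠ 0 ∧ -(n : ℤ) ≤ p ∧ p ≤ n) (h : IsWt n α p p) : α ∈ extRoots n := by
  have key (e : ℤˣ) (i : ℤ) (hi : 1 ≤ i ∧ i ≤ n) (hpe : p = e * i) : α ∈ extRoots n := by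
    subst hpe
    rcases (by omega : i ≤ n - 1 ∨ i = n) with h3 | rfl
    · obtain ⟨s, hs⟩ := h.eq_add_delta hn ((isWt_long hn ⟨hi.1, h3⟩).unit_smul e)
      exact Or.inr ⟨e, s, Or.inl ⟨i, hi.1, h3, hs⟩⟩
    · obtain ⟨s, hs⟩ := h.eq_add_delta hn ((isWt_top hn).unit_smul e)
      -- The sign is reversed because `Δ^ex` lists `α_{n-1} - α_n`, which is `-2ε_n`.
      refine Or.inr ⟨-e, s, Or.inr (Or.inl ?_)⟩
      rw [hs, Units.val_neg, neg_smul, ← smul_neg, neg_sub]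
  rcases (by omega : 1 ≤ p ∨ p ≤ -1) with h3 | h3
  · exact key 1 p (by omega) (by simp)
  · exact key (-1) (-p) (by omega) (by simp)

theorem exists_isWt_of_mem_roots {n : ℕ} (hn : 4 ≤ n) {α : Q n} (him : ¬ IsImag n α)
    (h : α ∈ roots n) : ∃ p q : ℤ, (p ≠ 0 ∧ -(n : ℤ) ≤ p ∧ p ≤ n) ∧
      (q ≠ 0 ∧ -(n : ℤ) ≤ q ∧ q ≤ n) ∧ p ≠ q ∧ p ≠ -q ∧ IsWt n α p q := by
  have hv (e : ℤˣ) (i : ℤ) (hi : i ≠ 0 ∧ -(n : ℤ) ≤ i ∧ i ≤ n) :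
      (e : ℤ) * i ≠ 0 ∧ -(n : ℤ) ≤ e * i ∧ e * i ≤ n := by
    rcases Int.units_eq_one_or e with rfl | rfl <;> simp <;> omega
  have hd (e : ℤˣ) (i j : ℤ) (hij : i ≠ j) : (e : ℤ) * i ≠ e * j := fun h =>
    hij (mul_left_cancel₀ e.ne_zero h)
  rcases h with ⟨β, ⟨i, j, hi, hij, hj, e, rfl | rfl⟩, s, rfl⟩ | ⟨s, -, rfl⟩
  · refine ⟨e * i, e * -j, hv e i (by omega), hv e (-j) (by omega), hd e _ _ (by omega), ?_,
      ((isWt_epsSub hi hij hj).unit_smul e).add_delta hn s⟩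
    rw [← mul_neg]
    exact hd e _ _ (by omega)
  · refine ⟨e * i, e * j, hv e i (by omega), hv e j (by omega), hd e _ _ (by omega), ?_,
      ((isWt_epsAdd hn hi hij hj).unit_smul e).add_delta hn s⟩
    rw [← mul_neg]
    exact hd e _ _ (by omega)
  · exact absurd (isImag_smul_delta hn s) him

theorem exists_isWt_of_mem_extRoots {n : ℕ} (hn : 4 ≤ n) {α : Q n} (h : α ∈ extRoots n)
    (hr : α ∉ roots n) : ∃ p : ℤ, (p ≠ 0 ∧ -(n : ℤ) ≤ p ∧ p ≤ n) ∧ IsWt n α p p := by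
  have hv (e : ℤˣ) (i : ℤ) (hi : i ≠ 0 ∧ -(n : ℤ) ≤ i ∧ i ≤ n) :
      (e : ℤ) * i ≠ 0 ∧ -(n : ℤ) ≤ e * i ∧ e * i ≤ n := by
    rcases Int.units_eq_one_or e with rfl | rfl <;> simp <;> omega
  rcases h with h | ⟨e, s, ⟨i, hi, hi', rfl⟩ | rfl | rfl⟩
  · exact absurd h hr
  · exact ⟨_, hv e i (by omega), ((isWt_long hn ⟨hi, hi'⟩).unit_smul e).add_delta hn s⟩
  · refine ⟨_, hv (-e) n (by omega), ?_⟩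
    have h1 := ((isWt_top hn).unit_smul (-e)).add_delta hn s
    rwa [Units.val_neg, neg_smul, ← smul_neg, neg_sub, ← Units.val_neg] at h1
  · exact ⟨_, hv e (-1) (by omega), ((isWt_bot hn).unit_smul e).add_delta hn s⟩

theorem not_isImag_of_isWt {n : ℕ} {α : Q n} {p q : ℤ} (hp : p ≠ 0 ∧ -(n : ℤ) ≤ p ∧ p ≤ n)
    (h : IsWt n α p q) (hpq : p ≠ -q) : ¬ IsImag n α := fun him => by
  rcases (by omega : 1 ≤ p ∨ p ≤ -1) with h3 | h3
  · have h1 := h p (by omega)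
    rw [him p (by omega)] at h1
    unfold eps at h1
    omega
  · have h1 := h (-p) (by omega)
    rw [him (-p) (by omega)] at h1
    unfold eps at h1
    omega

/-! ### The elements `f_{p,q}^{r,s}` as images of homogeneous elements -/

/-- The element `f_{p,q}^{r,s}` is the image of a homogeneous element of the degree that
corresponds to it. -/
def Lifts {n : ℕ} (hn : 4 ≤ n) (p q r : ℤ) (s : ℕ) : Prop :=
  ∃ α, ∃ x ∈ piece n α s, IsWt n α p (-q) ∧ co n 0 α = r ∧ (piD hn x : Gl n) = f n p q r s

/-- The three inequalities suppress three of the four contractions in `lie_f`, and what survives is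
exactly `f_{p,q}`. -/
theorem Lifts.lie {n : ℕ} {hn : 4 ≤ n} {p j q r r' : ℤ} {s s' : ℕ}
    (hp : p ≠ 0 ∧ -(n : ℤ) ≤ p ∧ p ≤ n) (hj : j ≠ 0 ∧ -(n : ℤ) ≤ j ∧ j ≤ n)
    (hq : q ≠ 0 ∧ -(n : ℤ) ≤ q ∧ q ≤ n) (h : Lifts hn p j r s) (h' : Lifts hn j q r' s')
    (h1 : p ≠ q) (h2 : j ≠ -p) (h3 : q ≠ -j) : Lifts hn p q (r + r') (s + s') := by
  obtain ⟨α, x, hx, hw, hr, hf⟩ := h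
  obtain ⟨α', x', hx', hw', hr', hf'⟩ := h'
  refine ⟨α + α', ⁅x, x'⁆, lie_mem_piece hx hx', hw.add hw', by rw [map_add, hr, hr'], ?_⟩
  rw [LieHom.map_lie, LieSubalgebra.coe_bracket, hf, hf', lie_f n p j j q r r' s s' hp hj hj hq,
    if_pos rfl, if_neg (Ne.symm h1), if_neg h2, if_neg h3]
  simp

theorem Lifts.of_smul {n : ℕ} {hn : 4 ≤ n} {p q r : ℤ} {s : ℕ} {α : Q n} {x : D n} (e : ℤˣ)
    (hx : x ∈ piece n α s) (hw : IsWt n α p (-q)) (hr : co n 0 α = r)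
    (hf : (piD hn x : Gl n) = (e : ℤ) • f n p q r s) : Lifts hn p q r s := by
  refine ⟨α, ((e : ℤ) : ℂ) • x, Submodule.smul_mem _ _ hx, hw, hr, ?_⟩
  rw [map_smul]
  change ((e : ℤ) : ℂ) • (piD hn x : Gl n) = _
  rw [hf, Int.cast_smul_eq_zsmul, smul_smul,
    ← Units.val_mul, Int.units_mul_self, Units.val_one, one_smul]

theorem Lifts.flip {n : ℕ} {hn : 4 ≤ n} {p q r : ℤ} {s : ℕ} (h : Lifts hn p q r s) :
    Lifts hn (-q) (-p) r s := by
  obtain ⟨α, x, hx, hw, hr, hf⟩ := h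
  refine Lifts.of_smul (-(-1) ^ s) hx (by rw [neg_neg]; exact hw.swap) hr ?_
  rw [hf, f_flip]
  rcases Nat.even_or_odd s with h | h <;> simp [h.neg_one_pow]

theorem Lifts.flip' {n : ℕ} {hn : 4 ≤ n} {p q p' q' r : ℤ} {s : ℕ} (h : Lifts hn p q r s)
    (hp : p' = -q) (hq : q' = -p) : Lifts hn p' q' r s := by
  rw [hp, hq]
  exact h.flip

theorem lifts_succ {n : ℕ} (hn : 4 ≤ n) {i : ℤ} (hi : 1 ≤ i ∧ i ≤ n - 1) (s : ℕ) :
    Lifts hn i (i + 1) 0 s := by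
  refine ⟨_, _, xD_mem_piece 1 i s, ?_, ?_, ?_⟩
  · rw [rt_of_mem (by omega), Units.val_one, one_smul]
    exact isWt_simple hn hi
  · rw [rt_of_mem (by omega), Units.val_one, one_smul, co_simple (by omega), if_neg (by omega)]
  · rw [xD, coe_piD_toD, phi_X_mid hi]

theorem lifts_pred {n : ℕ} (hn : 4 ≤ n) {i : ℤ} (hi : 1 ≤ i ∧ i ≤ n - 1) (s : ℕ) :
    Lifts hn (i + 1) i 0 s := by
  refine ⟨_, _, xD_mem_piece (-1) i s, ?_, ?_, ?_⟩
  · rw [rt_of_mem (by omega)]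
    convert ((isWt_simple hn hi).unit_smul (-1)).swap using 1 <;> simp
  · rw [rt_of_mem (by omega), map_zsmul, co_simple (by omega), if_neg (by omega), smul_zero]
  · rw [xD, coe_piD_toD, phi_X_mid' hi]

theorem lifts_last {n : ℕ} (hn : 4 ≤ n) (s : ℕ) : Lifts hn (n - 1) (-n) 0 s := by
  refine ⟨_, _, xD_mem_piece 1 n s, ?_, ?_, ?_⟩
  · rw [rt_of_mem (by omega), Units.val_one, one_smul, neg_neg]
    exact isWt_simple_last hn
  · rw [rt_of_mem (by omega), map_zsmul, co_simple (by omega), if_neg (by omega), smul_zero]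
  · rw [xD, coe_piD_toD, phi_X_last hn]

theorem lifts_last' {n : ℕ} (hn : 4 ≤ n) (s : ℕ) : Lifts hn (-n) (n - 1) 0 s := by
  refine ⟨_, _, xD_mem_piece (-1) n s, ?_, ?_, ?_⟩
  · rw [rt_of_mem (by omega)]
    convert ((isWt_simple_last hn).unit_smul (-1)).swap using 1 <;> simp
  · rw [rt_of_mem (by omega), map_zsmul, co_simple (by omega), if_neg (by omega), smul_zero]
  · rw [xD, coe_piD_toD, phi_X_last' hn]

theorem lifts_zero {n : ℕ} (hn : 4 ≤ n) (s : ℕ) : Lifts hn (-2) 1 1 s := by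
  refine Lifts.of_smul ((-1) ^ s) (xD_mem_piece 1 0 s) ?_ ?_ ?_
  · rw [rt_of_mem (by omega), Units.val_one, one_smul]
    exact isWt_simple_zero hn
  · rw [rt_of_mem (by omega), map_zsmul, co_simple (by omega), if_pos rfl]
    simp
  · rw [xD, coe_piD_toD, phi_X_zero]
    simp

theorem lifts_zero' {n : ℕ} (hn : 4 ≤ n) (s : ℕ) : Lifts hn 1 (-2) (-1) s := by
  refine Lifts.of_smul ((-1) ^ s) (xD_mem_piece (-1) 0 s) ?_ ?_ ?_
  · rw [rt_of_mem (by omega)]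
    convert ((isWt_simple_zero hn).unit_smul (-1)).swap using 1 <;> simp
  · rw [rt_of_mem (by omega), map_zsmul, co_simple (by omega), if_pos rfl]
    simp
  · rw [xD, coe_piD_toD, phi_X_zero']
    simp

/-- Chains of simple root vectors give all pairs of positive indices, and the flip gives the
negative pairs. A single crossing by `f_{n-1,-n}` or `f_{-n,n-1}` gives the mixed ones. The power
`v^s` can be carried by one factor alone. -/
theorem lifts_r_zero {n : ℕ} (hn : 4 ≤ n) {p q : ℤ} (hp : p ≠ 0 ∧ -(n : ℤ) ≤ p ∧ p ≤ n)
    (hq : q ≠ 0 ∧ -(n : ℤ) ≤ q ∧ q ≤ n) (hpq : p ≠ q) (s : ℕ) : Lifts hn p q 0 s := by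
  have comp {p j q : ℤ} (hp : p ≠ 0 ∧ -(n : ℤ) ≤ p ∧ p ≤ n) (hj : j ≠ 0 ∧ -(n : ℤ) ≤ j ∧ j ≤ n)
      (hq : q ≠ 0 ∧ -(n : ℤ) ≤ q ∧ q ≤ n) (h : ∀ s, Lifts hn p j 0 s) (h' : ∀ s, Lifts hn j q 0 s)
      (h1 : p ≠ q) (h2 : j ≠ -p) (h3 : q ≠ -j) (s : ℕ) : Lifts hn p q 0 s := by
    have h4 := Lifts.lie hp hj hq (h s) (h' 0) h1 h2 h3
    rwa [add_zero, add_zero] at h4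
  have up (m : ℕ) : ∀ i : ℤ, 1 ≤ i → i + m + 1 ≤ n →
      (∀ s, Lifts hn i (i + m + 1) 0 s) ∧ ∀ s, Lifts hn (i + m + 1) i 0 s := by
    induction m with
    | zero =>
      intro i hi hm
      rw [Nat.cast_zero, add_zero]
      exact ⟨lifts_succ hn (by omega), lifts_pred hn (by omega)⟩
    | succ m ih =>
      intro i hi hm
      obtain ⟨h1, h2⟩ := ih i hi (by omega)
      rw [Nat.cast_succ, ← add_assoc]
      rw [Nat.cast_succ] at hm
      exact ⟨comp (by omega) (by omega) (by omega) h1 (lifts_succ hn (by omega)) (by omega)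
        (by omega) (by omega), comp (by omega) (by omega) (by omega) (lifts_pred hn (by omega)) h2
        (by omega) (by omega) (by omega)⟩
  have pos {p q : ℤ} (hp : 1 ≤ p ∧ p ≤ n) (hq : 1 ≤ q ∧ q ≤ n) (hpq : p ≠ q) (s : ℕ) :
      Lifts hn p q 0 s := by
    rcases lt_or_gt_of_ne hpq with h | h
    · have h1 := (up (q - p - 1).toNat p hp.1 (by omega)).1 s
      rwa [show p + ((q - p - 1).toNat : ℤ) + 1 = q by omega] at h1
    · have h1 := (up (p - q - 1).toNat q hq.1 (by omega)).2 s
      rwa [show q + ((p - q - 1).toNat : ℤ) + 1 = p by omega] at h1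
  have last {p : ℤ} (hp : 1 ≤ p ∧ p ≤ n - 1) : (∀ s, Lifts hn p (-n) 0 s) ∧
      ∀ s, Lifts hn (-n) p 0 s := by
    by_cases h : p = n - 1
    · rw [h]
      exact ⟨lifts_last hn, lifts_last' hn⟩
    · exact ⟨comp (by omega) (by omega) (by omega) (pos (by omega) (by omega) h) (lifts_last hn)
        (by omega) (by omega) (by omega), comp (by omega) (by omega) (by omega) (lifts_last' hn)
        (pos (by omega) (by omega) (Ne.symm h)) (by omega) (by omega) (by omega)⟩
  have neg {p q : ℤ} (hp : 1 ≤ p ∧ p ≤ n) (hq : 1 ≤ q ∧ q ≤ n) (hpq : p ≠ q) (s : ℕ) :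
      Lifts hn (-p) (-q) 0 s := (pos hq hp (Ne.symm hpq) s).flip
  have mixed {p q : ℤ} (hp : 1 ≤ p ∧ p ≤ n) (hq : 1 ≤ q ∧ q ≤ n) (hpq : p ≠ n ∨ q ≠ n) :
      (∀ s, Lifts hn p (-q) 0 s) ∧ ∀ s, Lifts hn (-q) p 0 s := by
    by_cases h : p = n
    · subst h
      have h1 := last (p := q) (by omega)
      exact ⟨fun s => (h1.1 s).flip' (by omega) rfl, fun s => (h1.2 s).flip' rfl (by omega)⟩
    · have h1 := last (p := p) (by omega)
      by_cases h' : q = n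
      · rw [h']
        exact h1
      · exact ⟨comp (by omega) (by omega) (by omega) h1.1 (neg (by omega) hq (Ne.symm h'))
          (by omega) (by omega) (by omega), comp (by omega) (by omega) (by omega)
          (neg hq (by omega) h') h1.2 (by omega) (by omega) (by omega)⟩
  -- `f_{n,-n}` cannot be reached through the index `-n` like the other mixed pairs; it passes
  -- through `-1` instead.
  have nn : (∀ s, Lifts hn n (-n) 0 s) ∧ ∀ s, Lifts hn (-n) n 0 s := by
    have h1 := mixed (p := n) (q := 1) (by omega) (by omega) (by omega)
    have h2 (s) := neg (p := 1) (q := n) (by omega) (by omega) (by omega) s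
    have h3 (s) := neg (p := n) (q := 1) (by omega) (by omega) (by omega) s
    exact ⟨comp (by omega) (by omega) (by omega) h1.1 h2 (by omega) (by omega) (by omega),
      comp (by omega) (by omega) (by omega) h3 h1.2 (by omega) (by omega) (by omega)⟩
  rcases (by omega : 1 ≤ p ∨ p ≤ -1) with h1 | h1 <;>
  rcases (by omega : 1 ≤ q ∨ q ≤ -1) with h2 | h2
  · exact pos (by omega) (by omega) hpq s
  · by_cases h3 : p = n ∧ q = -n
    · rw [h3.1, h3.2]
      exact nn.1 s
    · have h4 := (mixed (p := p) (q := -q) (by omega) (by omega) (by omega)).1 s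
      rwa [neg_neg] at h4
  · by_cases h3 : p = -n ∧ q = n
    · rw [h3.1, h3.2]
      exact nn.2 s
    · have h4 := (mixed (p := q) (q := -p) (by omega) (by omega) (by omega)).2 s
      rwa [neg_neg] at h4
  · have h4 := neg (p := -p) (q := -q) (by omega) (by omega) (by omega) s
    rwa [neg_neg, neg_neg] at h4

/-- At most three absolute values are excluded, and `4 ≤ n` leaves one of `1, 2, 3, 4`. -/
theorem exists_third {n : ℕ} (hn : 4 ≤ n) (a b c : ℤ) :
    ∃ m : ℤ, 1 ≤ m ∧ m ≤ n ∧ m ≠ a ∧ m ≠ -a ∧ m ≠ b ∧ m ≠ -b ∧ m ≠ c ∧ m ≠ -c := by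
  by_contra hc
  push Not at hc
  have h1 := hc 1
  have h2 := hc 2
  have h3 := hc 3
  have h4 := hc 4
  omega

/-- A bracket with an `f_{p',p}` of `u`-degree `0` replaces the left index. The detour through a
generic `m` avoids the coincidences `p' = ±p`, where other contractions would appear. -/
theorem Lifts.left {n : ℕ} {hn : 4 ≤ n} {p q r : ℤ} (hp : p ≠ 0 ∧ -(n : ℤ) ≤ p ∧ p ≤ n)
    (hq : q ≠ 0 ∧ -(n : ℤ) ≤ q ∧ q ≤ n) (h2 : p ≠ -q) (h : ∀ s, Lifts hn p q r s)
    {p' : ℤ} (hp' : p' ≠ 0 ∧ -(n : ℤ) ≤ p' ∧ p' ≤ n) (h3 : p' ≠ q) (s : ℕ) :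
    Lifts hn p' q r s := by
  obtain ⟨m, hm⟩ := exists_third hn p q p'
  have step {p p' : ℤ} (hp : p ≠ 0 ∧ -(n : ℤ) ≤ p ∧ p ≤ n)
      (hp' : p' ≠ 0 ∧ -(n : ℤ) ≤ p' ∧ p' ≤ n) (h2 : q ≠ -p) (h3 : p' ≠ q) (h4 : p' ≠ p)
      (h5 : p ≠ -p') (h : ∀ s, Lifts hn p q r s) (s : ℕ) : Lifts hn p' q r s := by
    have h6 := Lifts.lie hp' hp hq (lifts_r_zero hn hp' hp h4 0) (h s) h3 h5 h2
    rwa [zero_add, zero_add] at h6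
  exact step (p := m) (by omega) hp' (by omega) h3 (by omega) (by omega)
    (step hp (by omega) (by omega) (by omega) (by omega) (by omega) h) s

theorem Lifts.right {n : ℕ} {hn : 4 ≤ n} {p q r : ℤ} (hp : p ≠ 0 ∧ -(n : ℤ) ≤ p ∧ p ≤ n)
    (hq : q ≠ 0 ∧ -(n : ℤ) ≤ q ∧ q ≤ n) (h2 : p ≠ -q) (h : ∀ s, Lifts hn p q r s)
    {q' : ℤ} (hq' : q' ≠ 0 ∧ -(n : ℤ) ≤ q' ∧ q' ≤ n) (h3 : p ≠ q') (s : ℕ) :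
    Lifts hn p q' r s :=
  (Lifts.left (by omega) (by omega) (by omega) (fun s => (h s).flip) (p' := -q')
    (by omega) (by omega) s).flip' (neg_neg p).symm (neg_neg q').symm

/-- The left index is parked at a generic `m` while the right one is changed. So one non-degenerate
`f_{p,q}` of a given `u`-degree yields all of them. -/
theorem Lifts.move {n : ℕ} {hn : 4 ≤ n} {p q r : ℤ} (hp : p ≠ 0 ∧ -(n : ℤ) ≤ p ∧ p ≤ n)
    (hq : q ≠ 0 ∧ -(n : ℤ) ≤ q ∧ q ≤ n) (h2 : p ≠ -q) (h : ∀ s, Lifts hn p q r s)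
    {p' q' : ℤ} (hp' : p' ≠ 0 ∧ -(n : ℤ) ≤ p' ∧ p' ≤ n)
    (hq' : q' ≠ 0 ∧ -(n : ℤ) ≤ q' ∧ q' ≤ n) (h3 : p' ≠ q') (s : ℕ) : Lifts hn p' q' r s := by
  obtain ⟨m, hm⟩ := exists_third hn q q' q
  exact Lifts.left (p := m) (by omega) hq' (by omega)
    (Lifts.right (by omega) hq (by omega)
      (Lifts.left hp hq h2 h (by omega) (by omega)) hq' (by omega)) hp' h3 s

/-- The images of `X^±_{0,s}` have `u`-degree `±1`. Moved to position `(3, 2)` and bracketed with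
`f_{1,3}`, they change the `u`-degree by `±1`; the result is moved back to `(1, 3)`, and all `r` are
reached by induction. -/
theorem lifts {n : ℕ} (hn : 4 ≤ n) {p q : ℤ} (hp : p ≠ 0 ∧ -(n : ℤ) ≤ p ∧ p ≤ n)
    (hq : q ≠ 0 ∧ -(n : ℤ) ≤ q ∧ q ≤ n) (hpq : p ≠ q) (r : ℤ) (s : ℕ) : Lifts hn p q r s := by
  have step {r r' : ℤ} (h : ∀ s, Lifts hn 1 3 r s) (h' : ∀ s, Lifts hn 3 2 r' s) (s : ℕ) :
      Lifts hn 1 3 (r + r') s :=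
    Lifts.right (q := 2) (by omega) (by omega) (by omega)
      (fun s => by
        have h1 := Lifts.lie (by omega) (by omega) (by omega) (h s) (h' 0) (by omega) (by omega)
          (by omega)
        rwa [add_zero] at h1) (by omega) (by omega) s
  have h13 (s : ℕ) : Lifts hn 1 3 r s := by
    induction r using Int.induction_on generalizing s with
    | zero => exact lifts_r_zero hn (by omega) (by omega) (by omega) s
    | succ r ih =>
      exact step ih (Lifts.move (by omega) (by omega) (by omega) (lifts_zero hn)
        (by omega) (by omega) (by omega)) s
    | pred r ih =>
      exact step ih (Lifts.move (by omega) (by omega) (by omega) (lifts_zero' hn)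
        (by omega) (by omega) (by omega)) s
  exact Lifts.move (by omega) (by omega) (by omega) h13 hp hq hpq s

theorem f_ne_zero {n : ℕ} {p q : ℤ} (hp : p ≠ 0 ∧ -(n : ℤ) ≤ p ∧ p ≤ n)
    (hq : q ≠ 0 ∧ -(n : ℤ) ≤ q ∧ q ≤ n) {s : ℕ} (h : p ≠ -q ∨ Odd s) (r : ℤ) :
    f n p q r s ≠ 0 := by
  intro h0
  have h1 := congrFun (congrFun h0 ⟨p, mem_idx.2 hp⟩) ⟨q, mem_idx.2 hq⟩
  have hm : mono r s ≠ 0 := by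
    rw [mono, Ne, Polynomial.monomial_eq_zero_iff]
    exact (LaurentPolynomial.isUnit_T r).ne_zero
  simp only [f, E, Matrix.sub_apply, Matrix.smul_apply, Matrix.of_apply, and_self, if_true,
    Matrix.zero_apply] at h1
  by_cases hpq : p = -q
  · have hs := h.resolve_left (not_not.2 hpq)
    rw [if_pos (by omega), hs.neg_one_pow, neg_smul, one_smul, sub_neg_eq_add,
      ← two_smul ℂ, smul_eq_zero] at h1
    exact h1.elim two_ne_zero hm
  · rw [if_neg (by omega), smul_zero, sub_zero] at h1
    exact hm h1

/-- The weight and the coefficient of `α_0` determine the degree, so the lift of a non-zero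
`f_{p,-q}` lies in the piece in question. This is the lower bound for the dimension. -/
theorem exists_mem_piece {n : ℕ} (hn : 4 ≤ n) {p q : ℤ} (hp : p ≠ 0 ∧ -(n : ℤ) ≤ p ∧ p ≤ n)
    (hq : q ≠ 0 ∧ -(n : ℤ) ≤ q ∧ q ≤ n) {s : ℕ} (h1 : p ≠ -q) (h2 : p ≠ q ∨ Odd s) {α : Q n}
    (h : IsWt n α p q) : ∃ x ∈ piece n α s, piD hn x ≠ 0 := by
  obtain ⟨β, x, hx, hw, hr, hf⟩ := lifts hn hp (q := -q) (by omega) h1 (co n 0 α) s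
  have hα : α = β := by
    refine ext_ep hn (fun l hl => ?_) hr.symm
    rw [h l hl, hw l hl, neg_neg]
  subst hα
  refine ⟨x, hx, fun h0 => f_ne_zero hp (q := -q) (by omega) (s := s) ?_ (co n 0 α) ?_⟩
  · rw [neg_neg]
    exact h2
  · rw [← hf, h0]
    rfl

/-! ### Dimensions -/

/-- A non-zero piece is conjugate to the piece of a generator, and that is spanned by the generator.
-/
theorem rank_piece_le_one {n : ℕ} (hn : 4 ≤ n) {α : Q n} (him : ¬ IsImag n α) (k : ℕ) :
    Module.rank ℂ (piece n α k) ≤ 1 := by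
  by_cases h : piece n α k = ⊥
  · rw [h, rank_bot]
    exact zero_le_one
  · obtain ⟨γ, h1, e, h2⟩ := exists_conj_gen hn him h
    have key : ∃ x, piece n γ k ≤ Submodule.span ℂ {x} := by
      rcases h2 with ⟨i, hi, rfl⟩ | rfl | rfl
      · refine ⟨xD n e i k, (piece_zsmul_simple hn hi e.ne_zero k).trans (Submodule.span_mono ?_)⟩
        rintro x ⟨e', he, rfl⟩
        rw [Units.ext he]
        rfl
      · exact ⟨_, piece_rt_top hn e k⟩
      · exact ⟨_, piece_rt_bot hn e k⟩
    obtain ⟨x, hx⟩ := key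
    rw [h1.rank_eq hn k]
    refine (Submodule.rank_mono hx).trans ((rank_span_le _).trans ?_)
    rw [Cardinal.mk_singleton]

/-- The generator to which the degree is conjugate has a weight of this form, and `Conj.isWt`
transports it back. The case `p = q` comes only from `X_{n+1,k}` and `X_{-1,k}`, which vanish for
even `k`. -/
theorem exists_isWt_of_piece_ne_bot {n : ℕ} (hn : 4 ≤ n) {α : Q n} (him : ¬ IsImag n α) {k : ℕ}
    (h : piece n α k ≠ ⊥) : ∃ p q : ℤ, (p ≠ 0 ∧ -(n : ℤ) ≤ p ∧ p ≤ n) ∧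
      (q ≠ 0 ∧ -(n : ℤ) ≤ q ∧ q ≤ n) ∧ p ≠ -q ∧ (p ≠ q ∨ Odd k) ∧ IsWt n α p q := by
  obtain ⟨γ, h1, e, h2⟩ := exists_conj_gen hn him h
  have hγ : piece n γ k ≠ ⊥ := by
    intro h0
    have h3 := h1.rank_eq hn k
    rw [h0, rank_bot] at h3
    exact h (Submodule.rank_eq_zero.1 h3)
  have hv (e : ℤˣ) (i : ℤ) (hi : i ≠ 0 ∧ -(n : ℤ) ≤ i ∧ i ≤ n) :
      (e : ℤ) * i ≠ 0 ∧ -(n : ℤ) ≤ e * i ∧ e * i ≤ n := by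
    rcases Int.units_eq_one_or e with rfl | rfl <;> simp <;> omega
  have key (p q : ℤ) (hp : p ≠ 0 ∧ -(n : ℤ) ≤ p ∧ p ≤ n) (hq : q ≠ 0 ∧ -(n : ℤ) ≤ q ∧ q ≤ n)
      (h3 : p ≠ -q) (h4 : p ≠ q ∨ Odd k) (β : Q n) (hw : IsWt n β p q) (hβ : γ = (e : ℤ) • β) :
      ∃ p q : ℤ, (p ≠ 0 ∧ -(n : ℤ) ≤ p ∧ p ≤ n) ∧
      (q ≠ 0 ∧ -(n : ℤ) ≤ q ∧ q ≤ n) ∧ p ≠ -q ∧ (p ≠ q ∨ Odd k) ∧ IsWt n α p q := by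
    subst hβ
    obtain ⟨p', q', hp', hq', hw', h5, h6⟩ := h1.symm.isWt hn (hv e p hp) (hv e q hq)
      (hw.unit_smul e)
    rw [← mul_neg] at h6
    have h7 : ∀ i j : ℤ, (e : ℤ) * i = e * j → i = j := fun i j => mul_left_cancel₀ e.ne_zero
    exact ⟨p', q', hp', hq', fun h => h3 (h7 _ _ (h6.1 h)),
      h4.imp_left fun h h' => h (h7 _ _ (h5.1 h')), hw'⟩
  rcases h2 with ⟨i, hi, h2⟩ | h2 | h2
  · rcases (by omega : i = 0 ∨ (1 ≤ i ∧ i ≤ (n : ℤ) - 1) ∨ i = n) with rfl | h | rfl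
    · exact key (-2) (-1) (by omega) (by omega) (by omega) (Or.inl (by omega)) _
        (isWt_simple_zero hn) h2
    · exact key i (-(i + 1)) (by omega) (by omega) (by omega) (Or.inl (by omega)) _
        (isWt_simple hn h) h2
    · exact key (n - 1) n (by omega) (by omega) (by omega) (Or.inl (by omega)) _
        (isWt_simple_last hn) h2
  · refine key n n (by omega) (by omega) (by omega) (Or.inr ?_) _
      (by rw [rt_top]; exact isWt_top hn) h2
    by_contra hk
    refine hγ (eq_bot_iff.2 ?_)
    have h3 := piece_rt_top hn e k
    rwa [xD_top_even n e hk, Submodule.span_zero_singleton, ← h2] at h3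
  · refine key (-1) (-1) (by omega) (by omega) (by omega) (Or.inr ?_) _
      (by rw [rt_bot]; exact isWt_bot hn) h2
    by_contra hk
    refine hγ (eq_bot_iff.2 ?_)
    have h3 := piece_rt_bot hn e k
    rwa [xD_bot_even n e hk, Submodule.span_zero_singleton, ← h2] at h3

theorem rank_piece_eq_one {n : ℕ} (hn : 4 ≤ n) {p q : ℤ} (hp : p ≠ 0 ∧ -(n : ℤ) ≤ p ∧ p ≤ n)
    (hq : q ≠ 0 ∧ -(n : ℤ) ≤ q ∧ q ≤ n) {k : ℕ} (h1 : p ≠ -q) (h2 : p ≠ q ∨ Odd k) {α : Q n}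
    (h : IsWt n α p q) : Module.rank ℂ (piece n α k) = 1 := by
  refine le_antisymm (rank_piece_le_one hn (not_isImag_of_isWt hp h h1) k) ?_
  obtain ⟨x, hx, hx0⟩ := exists_mem_piece hn hp hq h1 h2 h
  rw [Cardinal.one_le_iff_ne_zero]
  intro h0
  rw [Submodule.rank_eq_zero] at h0
  rw [h0, Submodule.mem_bot] at hx
  exact hx0 (by rw [hx, map_zero])

theorem piece_eq_bot_of_not_mem_extRoots {n : ℕ} (hn : 4 ≤ n) {α : Q n} (h : α ∉ extRoots n)
    (h0 : α ≠ 0) (k : ℕ) : piece n α k = ⊥ := by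
  have him : ¬ IsImag n α := fun him => h <| Or.inl <| Or.inr ⟨co n 0 α, fun h1 => h0 (by
    rw [him.eq_smul_delta hn, h1, zero_smul]), him.eq_smul_delta hn⟩
  by_contra hk
  obtain ⟨p, q, hp, hq, h1, -, hw⟩ := exists_isWt_of_piece_ne_bot hn him hk
  by_cases hpq : p = q
  · subst hpq
    exact h (mem_extRoots_of_isWt hn hp hw)
  · exact h (Or.inl (mem_roots_of_isWt hn hp hq hpq h1 hw))

theorem piece_eq_bot_of_even {n : ℕ} (hn : 4 ≤ n) {α : Q n} (him : ¬ IsImag n α)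
    (h : α ∉ roots n) {k : ℕ} (hk : Even k) : piece n α k = ⊥ := by
  by_contra hb
  obtain ⟨p, q, hp, hq, h1, h2, hw⟩ := exists_isWt_of_piece_ne_bot hn him hb
  exact h (mem_roots_of_isWt hn hp hq (h2.resolve_right (Nat.not_odd_iff_even.2 hk)) h1 hw)

/-- The map `π` is injective on the pieces whose weight is not a multiple of `δ`. -/
theorem eq_zero_of_piD_eq_zero {n : ℕ} (hn : 4 ≤ n) {α : Q n} (him : ¬ IsImag n α) {k : ℕ}
    {x : D n} (hx : x ∈ piece n α k) (h : piD hn x = 0) : x = 0 := by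
  by_contra hx0
  have hb : piece n α k ≠ ⊥ := fun hb => by
    rw [hb, Submodule.mem_bot] at hx
    exact hx0 hx
  obtain ⟨p, q, hp, hq, h1, h2, hw⟩ := exists_isWt_of_piece_ne_bot hn him hb
  obtain ⟨y, hy, hy0⟩ := exists_mem_piece hn hp hq h1 h2 hw
  obtain ⟨v, -, hv⟩ := (rank_submodule_le_one_iff _).1 (rank_piece_le_one hn him k)
  obtain ⟨c, hc⟩ := Submodule.mem_span_singleton.1 (hv hx)
  obtain ⟨c', hc'⟩ := Submodule.mem_span_singleton.1 (hv hy)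
  have hc0 : c ≠ 0 := by
    rintro rfl
    exact hx0 (by rw [← hc, zero_smul])
  rw [← hc, map_smul, smul_eq_zero] at h
  exact hy0 (by rw [← hc', map_smul, h.resolve_left hc0, smul_zero])

/-! ### The grading of the matrices by weights -/

/-- The possible entries in position `(p, q)` of a matrix of degree `(α, k)`. -/
def wtEntry (n : ℕ) (α : Q n) (k : ℕ) (p q : ℤ) : Submodule ℂ Coeff :=
  Submodule.span ℂ {c | c = mono (co n 0 α) k ∧ IsWt n α p (-q)}

/-- The matrices of degree `(α, k)`. -/
def wtMat (n : ℕ) (α : Q n) (k : ℕ) : Submodule ℂ (Gl n) where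
  carrier := {M | ∀ p q : Idx n, M p q ∈ wtEntry n α k p.1 q.1}
  zero_mem' _ _ := zero_mem _
  add_mem' hA hB p q := add_mem (hA p q) (hB p q)
  smul_mem' c _ hA p q := Submodule.smul_mem _ c (hA p q)

/-- The position `(p, q)` has weight `ε_p - ε_q`; in a matrix product the contributions of the
middle index cancel. -/
theorem mul_mem_wtEntry {n : ℕ} {α β : Q n} {k l : ℕ} {p j q : ℤ} {x y : Coeff}
    (hx : x ∈ wtEntry n α k p j) (hy : y ∈ wtEntry n β l j q) :
    x * y ∈ wtEntry n (α + β) (k + l) p q := by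
  have h := Submodule.mul_mem_mul hx hy
  rw [wtEntry, wtEntry, Submodule.span_mul_span] at h
  refine Submodule.span_mono ?_ h
  rintro _ ⟨x, ⟨rfl, hx⟩, y, ⟨rfl, hy⟩, rfl⟩
  refine ⟨?_, hx.add hy⟩
  change mono _ _ * mono _ _ = _
  rw [mono_mul, map_add]

theorem mul_mem_wtMat {n : ℕ} {α β : Q n} {k l : ℕ} {A B : Gl n} (hA : A ∈ wtMat n α k)
    (hB : B ∈ wtMat n β l) : A * B ∈ wtMat n (α + β) (k + l) := fun p q => by
  rw [Matrix.mul_apply]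
  exact sum_mem fun j _ => mul_mem_wtEntry (hA p j) (hB j q)

theorem lie_mem_wtMat {n : ℕ} {α β : Q n} {k l : ℕ} {A B : Gl n} (hA : A ∈ wtMat n α k)
    (hB : B ∈ wtMat n β l) : ⁅A, B⁆ ∈ wtMat n (α + β) (k + l) := by
  have h := mul_mem_wtMat hB hA
  rw [add_comm β, add_comm l] at h
  rw [LieRing.of_associative_ring_bracket]
  exact sub_mem (mul_mem_wtMat hA hB) h

theorem E_mem_wtMat {n : ℕ} {α : Q n} {p q r : ℤ} (s : ℕ) (h : IsWt n α p (-q))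
    (hr : co n 0 α = r) : E n p q r s ∈ wtMat n α s := fun i j => by
  rw [E, Matrix.of_apply]
  split_ifs with hij
  · rw [hij.1, hij.2]
    exact Submodule.subset_span ⟨by rw [hr], h⟩
  · exact zero_mem _

theorem smul_int_mem_wtMat {n : ℕ} {α : Q n} {k : ℕ} {M : Gl n} (hM : M ∈ wtMat n α k) (c : ℤ) :
    c • M ∈ wtMat n α k :=
  zsmul_mem (S := AddSubgroup (Gl n)) (K := (wtMat n α k).toAddSubgroup) hM c

theorem f_mem_wtMat {n : ℕ} {α : Q n} {p q r : ℤ} (s : ℕ) (h : IsWt n α p (-q))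
    (hr : co n 0 α = r) : f n p q r s ∈ wtMat n α s :=
  sub_mem (E_mem_wtMat s h hr) (smul_int_mem_wtMat
    (E_mem_wtMat s (by rw [neg_neg]; exact h.swap) hr) _)

theorem f_mem_wtMat_unit {n : ℕ} {α : Q n} {p q r : ℤ} (s : ℕ) (e : ℤˣ) (h : IsWt n α p q)
    (hr : co n 0 α = r) {p' q' : ℤ} (hp : p' = e * p) (hq : q' = -(e * q)) :
    f n p' q' (e * r) s ∈ wtMat n ((e : ℤ) • α) s := by
  refine f_mem_wtMat s ?_ ?_
  · rw [hp, hq, neg_neg]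
    exact h.unit_smul e
  · rw [map_zsmul, hr, smul_eq_mul]

theorem isWt_zero (n : ℕ) (p : ℤ) : IsWt n 0 p (-p) := fun l _ => by
  rw [map_zero, eps_neg]
  ring

theorem f_mem_wtMat_flip {n : ℕ} {α : Q n} {p q r : ℤ} {s : ℕ} (h : f n (-q) (-p) r s ∈ wtMat n α s) :
    f n p q r s ∈ wtMat n α s := by
  have h1 := f_flip n (-q) (-p) r s
  rw [neg_neg, neg_neg] at h1
  rw [h1]
  exact neg_mem (smul_int_mem_wtMat h _)

theorem phi_X_mem_wtMat {n : ℕ} (hn : 4 ≤ n) (e : ℤˣ) (i : ℤ) (r : ℕ) (h : IsGen n (.X e i r)) :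
    phi n (X n e i r) ∈ wtMat n ((e : ℤ) • rt n i) r := by
  rcases h with h | ⟨rfl | rfl, h⟩
  · rw [rt_of_mem h]
    rcases (by omega : i = 0 ∨ (1 ≤ i ∧ i ≤ (n : ℤ) - 1) ∨ i = n) with rfl | h | rfl
    · have h1 : co n 0 (simple n 0) = 1 := by rw [co_simple (by omega), if_pos rfl]
      have h2 := f_mem_wtMat_unit r e (isWt_simple_zero hn) h1 rfl rfl
      have h3 := f_mem_wtMat_unit r e (isWt_simple_zero hn).swap h1 rfl rfl
      rcases Int.units_eq_one_or e with rfl | rfl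
      · rw [phi_X_zero]
        exact smul_int_mem_wtMat h2 _
      · rw [phi_X_zero']
        exact smul_int_mem_wtMat h3 _
    · have h1 : co n 0 (simple n i) = 0 := by rw [co_simple (by omega), if_neg (by omega)]
      have h2 := f_mem_wtMat_unit r e (isWt_simple hn h) h1 (p' := e * i) (q' := e * (i + 1)) rfl
        (by ring)
      rw [mul_zero] at h2
      rcases Int.units_eq_one_or e with rfl | rfl
      · rw [phi_X_mid h]
        simpa only [Units.val_one, one_mul] using h2
      · rw [phi_X_mid' h]
        refine f_mem_wtMat_flip ?_
        simpa only [Units.val_neg, Units.val_one, neg_mul, one_mul] using h2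
    · have h1 : co n 0 (simple n n) = 0 := by rw [co_simple (by omega), if_neg (by omega)]
      have h2 := f_mem_wtMat_unit r e (isWt_simple_last hn) h1 rfl rfl
      have h3 := f_mem_wtMat_unit r e (isWt_simple_last hn).swap h1 rfl rfl
      rw [mul_zero] at h2 h3
      rcases Int.units_eq_one_or e with rfl | rfl
      · rw [phi_X_last hn]
        simpa only [Units.val_one, one_mul] using h2
      · rw [phi_X_last' hn]
        simpa only [Units.val_neg, Units.val_one, neg_mul, one_mul, neg_neg] using h3
  · have h1 : co n 0 (rt n (-1)) = 1 := by
      rw [rt_bot, map_sub, co_simple (by omega), co_simple (by omega), if_pos rfl,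
        if_neg (by omega), sub_zero]
    have h2 := f_mem_wtMat_unit r e (by rw [rt_bot]; exact isWt_bot hn) h1 rfl rfl
    rcases Int.units_eq_one_or e with rfl | rfl
    · rw [phi_X_bot n h]
      exact h2
    · rw [phi_X_bot' n h]
      exact h2
  · have h1 : co n 0 (rt n (n + 1)) = 0 := by
      rw [rt_top, map_sub, co_simple (by omega), co_simple (by omega), if_neg (by omega),
        if_neg (by omega), sub_zero]
    have h2 := f_mem_wtMat_unit r e (by rw [rt_top]; exact isWt_top hn) h1 rfl rfl
    rw [mul_zero] at h2
    rcases Int.units_eq_one_or e with rfl | rfl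
    · rw [phi_X_top n h]
      simpa only [Units.val_one, one_mul] using h2
    · rw [phi_X_top' n h]
      simpa only [Units.val_neg, Units.val_one, neg_mul, one_mul, neg_neg] using h2

/-- The map `π` as a linear map to the matrices. -/
def piLin {n : ℕ} (hn : 4 ≤ n) : D n →ₗ[ℂ] Gl n :=
  ((slTau n).incl : slTau n →ₗ[ℂ] Gl n) ∘ₗ (piD hn : D n →ₗ[ℂ] slTau n)

theorem piLin_apply {n : ℕ} (hn : 4 ≤ n) (x : D n) : piLin hn x = (piD hn x : Gl n) := rfl

theorem piD_gen_mem_wtMat {n : ℕ} (hn : 4 ≤ n) (g : Gen n) :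
    (piD hn (toD n (FreeLieAlgebra.of ℂ g)) : Gl n) ∈ wtMat n (deg n g.1).1 (deg n g.1).2 := by
  rw [coe_piD_toD]
  obtain ⟨g, hg⟩ := g
  cases g with
  | H i r =>
    have h1 : phi n (FreeLieAlgebra.of ℂ ⟨.H i r, hg⟩) = phi n (H n i r) := by
      rw [H, sym, dif_pos hg]
    rw [h1]
    obtain ⟨k, l, a, b, -, -, h⟩ := phi_H_mem hn i r
    rw [h]
    exact add_mem (smul_int_mem_wtMat (f_mem_wtMat r (isWt_zero n k) (map_zero _)) _)
      (smul_int_mem_wtMat (f_mem_wtMat r (isWt_zero n l) (map_zero _)) _)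
  | X e i r =>
    have h1 : phi n (FreeLieAlgebra.of ℂ ⟨.X e i r, hg⟩) = phi n (X n e i r) := by
      rw [X, sym, dif_pos hg]
    rw [h1]
    exact phi_X_mem_wtMat hn e i r hg

theorem piD_monomial_mem_wtMat {n : ℕ} (hn : 4 ≤ n) {x : D n} {d : Q n × ℕ}
    (h : IsMonomial n x d) : (piD hn x : Gl n) ∈ wtMat n d.1 d.2 := by
  induction h with
  | gen g => exact piD_gen_mem_wtMat hn g
  | lie _ _ hx hy =>
    rw [LieHom.map_lie, LieSubalgebra.coe_bracket]
    exact lie_mem_wtMat hx hy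

theorem piD_mem_wtMat {n : ℕ} (hn : 4 ≤ n) {α : Q n} {k : ℕ} {x : D n} (hx : x ∈ piece n α k) :
    (piD hn x : Gl n) ∈ wtMat n α k := by
  rw [← piLin_apply]
  have hle : piece n α k ≤ (wtMat n α k).comap (piLin hn) := by
    rw [piece, Submodule.span_le]
    intro x hx
    rw [SetLike.mem_coe, Submodule.mem_comap, piLin_apply]
    exact piD_monomial_mem_wtMat (d := (α, k)) hn hx
  exact Submodule.mem_comap.1 (hle hx)

/-- The coefficient of `u^r v^s`. -/
def monoCoeff (r : ℤ) (s : ℕ) : Coeff →+ ℂ where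
  toFun x := (Polynomial.coeff x s).coeff r
  map_zero' := rfl
  map_add' x y := by
    rw [Polynomial.coeff_add]
    rfl

theorem monoCoeff_smul (r : ℤ) (s : ℕ) (c : ℂ) (x : Coeff) :
    monoCoeff r s (c • x) = c * monoCoeff r s x := by
  change (Polynomial.coeff (c • x) s).coeff r = c * (Polynomial.coeff x s).coeff r
  rw [Polynomial.coeff_smul]
  rfl

theorem monoCoeff_mono (r r' : ℤ) (s s' : ℕ) :
    monoCoeff r s (mono r' s') = if r' = r ∧ s' = s then 1 else 0 := by
  change (Polynomial.coeff (Polynomial.monomial s' (LaurentPolynomial.T r')) s).coeff r = _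
  rw [Polynomial.coeff_monomial]
  by_cases h : s' = s
  · simp [h]
  · simp [h]

/-- The position fixes the `ε`-coordinates, the exponent of `u` the coefficient of `α_0`, and the
exponent of `v` the second degree. One coefficient of one entry thus sees a single degree. -/
theorem monoCoeff_eq_zero {n : ℕ} (hn : 4 ≤ n) {α β : Q n} {k l : ℕ} {p q : ℤ}
    (h : IsWt n β p (-q)) (hd : (α, k) ≠ (β, l)) {x : Coeff} (hx : x ∈ wtEntry n α k p q) :
    monoCoeff (co n 0 β) l x = 0 := by
  induction hx using Submodule.span_induction with
  | mem x h' =>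
    obtain ⟨rfl, h'⟩ := h'
    rw [monoCoeff_mono, if_neg]
    rintro ⟨h1, rfl⟩
    refine hd (Prod.ext (ext_ep hn (fun l hl => ?_) h1) rfl)
    rw [h' l hl, h l hl]
  | zero => exact map_zero _
  | add x y _ _ hx hy => rw [map_add, hx, hy, add_zero]
  | smul c x _ hx => rw [monoCoeff_smul, hx, mul_zero]

theorem eq_zero_of_monoCoeff {n : ℕ} {α : Q n} {k : ℕ} {p q : ℤ} {x : Coeff}
    (hx : x ∈ wtEntry n α k p q)
    (h : IsWt n α p (-q) → monoCoeff (co n 0 α) k x = 0) : x = 0 := by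
  by_cases hw : IsWt n α p (-q)
  · have h1 : ∃ c : ℂ, x = c • mono (co n 0 α) k := by
      have h2 : x ∈ Submodule.span ℂ {mono (co n 0 α) k} :=
        Submodule.span_mono (fun _ hc => hc.1) hx
      obtain ⟨c, hc⟩ := Submodule.mem_span_singleton.1 h2
      exact ⟨c, hc.symm⟩
    obtain ⟨c, rfl⟩ := h1
    have h2 := h hw
    rw [monoCoeff_smul, monoCoeff_mono, if_pos ⟨rfl, rfl⟩, mul_one] at h2
    rw [h2, zero_smul]
  · have h2 : x ∈ Submodule.span ℂ (∅ : Set Coeff) :=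
      Submodule.span_mono (fun _ hc => hw hc.2) hx
    rwa [Submodule.span_empty, Submodule.mem_bot] at h2

/-! ### The kernel -/

/-- Since `π` is homogeneous, components of `x` in other degrees cannot contribute to this
coefficient. -/
theorem monoCoeff_piD_proj {n : ℕ} (hn : 4 ≤ n) {α : Q n} {k : ℕ} {p q : Idx n}
    (h : IsWt n α p.1 (-q.1)) (x : D n) : monoCoeff (co n 0 α) k ((piD hn x : Gl n) p q) =
      monoCoeff (co n 0 α) k ((piD hn (proj hn (α, k) x) : Gl n) p q) := by
  have hx : x ∈ ⨆ d : Q n × ℕ, piece n d.1 d.2 := by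
    rw [iSup_piece]
    trivial
  induction hx using Submodule.iSup_induction' with
  | mem d x hx =>
    rw [proj_piece hn hx]
    by_cases hd : (d.1, d.2) = (α, k)
    · rw [if_pos hd]
    · rw [if_neg hd, monoCoeff_eq_zero hn h hd (piD_mem_wtMat hn hx p q), map_zero]
      exact (map_zero _).symm
  | zero => rw [map_zero (proj hn (α, k))]
  | add x y _ _ hx hy =>
    rw [map_add, map_add, map_add]
    exact (map_add _ _ _).trans ((congrArg₂ _ hx hy).trans (map_add _ _ _).symm)

/-- The kernel is a graded subspace: the coefficients that can be non-zero in the image of the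
component are already coefficients of the image of `x`. -/
theorem piD_proj_eq_zero {n : ℕ} (hn : 4 ≤ n) {x : D n} (h : piD hn x = 0) (d : Q n × ℕ) :
    piD hn (proj hn d x) = 0 := by
  refine Subtype.ext (Matrix.ext fun p q => ?_)
  refine eq_zero_of_monoCoeff (piD_mem_wtMat hn (proj_mem_piece hn d x) p q) fun hw => ?_
  rw [← monoCoeff_piD_proj hn hw, h]
  exact map_zero _

/-- Allowing every finite set that contains `s` makes the additive step work: the decompositions of
both summands hold over the union. -/
theorem exists_sum_proj {n : ℕ} (hn : 4 ≤ n) (x : D n) :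
    ∃ s : Finset (Q n × ℕ), ∀ t, s ⊆ t → x = ∑ d ∈ t, proj hn d x := by
  have hx : x ∈ ⨆ d : Q n × ℕ, piece n d.1 d.2 := by
    rw [iSup_piece]
    trivial
  classical
  induction hx using Submodule.iSup_induction' with
  | mem d x hx =>
    refine ⟨{d}, fun t ht => ?_⟩
    rw [Finset.sum_eq_single d]
    · rw [proj_piece hn hx, if_pos rfl]
    · intro d' _ hd
      rw [proj_piece hn hx, if_neg (Ne.symm hd)]
    · intro hd
      exact absurd (ht (Finset.mem_singleton_self d)) hd
  | zero => exact ⟨∅, fun t _ => by simp⟩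
  | add x y _ _ hx hy =>
    obtain ⟨s, hs⟩ := hx
    obtain ⟨s', hs'⟩ := hy
    refine ⟨s ∪ s', fun t ht => ?_⟩
    have h1 := hs t (Finset.union_subset_left ht)
    have h2 := hs' t (Finset.union_subset_right ht)
    simp only [map_add, Finset.sum_add_distrib]
    rw [← h1, ← h2]

theorem not_isImag_add {n : ℕ} (hn : 4 ≤ n) {α : Q n} (h : IsImag n α) (e : ℤˣ) {i : ℤ}
    (hi : 0 ≤ i ∧ i ≤ n) : ¬ IsImag n (α + (e : ℤ) • simple n i) := fun h' => by
  have h1 : IsImag n (simple n i) := fun l hl => by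
    have h2 := h' l hl
    rw [map_add, map_zsmul, h l hl, zero_add, smul_eq_mul] at h2
    exact (mul_eq_zero.1 h2).resolve_left e.ne_zero
  rcases (by omega : i = 0 ∨ (1 ≤ i ∧ i ≤ (n : ℤ) - 1) ∨ i = n) with rfl | h | rfl
  · exact not_isImag_of_isWt (by omega) (isWt_simple_zero hn) (by omega) h1
  · exact not_isImag_of_isWt (by omega) (isWt_simple hn h) (by omega) h1
  · exact not_isImag_of_isWt (by omega) (isWt_simple_last hn) (by omega) h1

/-- Components of `z` outside `ℤδ` vanish because `π` is injective there. For a component in `ℤδ`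
the bracket has degree `mδ ± α_i`, outside `ℤδ`, and lies in the kernel, so it vanishes as well. -/
theorem lie_xD_eq_zero_of_piD {n : ℕ} (hn : 4 ≤ n) {z : D n} (h : piD hn z = 0) (e : ℤˣ) {i : ℤ}
    (hi : 0 ≤ i ∧ i ≤ n) (r : ℕ) : ⁅z, xD n e i r⁆ = 0 := by
  obtain ⟨s, hs⟩ := exists_sum_proj hn z
  rw [hs s subset_rfl, sum_lie]
  refine Finset.sum_eq_zero fun d _ => ?_
  have h1 := piD_proj_eq_zero hn h d
  have h2 := proj_mem_piece hn d z
  by_cases him : IsImag n d.1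
  · have h3 := lie_mem_piece h2 (xD_mem_piece (n := n) e i r)
    rw [rt_of_mem hi] at h3
    refine eq_zero_of_piD_eq_zero hn (not_isImag_add hn him e hi) h3 ?_
    rw [LieHom.map_lie, h1, zero_lie]
  · rw [eq_zero_of_piD_eq_zero hn him h2 h1, zero_lie]

/-- The centralizer of a kernel element is a subalgebra that contains the generators `X^±_{i,r}`. -/
theorem ker_piD_le_center {n : ℕ} (hn : 4 ≤ n) :
    (piD hn).ker ≤ LieAlgebra.center ℂ (D n) := by
  intro z hz
  rw [LieHom.mem_ker] at hz
  rw [LieModule.mem_maxTrivSubmodule]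
  intro x
  rw [← lie_skew, neg_eq_zero]
  have hx : x ∈ LieSubalgebra.lieSpan ℂ (D n)
      {x | ∃ e i r, (0 ≤ i ∧ i ≤ (n : ℤ)) ∧ x = xD n e i r} := by
    rw [lieSpan_xD hn]
    trivial
  induction hx using LieSubalgebra.lieSpan_induction with
  | mem x h =>
    obtain ⟨e, i, r, hi, rfl⟩ := h
    exact lie_xD_eq_zero_of_piD hn hz e hi r
  | zero => exact lie_zero z
  | smul c x _ hx => rw [lie_smul, hx, smul_zero]
  | add x y _ _ hx hy => rw [lie_add, hx, hy, add_zero]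
  | lie x y _ _ hx hy => rw [leibniz_lie, hx, hy, zero_lie, lie_zero, add_zero]

/-! ### Surjectivity -/

theorem mem_of_mono_mem {S : Submodule ℂ Coeff} (h : ∀ r s, mono r s ∈ S) (x : Coeff) : x ∈ S := by
  induction x using Polynomial.induction_on' with
  | add x y hx hy => exact add_mem hx hy
  | monomial s a =>
    induction a using LaurentPolynomial.induction_on' with
    | add a b ha hb =>
      rw [map_add]
      exact add_mem ha hb
    | C_mul_T r c =>
      rw [← LaurentPolynomial.smul_eq_C_mul, ← Polynomial.smul_monomial]
      exact Submodule.smul_mem _ c (h r s)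

theorem map_mem_of_mono_mem {V : Type*} [AddCommGroup V] [Module ℂ V] (F : Coeff →ₗ[ℂ] V)
    {R : Submodule ℂ V} (h : ∀ r s, F (mono r s) ∈ R) (x : Coeff) : F x ∈ R :=
  mem_of_mono_mem (S := R.comap F) h x

theorem f_mem_range {n : ℕ} (hn : 4 ≤ n) {p q : ℤ} (hp : p ≠ 0 ∧ -(n : ℤ) ≤ p ∧ p ≤ n)
    (hq : q ≠ 0 ∧ -(n : ℤ) ≤ q ∧ q ≤ n) (hpq : p ≠ q) (r : ℤ) (s : ℕ) :
    f n p q r s ∈ LinearMap.range (piLin hn) := by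
  obtain ⟨α, x, -, -, -, h⟩ := lifts hn hp hq hpq r s
  exact ⟨x, h⟩

/-- For `p ≠ ±q` the difference is `[f_{p,q}, f_{q,p}]`. In general it is a sum of two such
differences through a third index, which also covers `q = -p`. -/
theorem f_sub_f_mem_range {n : ℕ} (hn : 4 ≤ n) {p q : ℤ} (hp : p ≠ 0 ∧ -(n : ℤ) ≤ p ∧ p ≤ n)
    (hq : q ≠ 0 ∧ -(n : ℤ) ≤ q ∧ q ≤ n) (r : ℤ) (s : ℕ) :
    f n p p r s - f n q q r s ∈ LinearMap.range (piLin hn) := by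
  have main {p q : ℤ} (hp : p ≠ 0 ∧ -(n : ℤ) ≤ p ∧ p ≤ n)
      (hq : q ≠ 0 ∧ -(n : ℤ) ≤ q ∧ q ≤ n) (h1 : p ≠ q) (h2 : p ≠ -q) :
      f n p p r s - f n q q r s ∈ LinearMap.range (piLin hn) := by
    obtain ⟨α, x, -, -, -, h⟩ := lifts hn hp hq h1 r s
    obtain ⟨β, y, -, -, -, h'⟩ := lifts hn hq hp (Ne.symm h1) 0 0
    refine ⟨⁅x, y⁆, ?_⟩
    change ((piD hn ⁅x, y⁆ : slTau n) : Gl n) = _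
    rw [LieHom.map_lie, LieSubalgebra.coe_bracket, h, h', lie_f n p q q p r 0 s 0 hp hq hq hp,
      if_pos rfl, if_pos rfl, if_neg (by omega), if_neg h2, sub_self, smul_zero, sub_zero,
      add_zero, add_zero]
  obtain ⟨m, hm⟩ := exists_third hn p q p
  rw [← sub_add_sub_cancel _ (f n m m r s)]
  exact add_mem (main hp (by omega) (by omega) (by omega))
    (main (by omega) hq (by omega) (by omega))

/-- The linear map `1 + τ`. -/
def symTau (n : ℕ) : Gl n →ₗ[ℂ] Gl n where
  toFun M := M + tau n M
  map_add' A B := by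
    ext1 p q
    simp only [tau, Matrix.add_apply, Matrix.of_apply, map_add]
    ring
  map_smul' c A := by
    ext1 p q
    simp only [tau, Matrix.add_apply, Matrix.of_apply, Matrix.smul_apply, map_smul,
      RingHom.id_apply, smul_add, smul_neg]

theorem single_mono {n : ℕ} (p q : Idx n) (r : ℤ) (s : ℕ) :
    Matrix.single p q (mono r s) = E n p.1 q.1 r s := by
  ext1 i j
  have h1 : (p = i ∧ q = j) ↔ (i.1 = p.1 ∧ j.1 = q.1) := by
    rw [eq_comm, @eq_comm _ q, Subtype.ext_iff, Subtype.ext_iff]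
  simp only [Matrix.single, Matrix.of_apply, E]
  by_cases h : i.1 = p.1 ∧ j.1 = q.1
  · rw [if_pos h, if_pos (h1.2 h)]
  · rw [if_neg h, if_neg fun h' => h (h1.1 h')]

theorem symTau_E (n : ℕ) (p q r : ℤ) (s : ℕ) : symTau n (E n p q r s) = f n p q r s := by
  change E n p q r s + tau n (E n p q r s) = _
  rw [tau_E, f, sub_eq_add_neg]

theorem symTau_single_mem {n : ℕ} {R : Submodule ℂ (Gl n)} {p q : Idx n}
    (h : ∀ r s, f n p.1 q.1 r s ∈ R) (x : Coeff) : symTau n (Matrix.single p q x) ∈ R := by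
  refine map_mem_of_mono_mem (symTau n ∘ₗ Matrix.singleLinearMap ℂ p q) (fun r s => ?_) x
  have h1 : symTau n (Matrix.single p q (mono r s)) = f n p.1 q.1 r s := by
    rw [single_mono, symTau_E]
  exact h1 ▸ h r s

theorem symTau_single_sub_mem {n : ℕ} {R : Submodule ℂ (Gl n)} {p q : Idx n}
    (h : ∀ r s, f n p.1 p.1 r s - f n q.1 q.1 r s ∈ R) (x : Coeff) :
    symTau n (Matrix.single p p x - Matrix.single q q x) ∈ R := by
  have key (x : Coeff) : (symTau n ∘ₗ Matrix.singleLinearMap ℂ p p -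
      symTau n ∘ₗ Matrix.singleLinearMap ℂ q q) x =
        symTau n (Matrix.single p p x - Matrix.single q q x) := by
    rw [map_sub, LinearMap.sub_apply, LinearMap.comp_apply, LinearMap.comp_apply]
    rfl
  rw [← key]
  refine map_mem_of_mono_mem _ (fun r s => ?_) x
  rw [key, map_sub, single_mono, single_mono, symTau_E, symTau_E]
  exact h r s

/-- As the trace is zero, subtracting `∑ M_{p,p} E_{o,o} = 0` writes `M` through off-diagonal units
and differences `E_{p,p} - E_{o,o}`, whose symmetrizations are known to be in the range. -/
theorem symTau_mem {n : ℕ} (hn : 4 ≤ n) {M : Gl n} (hM : M.trace = 0) :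
    symTau n M ∈ LinearMap.range (piLin hn) := by
  have h0 : (1 : ℤ) ∈ (Finset.Icc (-(n : ℤ)) n).erase 0 := mem_idx.2 (by omega)
  set o : Idx n := ⟨1, h0⟩
  have h1 : ∑ p : Idx n, Matrix.single o o (M p p) = 0 := by
    have h2 : ∑ p : Idx n, Matrix.single o o (M p p) = Matrix.single o o M.trace :=
      (map_sum (Matrix.singleAddMonoidHom o o) (fun p => M p p) Finset.univ).symm
    rw [h2, hM, Matrix.single_zero]
  have h2 : M = ∑ p : Idx n, ((Matrix.single p p (M p p) - Matrix.single o o (M p p)) +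
      ∑ q ∈ Finset.univ.erase p, Matrix.single p q (M p q)) := by
    conv_lhs => rw [Matrix.matrix_eq_sum_single M, ← sub_zero (∑ p, _), ← h1,
      ← Finset.sum_sub_distrib]
    refine Finset.sum_congr rfl fun p _ => ?_
    rw [← Finset.add_sum_erase _ _ (Finset.mem_univ p), add_sub_right_comm]
  rw [h2, map_sum]
  refine sum_mem fun p _ => ?_
  rw [map_add, map_sum]
  exact add_mem
    (symTau_single_sub_mem (f_sub_f_mem_range hn (mem_idx.1 p.2) (mem_idx.1 o.2)) _)
    (sum_mem fun q hq => symTau_single_mem (f_mem_range hn (mem_idx.1 p.2) (mem_idx.1 q.2)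
      fun h => Finset.ne_of_mem_erase hq (Subtype.ext h.symm)) _)

/-- A matrix fixed by `τ` is half of its own symmetrization. -/
theorem piD_surjective {n : ℕ} (hn : 4 ≤ n) : Function.Surjective (piD hn) := by
  rintro ⟨M, hM, hM'⟩
  have h : (2 : ℂ) • M = symTau n M := by
    change _ = M + tau n M
    rw [hM', two_smul]
  have h1 : M ∈ LinearMap.range (piLin hn) := by
    rw [← inv_smul_smul₀ (two_ne_zero (α := ℂ)) M, h]
    exact Submodule.smul_mem _ _ (symTau_mem hn hM)
  obtain ⟨x, hx⟩ := h1
  exact ⟨x, Subtype.ext hx⟩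

end TwistedD

end

theorem mainTheorem2 (n : ℕ) (hn : 4 ≤ n) :
    DirectSum.IsInternal (fun d : TwistedD.Q n × ℕ => TwistedD.piece n d.1 d.2) ∧
    (∀ α ∈ TwistedD.extRoots n, (∀ m : ℤ, α ≠ m • TwistedD.delta n) → ∀ k : ℕ,
      (α ∈ TwistedD.roots n → Module.rank ℂ (TwistedD.piece n α k) = 1) ∧
      (α ∉ TwistedD.roots n → Odd k → Module.rank ℂ (TwistedD.piece n α k) = 1) ∧
      (α ∉ TwistedD.roots n → Even k → Module.rank ℂ (TwistedD.piece n α k) = 0)) ∧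
    (∀ α ∉ TwistedD.extRoots n, α ≠ 0 → ∀ k : ℕ,
      Module.rank ℂ (TwistedD.piece n α k) = 0) ∧
    ∃ π : TwistedD.D n →ₗ⁅ℂ⁆ TwistedD.slTau n,
      (∀ g : TwistedD.Gen n, (π (TwistedD.toD n (FreeLieAlgebra.of ℂ g)) : TwistedD.Gl n) =
        TwistedD.image n g.1) ∧
      Function.Surjective π ∧
      π.ker ≤ LieAlgebra.center ℂ (TwistedD.D n) := by
  -- An element whose `ε`-coordinates all vanish is a multiple of `δ`, so the exclusion of `ℤδ`
  -- provides a non-zero `ε`-coordinate.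
  have him {α : TwistedD.Q n} (h : ∀ m : ℤ, α ≠ m • TwistedD.delta n) : ¬ TwistedD.IsImag n α :=
    fun h' => h _ (h'.eq_smul_delta hn)
  refine ⟨TwistedD.isInternal_piece hn, fun α hα hδ k => ⟨fun h => ?_, fun h hk => ?_,
    fun h hk => ?_⟩, fun α hα h0 k => ?_, TwistedD.piD hn, fun g => ?_,
    TwistedD.piD_surjective hn, TwistedD.ker_piD_le_center hn⟩
  · obtain ⟨p, q, hp, hq, h1, h2, hw⟩ := TwistedD.exists_isWt_of_mem_roots hn (him hδ) h
    exact TwistedD.rank_piece_eq_one hn hp hq h2 (Or.inl h1) hw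
  · obtain ⟨p, hp, hw⟩ := TwistedD.exists_isWt_of_mem_extRoots hn hα h
    exact TwistedD.rank_piece_eq_one hn hp hp (by omega) (Or.inr hk) hw
  · rw [TwistedD.piece_eq_bot_of_even hn (him hδ) h hk, rank_bot]
  · rw [TwistedD.piece_eq_bot_of_not_mem_extRoots hn hα h0, rank_bot]
  · rw [TwistedD.coe_piD_toD, TwistedD.phi, FreeLieAlgebra.lift_of_apply]
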